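/- **Definitions.** Bimodal formulas are built from the propositional variables $x_0,x_1,x_2,\dots$ by $\neg\varphi$, $(\varphi\wedge\psi)$, $K\varphi$, $\Box\varphi$; $\mathcal L$ is the set of them, $\varphi\vee\psi:=\neg(\neg\varphi\wedge\neg\psi)$, $\varphi\to\psi:=\neg\varphi\vee\psi$, and $\mathrm{sf}(\varphi)$ is the set of subformulas of $\varphi$. Formulas are strings over $\Sigma=\{(,),\neg,\Box,K,\wedge,x,0,1\}$, where $x_i$ is written $x\,\mathrm{bin}(i)$ with $\mathrm{bin}(i)$ the usual binary representation of $i$ (and $\mathrm{bin}(0)=0$). A model is $M=(W,\stackrel{\Diamond}{\to},\stackrel{L}{\to},\sigma)$ with binary relations $\stackrel{\Diamond}{\to},\stackrel{L}{\to}$ on the set $W$ and $\sigma(x_i)\subseteq W$ for all $i$. Satisfaction $M,w\models\varphi$ is as usual, $\Box$ quantifying over all $\stackrel{\Diamond}{\to}$-successors and $K$ over all $\stackrel{L}{\to}$-successors. * $M$ is a *cross axiom model* if $\stackrel{\Diamond}{\to}$ is a preorder, $\stackrel{L}{\to}$ is an equivalence relation, left commutativity holds (if $p\stackrel{\Diamond}{\to}q\stackrel{L}{\to}r$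 then $p\stackrel{L}{\to}p'\stackrel{\Diamond}{\to}r$ for some $p'$), and every variable $A$ is persistent: $p\stackrel{\Diamond}{\to}q$ implies ($p\in\sigma(A)\iff q\in\sigma(A)$). * $M$ is an *$\mathrm{S4\times S5}$-commutator model* if $\stackrel{\Diamond}{\to}$ is a preorder, $\stackrel{L}{\to}$ is an equivalence relation, and left commutativity and right commutativity (if $p\stackrel{L}{\to}q\stackrel{\Diamond}{\to}r$ then $p\stackrel{\Diamond}{\to}p'\stackrel{L}{\to}r$ for some $p'$) hold. * $M$ is an *$\mathrm{S4\times S5}$-product model* if $W=W_1\times W_2$ and there are a preorder $R_1$ on $W_1$ and an equivalence relation $R_2$ on $W_2$ with $(a,b)\stackrel{\Diamond}{\to}(a',b')\iff aR_1a'$ and $b=b'$, and $(a,b)\stackrel{L}{\to}(a',b')\iff a=a'$ and $bR_2b'$. A formula is *$\mathrm{SSL}$-satisfiable* if it holds at some point of some cross axiom model, and *$\mathrm{S4\times S5}$-satisfiable* if it holds at some point of some $\mathrm{S4\times S5}$-product model. A function on strings is *logspace computable* (a language is *decidable in logarithmic space*) if this is done by a deterministic Turing machine with a two-way read-only input tape,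 finitely many work tapes and a one-way write-only output tape (respectively, accepting states) that halts on every input and visits $O(\log n)$ work tape cells on inputs of length $n$. For $\varphi\in\mathcal L$ let $\mathrm{main}$ be the variable $x_i$ with the least $i$ such that $x_i\notin\mathrm{sf}(\varphi)$. Define $T$ recursively by $$T(A)=A,\quad T(\neg\psi)=\neg T(\psi),\quad T((\psi_1\wedge\psi_2))=(T(\psi_1)\wedge T(\psi_2)),$$ $$T(K\psi)=K\neg(\mathrm{main}\wedge\neg T(\psi)),\qquad T(\Box\psi)=\Box\neg(\mathrm{main}\wedge\neg T(\psi)),$$ and let $$\mathit{persistent}_{\mathrm{main}}:=\bigwedge_{A}K\bigl(\Box(\mathrm{main}\to A)\vee\Box(\mathrm{main}\to\neg A)\bigr),$$ where $A$ runs through the variables in $\mathrm{sf}(\varphi)$ in the order of their first occurrence in $\varphi$, and $$\widehat T(\varphi):=\mathrm{main}\wedge K\Box(\neg\mathrm{main}\to\Box\neg\mathrm{main})\wedge\mathit{persistent}_{\mathrm{main}}\wedge T(\varphi),$$ iterated conjunctions being bracketed to the right. Let $\widetilde T:\Sigma^*\to\Sigma^*$ be the function with $\widetilde T(\varphi)=\widehat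 T(\varphi)$ for $\varphi\in\mathcal L$ and $\widetilde T(w)=\wedge$ for $w\notin\mathcal L$. **Theorem.** 1. For every $\varphi\in\mathcal L$, $\varphi$ is $\mathrm{SSL}$-satisfiable if and only if $\widehat T(\varphi)$ is $\mathrm{S4\times S5}$-satisfiable, and also if and only if $\widehat T(\varphi)$ holds at some point of some $\mathrm{S4\times S5}$-commutator model. 2. The language $\mathcal L\subseteq\Sigma^*$ is decidable in logarithmic space. 3. The function $\widetilde T$ is well defined (every formula is determined by its string) and logspace computable, and for every $w\in\Sigma^*$, $$w\in\mathcal L\text{ and }w\text{ is }\mathrm{SSL}\text{-satisfiable}\iff\widetilde T(w)\in\mathcal L\text{ and }\widetilde T(w)\text{ is }\mathrm{S4\times S5}\text{-satisfiable}.$$ Hence the satisfiability problem of $\mathrm{SSL}$ can be reduced in logarithmic space to the satisfiability problem of $\mathrm{S4\times S5}$. -/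

import Mathlib

namespace Bimodal

/-! ### Bimodal formulas -/

/-- Bimodal formulas over the propositional variables `x_0, x_1, x_2, …`. -/
inductive Formula : Type
  | var : ℕ → Formula
  | neg : Formula → Formula
  | and : Formula → Formula → Formula
  | K : Formula → Formula
  | box : Formula → Formula
  deriving DecidableEq

namespace Formula

/-- `φ ∨ ψ` abbreviates `¬(¬φ ∧ ¬ψ)`. -/
def or (φ ψ : Formula) : Formula := neg (and (neg φ) (neg ψ))

/-- `φ → ψ` abbreviates `¬φ ∨ ψ`. -/
def imp (φ ψ : Formula) : Formula := or (neg φ) ψ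

/-- The set `sf(φ)` of subformulas of `φ` (including `φ`). -/
def sf : Formula → Finset Formula
  | var n => {var n}
  | neg φ => insert (neg φ) (sf φ)
  | and φ ψ => insert (and φ ψ) (sf φ ∪ sf ψ)
  | K φ => insert (K φ) (sf φ)
  | box φ => insert (box φ) (sf φ)

/-- The indices of the propositional variables of `φ`, without repetition, in the order of
their first occurrence (from left to right) in `φ`. -/
def vars : Formula → List ℕ
  | var n => [n]
  | neg φ => vars φ
  | and φ ψ => vars φ ++ (vars ψ).filter (fun n => n ∉ vars φ)
  | K φ => vars φ
  | box φ => vars φ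

/-- `vars φ` lists exactly the elements of `AT ∩ sf(φ)`. -/
theorem mem_vars_iff (φ : Formula) (n : ℕ) : n ∈ φ.vars ↔ var n ∈ φ.sf := by
  induction φ with
  | var m => simp [vars, sf]
  | neg φ ih => simp [vars, sf, ih]
  | and φ ψ ih₁ ih₂ => simp [vars, sf, ← ih₁, ← ih₂]; tauto
  | K φ ih => simp [vars, sf, ih]
  | box φ ih => simp [vars, sf, ih]

theorem vars_nodup (φ : Formula) : φ.vars.Nodup := by
  induction φ with
  | var m => simp [vars]
  | neg φ ih => exact ih
  | and φ ψ ih₁ ih₂ =>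
    refine List.Nodup.append ih₁ (ih₂.filter _) ?_
    intro a ha hb
    simp at hb
    exact hb.2 ha
  | K φ ih => exact ih
  | box φ ih => exact ih

theorem exists_fresh (φ : Formula) : ∃ n, var n ∉ φ.sf := by
  obtain ⟨n, hn⟩ := Infinite.exists_notMem_finset φ.vars.toFinset
  exact ⟨n, fun h => hn (by simpa using (mem_vars_iff φ n).2 h)⟩

/-- The index of the variable `main` for `φ`: the first variable that is not a subformula
of `φ`. -/
def mainIdx (φ : Formula) : ℕ := Nat.find (exists_fresh φ)

/-- Conjunction of a nonempty list of formulas, bracketed to the right. (The value on the empty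
list is a tautology; it is never used below, because every formula contains a variable.) -/
def bigAnd : List Formula → Formula
  | [] => neg (and (var 0) (neg (var 0)))
  | [φ] => φ
  | φ :: ψ :: l => and φ (bigAnd (ψ :: l))

/-- The translation `T`, relative to the formula `m` that plays the role of `main`. -/
def T (m : Formula) : Formula → Formula
  | var n => var n
  | neg φ => neg (T m φ)
  | and φ ψ => and (T m φ) (T m ψ)
  | K φ => K (neg (and m (neg (T m φ))))
  | box φ => box (neg (and m (neg (T m φ))))

/-- The conjunction over all variables `A` of `φ` of `K(□(m → A) ∨ □(m → ¬A))`. -/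
def persistent (m φ : Formula) : Formula :=
  bigAnd (φ.vars.map fun n =>
    K (or (box (imp m (var n))) (box (imp m (neg (var n))))))

/-- The translation `T̂`:
`main ∧ K□(¬main → □¬main) ∧ persistent_main ∧ T(φ)`. -/
def That (φ : Formula) : Formula :=
  let m := var (mainIdx φ)
  and m (and (K (box (imp (neg m) (box (neg m))))) (and (persistent m φ) (T m φ)))

end Formula

/-! ### Models and satisfiability -/

/-- A set of points with two accessibility relations and a valuation. -/
structure Model where
  W : Type
  dia : W → W → Prop
  ell : W → W → Prop
  val : ℕ → Set W

/-- `M, w ⊨ φ`; the operator `□` belongs to the relation `dia`, the operator `K` to `ell`. -/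
def Model.Sat (M : Model) : M.W → Formula → Prop
  | w, .var n => w ∈ M.val n
  | w, .neg φ => ¬ M.Sat w φ
  | w, .and φ ψ => M.Sat w φ ∧ M.Sat w ψ
  | w, .K φ => ∀ v, M.ell w v → M.Sat v φ
  | w, .box φ => ∀ v, M.dia w v → M.Sat v φ

def IsPreorderRel {W : Type} (R : W → W → Prop) : Prop :=
  (∀ a, R a a) ∧ ∀ a b c, R a b → R b c → R a c

def Model.LeftCommutative (M : Model) : Prop :=
  ∀ p q r, M.dia p q → M.ell q r → ∃ p', M.ell p p' ∧ M.dia p' r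

def Model.RightCommutative (M : Model) : Prop :=
  ∀ p q r, M.ell p q → M.dia q r → ∃ p', M.dia p p' ∧ M.ell p' r

/-- Cross axiom models: a preorder and an equivalence relation with left commutativity (the cross
property), in which all propositional variables are persistent along the preorder. -/
def Model.IsCrossAxiom (M : Model) : Prop :=
  IsPreorderRel M.dia ∧ Equivalence M.ell ∧ M.LeftCommutative ∧
    ∀ n p q, M.dia p q → (p ∈ M.val n ↔ q ∈ M.val n)

/-- `S4×S5`-commutator models: a preorder and an equivalence relation with left and right
commutativity. -/
def Model.IsS4S5Commutator (M : Model) : Prop :=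
  IsPreorderRel M.dia ∧ Equivalence M.ell ∧ M.LeftCommutative ∧ M.RightCommutative

/-- The product of two frames with a valuation: the first relation acts on the first coordinate
as `dia`, the second one acts on the second coordinate as `ell`. -/
def productModel {W₁ W₂ : Type} (R₁ : W₁ → W₁ → Prop) (R₂ : W₂ → W₂ → Prop)
    (σ : ℕ → Set (W₁ × W₂)) : Model where
  W := W₁ × W₂
  dia p q := R₁ p.1 q.1 ∧ p.2 = q.2
  ell p q := p.1 = q.1 ∧ R₂ p.2 q.2
  val := σ

/-- Satisfiability at a point of a cross axiom model. -/
def SSLSatisfiable (φ : Formula) : Prop :=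
  ∃ M : Model, M.IsCrossAxiom ∧ ∃ w : M.W, M.Sat w φ

/-- Satisfiability at a point of an `S4×S5`-product model. -/
def S4S5Satisfiable (φ : Formula) : Prop :=
  ∃ (W₁ W₂ : Type) (R₁ : W₁ → W₁ → Prop) (R₂ : W₂ → W₂ → Prop) (σ : ℕ → Set (W₁ × W₂)),
    IsPreorderRel R₁ ∧ Equivalence R₂ ∧
      ∃ w : (productModel R₁ R₂ σ).W, (productModel R₁ R₂ σ).Sat w φ

/-- Satisfiability at a point of an `S4×S5`-commutator model. -/
def S4S5CommutatorSatisfiable (φ : Formula) : Prop :=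
  ∃ M : Model, M.IsS4S5Commutator ∧ ∃ w : M.W, M.Sat w φ

/-! ### Formulas as strings -/

/-- The nine-letter alphabet `(`, `)`, `¬`, `□`, `K`, `∧`, `x`, `0`, `1`. -/
inductive Sym : Type
  | lpar | rpar | neg | box | K | and | x | zero | one
  deriving DecidableEq

/-- The usual binary representation, most significant bit first, without leading zeros, and with
`bin 0` the one-letter string `0`. -/
def bin (n : ℕ) : List Sym :=
  if n = 0 then [Sym.zero] else n.bits.reverse.map fun b => if b then Sym.one else Sym.zero

/-- The string that a formula is written as. -/
def Formula.str : Formula → List Sym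
  | .var n => Sym.x :: bin n
  | .neg φ => Sym.neg :: φ.str
  | .and φ ψ => Sym.lpar :: (φ.str ++ Sym.and :: (ψ.str ++ [Sym.rpar]))
  | .K φ => Sym.K :: φ.str
  | .box φ => Sym.box :: φ.str

/-- The language of all strings that are bimodal formulas. -/
def formulaLanguage : Language Sym := {w | ∃ φ : Formula, φ.str = w}

/-- The satisfiability problem belonging to a notion `P` of satisfiability. -/
def satProblem (P : Formula → Prop) : Language Sym := {w | ∃ φ : Formula, φ.str = w ∧ P φ}

open Classical in
/-- The translation `T̂` as a function on all strings; strings that are not formulas are mapped to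
the string `∧`. -/
noncomputable def stringTranslation (w : List Sym) : List Sym :=
  if h : ∃ φ : Formula, φ.str = w then h.choose.That.str else [Sym.and]

/-! ### Turing machines with a read-only input tape, and logarithmic space -/

/-- Contents of a cell of the input tape: an end marker or a letter of the input word. -/
inductive InCell (α : Type) : Type
  | leftEnd : InCell α
  | letter : α → InCell α
  | rightEnd : InCell α

inductive Move : Type
  | left | stay | right

/-- What a machine does in one step: new state, move of the input head, symbols written to the work
tapes, moves of the work heads, and possibly one letter written to the output tape. -/
structure Action (β Q ι Γ : Type) where
  next : Q
  inMove : Move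
  write : ι → Γ
  workMove : ι → Move
  emit : Option β

/-- A deterministic Turing machine with a two-way read-only input tape over `α`, finitely many
read-write work tapes (indexed by `ι`), and a one-way write-only output tape over `β`. It halts when
`δ` returns `none`. The set `accept` is relevant only for machines that decide languages. -/
structure Machine (α β : Type) where
  Q : Type
  finQ : Finite Q
  ι : Type
  finι : Finite ι
  Γ : Type
  finΓ : Finite Γ
  blank : Γ
  start : Q
  accept : Set Q
  δ : Q → InCell α → (ι → Γ) → Option (Action β Q ι Γ)

namespace Machine

variable {α β : Type}

/-- A configuration. Input cell `0` holds the left end marker, input cell `i + 1` the `i`-th letter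
of the input; the work tapes are one-way infinite. -/
structure Cfg (M : Machine α β) where
  state : M.Q
  inHead : ℕ
  head : M.ι → ℕ
  tape : M.ι → ℕ → M.Γ
  out : List β

def init (M : Machine α β) : M.Cfg where
  state := M.start
  inHead := 0
  head _ := 0
  tape _ _ := M.blank
  out := []

def inCell (w : List α) : ℕ → InCell α
  | 0 => .leftEnd
  | i + 1 => match w[i]? with
    | some a => .letter a
    | none => .rightEnd

/-- New position of a head; a head in the leftmost cell stays there when told to move left. -/
def moveHead (p : ℕ) : Move → ℕ
  | .left => p - 1
  | .stay => p
  | .right => p + 1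

/-- One step on input `w`; `none` if the machine has halted. The input head never leaves the cells
`0, …, |w| + 1`. -/
def step (M : Machine α β) (w : List α) (c : M.Cfg) : Option M.Cfg :=
  (M.δ c.state (inCell w c.inHead) fun i => c.tape i (c.head i)).map fun a =>
    { state := a.next
      inHead := min (moveHead c.inHead a.inMove) (w.length + 1)
      head := fun i => moveHead (c.head i) (a.workMove i)
      tape := fun i => Function.update (c.tape i) (c.head i) (a.write i)
      out := c.out ++ a.emit.toList }

/-- On input `w` only the first `s` cells of every work tape are visited. -/
def SpaceBound (M : Machine α β) (w : List α) (s : ℕ) : Prop :=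
  ∀ c : M.Cfg, StateTransition.Reaches (M.step w) M.init c → ∀ i, c.head i < s

/-- On input `w` the machine halts, and does so in configuration `c`. -/
def HaltsIn (M : Machine α β) (w : List α) (c : M.Cfg) : Prop :=
  c ∈ StateTransition.eval (M.step w) M.init

/-- The machine works in space `O(log n)`, where `n` is the length of the input. -/
def Logspace (M : Machine α β) : Prop :=
  ∃ C : ℕ, ∀ w : List α, M.SpaceBound w (C * (Nat.log 2 w.length + 1))

end Machine

/-- `f` is computed by a machine working in logarithmic space. -/
def LogspaceComputable {α β : Type} (f : List α → List β) : Prop :=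
  ∃ M : Machine α β, M.Logspace ∧ ∀ w, ∃ c, M.HaltsIn w c ∧ c.out = f w

/-- `L` is decided by a machine working in logarithmic space. -/
def LogspaceDecidable {α : Type} (L : Language α) : Prop :=
  ∃ M : Machine α Empty, M.Logspace ∧ ∀ w, ∃ c, M.HaltsIn w c ∧ (c.state ∈ M.accept ↔ w ∈ L)

/-- Many-one reducibility by functions computable in logarithmic space. -/
def LogspaceReducible {α β : Type} (A : Language α) (B : Language β) : Prop :=
  ∃ f : List α → List β, LogspaceComputable f ∧ ∀ w, w ∈ A ↔ f w ∈ B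

end Bimodal

namespace Bimodal

open Formula

/-! ### From commutator models to cross axiom models -/

/-! Correctness. `That φ` makes `main` mark a part of the frame, and `T` relativises both modalities
to that part. Given a commutator model of `That φ`, keep the points that satisfy `main` and are
reached from the given point by an `ell`-step followed by a `dia`-step. Since `¬main` is inherited
upwards, left commutativity survives the restriction, and the persistence clause makes the variables
of `φ` persistent (`sslSatisfiable_of_commutator`).

Conversely, a cross axiom model is unfolded into a product. The first factor is the tree of finite
sequences of labels `(q, n)` with `q` a point and `n` a number; the second is the set of coherent
partial maps `g` from the tree to the model, all related to each other. The pair `(a, g)` stands for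
the point `g a`, and `main` says that `g a` is defined. Partiality is what reconciles a model
without right commutativity with a product: a map need not follow another one up the tree. For `K`,
every point of the `ell`-class of `g a` has to be the value at `a` of some map. This is
`Coherent.exists_of_ell`, where left commutativity carries an `ell`-step down towards the root. The
infinitely many copies `n` of each label allow the value at one node to be altered while each
`dia`-successor still appears at some child.

Space. The usual parser needs a stack, but only two facts about it: the state of the innermost open
parenthesis, and the number of modal operators whose scope ends at the current letter. Both are
recomputed from the prefix by a backward scan with one counter (`top`, `closers`). A finite control
and a fixed number of integers bounded by the input length plus two therefore suffice. `accepts_iff`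
shows that the parser recognises the formulas, and `str_That` writes the translation as a
concatenation of passes over the input.

The machines are composed from fragments with exit values. `Spec` describes their effect on the
numbers on the tapes, including the space bound, and `exists_machine` turns a specified fragment
into a machine. The index of `main` fits on a tape by `mainIdx_le`. -/

theorem sat_or (M : Model) (w : M.W) (φ ψ : Formula) :
    M.Sat w (or φ ψ) ↔ M.Sat w φ ∨ M.Sat w ψ := by
  simp only [Formula.or, Model.Sat]; tauto

theorem sat_imp (M : Model) (w : M.W) (φ ψ : Formula) :
    M.Sat w (imp φ ψ) ↔ (M.Sat w φ → M.Sat w ψ) := by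
  simp only [Formula.imp, sat_or, Model.Sat]; tauto

theorem sat_bigAnd (M : Model) (w : M.W) (l : List Formula) :
    M.Sat w (bigAnd l) ↔ ∀ φ ∈ l, M.Sat w φ := by
  induction l with
  | nil => simp [bigAnd, Model.Sat]
  | cons φ l ih =>
    cases l with
    | nil => simp [bigAnd]
    | cons ψ l => simp only [bigAnd, Model.Sat, ih]; simp

theorem sat_persistent (M : Model) (w : M.W) (m φ : Formula) :
    M.Sat w (persistent m φ) ↔ ∀ n ∈ φ.vars, ∀ u, M.ell w u →
      (∀ v, M.dia u v → M.Sat v m → M.Sat v (var n)) ∨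
      (∀ v, M.dia u v → M.Sat v m → ¬ M.Sat v (var n)) := by
  simp [persistent, sat_bigAnd, Model.Sat, sat_or, sat_imp]

theorem sat_That (M : Model) (w : M.W) (φ : Formula) :
    M.Sat w φ.That ↔ M.Sat w (var φ.mainIdx) ∧
      (∀ u, M.ell w u → ∀ v, M.dia u v → ¬ M.Sat v (var φ.mainIdx) →
        ∀ x, M.dia v x → ¬ M.Sat x (var φ.mainIdx)) ∧
      M.Sat w (persistent (var φ.mainIdx) φ) ∧ M.Sat w (T (var φ.mainIdx) φ) := by
  simp only [That, Model.Sat, sat_imp]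

theorem mainIdx_notMem (φ : Formula) : φ.mainIdx ∉ φ.vars := fun h =>
  Nat.find_spec (exists_fresh φ) ((mem_vars_iff _ _).1 h)

theorem sslSatisfiable_of_commutator {φ : Formula} (h : S4S5CommutatorSatisfiable φ.That) :
    SSLSatisfiable φ := by
  obtain ⟨M, ⟨⟨hr, ht⟩, he, hl, -⟩, w, hw⟩ := h
  obtain ⟨hm, hmain, hp, hT⟩ := (sat_That _ _ _).1 hw
  rw [sat_persistent] at hp
  set m := var φ.mainIdx
  -- The points reachable by `ell` and then `dia` are closed under `ell` by left commutativity and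
  -- under `dia` by transitivity. So a step out of `D` can only lead to a point where `main` fails,
  -- and these are the points that `T` ignores.
  let D : Set M.W := {v | M.Sat v m ∧ ∃ u, M.ell w u ∧ M.dia u v}
  let N : Model :=
    { W := D
      dia := fun p q => M.dia p q
      ell := fun p q => M.ell p q
      -- Variables foreign to `φ` are made false everywhere, since `hp` gives no persistence for
      -- them.
      val := fun n => {p | n ∈ φ.vars ∧ p.1 ∈ M.val n} }
  have hreach : ∀ v ∈ D, ∀ x, M.ell v x → ∃ u, M.ell w u ∧ M.dia u x := by
    rintro v ⟨-, u, hu, huv⟩ x hvx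
    obtain ⟨u', h1, h2⟩ := hl _ _ _ huv hvx
    exact ⟨u', he.trans hu h1, h2⟩
  have hreach' : ∀ v ∈ D, ∀ x, M.dia v x → ∃ u, M.ell w u ∧ M.dia u x := by
    rintro v ⟨-, u, hu, huv⟩ x hvx
    exact ⟨u, hu, ht _ _ _ huv hvx⟩
  have key : ∀ ψ : Formula, (∀ n ∈ ψ.vars, n ∈ φ.vars) → ∀ v : D,
      N.Sat v ψ ↔ M.Sat v.1 (T m ψ) := by
    intro ψ
    induction ψ with
    | var n => intro h v; simp [N, Model.Sat, T, h n (by simp [vars])]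
    | neg ψ ih => intro h v; simp only [Model.Sat, T, ih h]
    | and ψ χ ih₁ ih₂ =>
      intro h v
      simp only [Model.Sat, T]
      rw [ih₁ fun n hn => h n (by simp [vars, hn]), ih₂ fun n hn => h n ?_]
      simp only [vars, List.mem_append, List.mem_filter]
      by_cases h' : n ∈ ψ.vars <;> simp [h', hn]
    | K ψ ih =>
      intro h v
      simp only [Model.Sat, T]
      constructor
      · rintro hv x hx ⟨h1, h2⟩
        exact h2 ((ih h ⟨x, h1, hreach _ v.2 _ hx⟩).1 (hv ⟨x, _⟩ hx))
      · intro hv x hx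
        rw [ih h]
        by_contra h2
        exact hv x.1 hx ⟨x.2.1, h2⟩
    | box ψ ih =>
      intro h v
      simp only [Model.Sat, T]
      constructor
      · rintro hv x hx ⟨h1, h2⟩
        exact h2 ((ih h ⟨x, h1, hreach' _ v.2 _ hx⟩).1 (hv ⟨x, _⟩ hx))
      · intro hv x hx
        rw [ih h]
        by_contra h2
        exact hv x.1 hx ⟨x.2.1, h2⟩
  refine ⟨N, ⟨⟨fun a => hr _, fun a b c => ht _ _ _⟩,
    ⟨fun a => he.refl _, fun h => he.symm h, fun h h' => he.trans h h'⟩, ?_, ?_⟩,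
    ⟨w, hm, w, he.refl _, hr _⟩, (key φ (fun _ h => h) _).2 hT⟩
  · intro p q r hpq hqr
    obtain ⟨p', h1, h2⟩ := hl _ _ _ hpq hqr
    obtain ⟨u, hu, hup⟩ := hreach _ p.2 _ h1
    refine ⟨⟨p', ?_, u, hu, hup⟩, h1, h2⟩
    -- If `main` failed at `p'`, it would fail at `r` as well, against `r ∈ D`.
    by_contra hp'
    exact hmain u hu p' hup hp' _ h2 r.2.1
  · intro n p q hpq
    obtain ⟨u, hu, hup⟩ := p.2.2
    have huq := ht _ _ _ hup hpq
    change (n ∈ φ.vars ∧ M.Sat p.1 (var n)) ↔ (n ∈ φ.vars ∧ M.Sat q.1 (var n))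
    refine and_congr_right fun hn => ?_
    -- Both `p` and `q` lie above the same `u` in the class of `w`, so one disjunct settles the
    -- variable at both of them.
    rcases hp n hn u hu with h | h
    · exact iff_of_true (h _ hup p.2.1) (h _ huq q.2.1)
    · exact iff_of_false (h _ hup p.2.1) (h _ huq q.2.1)

/-! ### From cross axiom models to product models -/

/-- A partial map from the tree of finite sequences of labelled points to a model, defined on a
subtree, monotone, staying in the cloud of the label of each node, and such that every
`dia`-successor of a value is a value at almost all of the children labelled with it. -/
structure Coherent (M : Model) (w : M.W) (g : List (M.W × ℕ) → Option M.W) : Prop where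
  root : ∀ p, g [] = some p → M.ell w p
  child : ∀ t a q, g (t :: a) = some q → ∃ p, g a = some p ∧ M.dia p q ∧ M.ell t.1 q
  saturated : ∀ a p q, g a = some p → M.dia p q →
    ∃ N, ∀ n, N ≤ n → g ((q, n) :: a) = some q

namespace Coherent

variable {M : Model} {w : M.W} {g : List (M.W × ℕ) → Option M.W}

theorem dia_of_suffix (hM : M.IsCrossAxiom) (hg : Coherent M w g) {a b : List (M.W × ℕ)}
    (hab : a <:+ b) : ∀ q, g b = some q → ∃ p, g a = some p ∧ M.dia p q := by
  obtain ⟨c, rfl⟩ := hab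
  induction c with
  | nil => exact fun q hq => ⟨q, hq, hM.1.1 q⟩
  | cons t c ih =>
    intro q hq
    obtain ⟨p, hp, hpq, -⟩ := hg.child _ _ _ hq
    obtain ⟨p', hp', h⟩ := ih p hp
    exact ⟨p', hp', hM.1.2 _ _ _ h hpq⟩

/-- The label of a node (at the root, the point `w`) fixes the `ell`-class of all values taken
there. Hence changing the map at a fixed node is an `ell`-step in the model. -/
theorem ell_of_eq (hM : M.IsCrossAxiom) {g' : List (M.W × ℕ) → Option M.W} (hg : Coherent M w g)
    (hg' : Coherent M w g') {a : List (M.W × ℕ)} {p q : M.W} (hp : g a = some p)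
    (hq : g' a = some q) : M.ell p q := by
  cases a with
  | nil => exact hM.2.1.trans (hM.2.1.symm (hg.root _ hp)) (hg'.root _ hq)
  | cons t a =>
    obtain ⟨_, _, _, h⟩ := hg.child _ _ _ hp
    obtain ⟨_, _, _, h'⟩ := hg'.child _ _ _ hq
    exact hM.2.1.trans (hM.2.1.symm h) h'

open Classical in
/-- The extension of a value at a node `a` to the nodes above `a`: each node takes its label as
value whenever that is possible. -/
noncomputable def fill (M : Model) (a : List (M.W × ℕ)) (r : M.W)
    (g : List (M.W × ℕ) → Option M.W) : List (M.W × ℕ) → Option M.W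
  | [] => if a = [] then some r else g []
  | t :: x => if t :: x = a then some r else
      if a <:+ x then
        if ∃ p, fill M a r g x = some p ∧ M.dia p t.1 then some t.1 else none
      else g (t :: x)

theorem fill_self (a : List (M.W × ℕ)) (r : M.W) : fill M a r g a = some r := by
  cases a <;> simp [fill]

theorem fill_of_not_suffix {a x : List (M.W × ℕ)} (r : M.W) (h : ¬ a <:+ x) :
    fill M a r g x = g x := by
  cases x with
  | nil => simp only [fill]; rw [if_neg]; rintro rfl; simp at h
  | cons t x =>
    simp only [fill]
    rw [if_neg, if_neg]
    · exact fun h' => h (h'.trans (List.suffix_cons _ _))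
    · rintro rfl; simp at h

theorem fill_of_suffix {a x : List (M.W × ℕ)} (r : M.W) (t : M.W × ℕ) (h : a <:+ x) :
    fill M a r g (t :: x) = some t.1 ∧ (∃ p, fill M a r g x = some p ∧ M.dia p t.1) ∨
    fill M a r g (t :: x) = none ∧ ¬ (∃ p, fill M a r g x = some p ∧ M.dia p t.1) := by
  have hne : t :: x ≠ a := by
    rintro rfl
    have := h.length_le
    simp at this
  simp only [fill, if_neg hne, if_pos h]
  split_ifs with h' <;> simp [h']

/-- Above `a` the labels themselves provide saturation without exceptions. At the parent of `a` only
one child is altered, which a condition on almost all copies tolerates. For `a = []` nothing of `g`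
is left, hence the conditional form of `hg`. -/
theorem coherent_fill (hM : M.IsCrossAxiom) {a : List (M.W × ℕ)} {r : M.W}
    (hg : a ≠ [] → Coherent M w g) (h0 : a = [] → M.ell w r)
    (h1 : ∀ t x, a = t :: x → ∃ p, g x = some p ∧ M.dia p r ∧ M.ell t.1 r) :
    Coherent M w (fill M a r g) := by
  constructor
  · intro p hp
    by_cases ha : a = []
    · simp only [fill, if_pos ha, Option.some.injEq] at hp
      exact hp ▸ h0 ha
    · simp only [fill, if_neg ha] at hp
      exact (hg ha).root _ hp
  · intro t x q hq
    by_cases hx : a <:+ x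
    · rcases fill_of_suffix (g := g) r t hx with ⟨h, p, hp, hd⟩ | ⟨h, -⟩
      · rw [h] at hq
        cases hq
        exact ⟨p, hp, hd, hM.2.1.refl _⟩
      · rw [h] at hq; cases hq
    · rw [fill_of_not_suffix r hx]
      by_cases ha : t :: x = a
      · rw [ha, fill_self] at hq
        cases hq
        exact h1 t x ha.symm
      · have : ¬ a <:+ t :: x := by
          intro h
          rcases List.suffix_cons_iff.1 h with h | h
          · exact ha h.symm
          · exact hx h
        rw [fill_of_not_suffix r this] at hq
        exact (hg (by rintro rfl; simp at hx)).child _ _ _ hq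
  · intro x p q hp hpq
    by_cases hx : a <:+ x
    · refine ⟨0, fun n _ => ?_⟩
      rcases fill_of_suffix (g := g) r (q, n) hx with ⟨h, -⟩ | ⟨-, h⟩
      · exact h
      · exact absurd ⟨p, hp, hpq⟩ h
    · rw [fill_of_not_suffix r hx] at hp
      have ha : a ≠ [] := by rintro rfl; simp at hx
      obtain ⟨N, hN⟩ := (hg ha).saturated x p q hp hpq
      obtain ⟨⟨t, k⟩, y, rfl⟩ := List.exists_cons_of_ne_nil ha
      -- The altered node is copy number `k` of its label; larger numbers avoid it.
      refine ⟨max N (k + 1), fun n hn => ?_⟩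
      rw [fill_of_not_suffix, hN n (le_trans (le_max_left _ _) hn)]
      intro h
      rcases List.suffix_cons_iff.1 h with h | h
      · simp only [List.cons.injEq, Prod.mk.injEq] at h
        have := le_trans (le_max_right _ _) hn
        omega
      · exact hx h

/-- Left commutativity replaces `p₀ → p` followed by the `ell`-step to `r` by an `ell`-step from
`p₀` to some `p'` below `r`. The induction hypothesis gives a map with value `p'` at the parent, and
`fill` then puts `r` at the node itself. -/
theorem exists_of_ell (hM : M.IsCrossAxiom) (a : List (M.W × ℕ)) :
    ∀ {g : List (M.W × ℕ) → Option M.W}, Coherent M w g → ∀ {p r : M.W}, g a = some p →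
      M.ell p r → ∃ g', Coherent M w g' ∧ g' a = some r := by
  induction a with
  | nil =>
    intro g hg p r hp hpr
    exact ⟨fill M [] r g, coherent_fill hM (fun h => absurd rfl h)
      (fun _ => hM.2.1.trans (hg.root _ hp) hpr) (by simp), fill_self _ _⟩
  | cons t a ih =>
    intro g hg p r hp hpr
    obtain ⟨p₀, h₀, hd, hl⟩ := hg.child _ _ _ hp
    obtain ⟨p', hp', hd'⟩ := hM.2.2.1 _ _ _ hd hpr
    obtain ⟨g₁, hg₁, h₁⟩ := ih hg h₀ hp'
    refine ⟨fill M (t :: a) r g₁, coherent_fill hM (fun _ => hg₁) (by simp) ?_, fill_self _ _⟩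
    intro t' x h
    cases h
    exact ⟨p', h₁, hd', hM.2.1.trans hl hpr⟩

theorem exists_root (hM : M.IsCrossAxiom) (w : M.W) : ∃ g, Coherent M w g ∧ g [] = some w :=
  ⟨fill M [] w fun _ => none, coherent_fill hM (fun h => absurd rfl h) (fun _ => hM.2.1.refl _)
    (by simp), fill_self _ _⟩

end Coherent

theorem s4s5Satisfiable_of_ssl {φ : Formula} (h : SSLSatisfiable φ) :
    S4S5Satisfiable φ.That := by
  obtain ⟨M, hM, w, hw⟩ := h
  obtain ⟨g₀, hg₀, h₀⟩ := Coherent.exists_root hM w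
  let W₂ := {g : List (M.W × ℕ) → Option M.W // Coherent M w g}
  -- The variable `main` holds where the map is defined; every other variable is copied from the
  -- value of the map.
  let σ : ℕ → Set (List (M.W × ℕ) × W₂) := fun n =>
    {x | if n = φ.mainIdx then ∃ p, x.2.1 x.1 = some p else ∃ p, x.2.1 x.1 = some p ∧ p ∈ M.val n}
  refine ⟨List (M.W × ℕ), W₂, fun a b => a <:+ b, fun _ _ => True, σ,
    ⟨List.suffix_refl, fun _ _ _ => List.IsSuffix.trans⟩,
    ⟨fun _ => trivial, fun _ => trivial, fun _ _ => trivial⟩, ([], ⟨g₀, hg₀⟩), ?_⟩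
  set N := productModel (fun a b : List (M.W × ℕ) => a <:+ b) (fun _ _ : W₂ => True) σ
  set m := var φ.mainIdx with hm
  have hmain : ∀ x : List (M.W × ℕ) × W₂,
      N.Sat x m ↔ ∃ p, x.2.1 x.1 = some p := by
    intro x
    change (if _ then _ else _) ↔ _
    simp
  have hvar : ∀ n ∈ φ.vars, ∀ (x : List (M.W × ℕ) × W₂) p, x.2.1 x.1 = some p →
      (N.Sat x (var n) ↔ M.Sat p (var n)) := by
    intro n hn x p hp
    change (if _ then _ else _) ↔ _
    rw [if_neg (fun h : n = φ.mainIdx => mainIdx_notMem φ (h ▸ hn))]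
    simp [hp, Model.Sat]
  have key : ∀ ψ : Formula, (∀ n ∈ ψ.vars, n ∈ φ.vars) →
      ∀ (x : List (M.W × ℕ) × W₂) p, x.2.1 x.1 = some p →
        (N.Sat x (T m ψ) ↔ M.Sat p ψ) := by
    intro ψ
    induction ψ with
    | var n => intro h; exact hvar n (h n (by simp [vars]))
    | neg ψ ih => intro h x p hp; simp only [Model.Sat, T, ih h x p hp]
    | and ψ χ ih₁ ih₂ =>
      intro h x p hp
      simp only [Model.Sat, T]
      rw [ih₁ (fun n hn => h n (by simp [vars, hn])) x p hp, ih₂ (fun n hn => h n ?_) x p hp]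
      simp only [vars, List.mem_append, List.mem_filter]
      by_cases h' : n ∈ ψ.vars <;> simp [h', hn]
    | K ψ ih =>
      intro h x p hp
      simp only [Model.Sat, T]
      constructor
      · intro hx q hq
        obtain ⟨g', hg', hgq⟩ := Coherent.exists_of_ell hM x.1 x.2.2 hp hq
        have := hx (x.1, ⟨g', hg'⟩) ⟨rfl, trivial⟩
        rw [hmain, not_and_not_right] at this
        exact (ih h (x.1, ⟨g', hg'⟩) q hgq).1 (this ⟨q, hgq⟩)
      · rintro hx ⟨b, g'⟩ ⟨hb, -⟩
        change x.1 = b at hb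
        subst hb
        rw [hmain, not_and_not_right]
        rintro ⟨q, hq⟩
        exact (ih h _ q hq).2 (hx q (x.2.2.ell_of_eq hM g'.2 hp hq))
    | box ψ ih =>
      intro h x p hp
      simp only [Model.Sat, T]
      constructor
      · intro hx q hq
        -- A `dia`-step to `q` is imitated by going to a child labelled `q` with a large enough copy
        -- number, keeping the map.
        obtain ⟨k, hk⟩ := x.2.2.saturated x.1 p q hp hq
        have := hx ((q, k) :: x.1, x.2) ⟨List.suffix_cons _ _, rfl⟩
        rw [hmain, not_and_not_right] at this
        exact (ih h ((q, k) :: x.1, x.2) q (hk k le_rfl)).1 (this ⟨q, hk k le_rfl⟩)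
      · rintro hx ⟨b, g'⟩ ⟨hb, hg⟩
        change x.1 <:+ b at hb
        change x.2 = g' at hg
        subst hg
        rw [hmain, not_and_not_right]
        rintro ⟨q, hq⟩
        obtain ⟨p', hp', hd⟩ := x.2.2.dia_of_suffix hM hb q hq
        rw [hp] at hp'
        cases hp'
        exact (ih h _ q hq).2 (hx q hd)
  refine (sat_That _ _ _).2 ⟨(hmain _).2 ⟨w, h₀⟩, ?_, (sat_persistent _ _ _ _).2 ?_,
    (key φ (fun _ h => h) _ w h₀).2 hw⟩
  · rintro u - v - hv x ⟨hvx, hx2⟩ hx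
    obtain ⟨q, hq⟩ := (hmain x).1 hx
    obtain ⟨p, hp, -⟩ := x.2.2.dia_of_suffix hM hvx q hq
    exact hv ((hmain v).2 ⟨p, by rw [hx2]; exact hp⟩)
  · intro n hn u _
    -- Where the map is undefined, it is undefined at all nodes above, so a box guarded by `main`
    -- holds vacuously. Where it has the value `p`, all values above are `dia`-successors of `p` and
    -- agree with it on every variable.
    rcases hu : u.2.1 u.1 with _ | p
    · left
      rintro v ⟨h1, h2⟩ hv
      obtain ⟨q, hq⟩ := (hmain v).1 hv
      obtain ⟨p, hp, -⟩ := v.2.2.dia_of_suffix hM h1 q hq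
      rw [← h2, hu] at hp
      cases hp
    · have : ∀ v, N.dia u v → N.Sat v m → (N.Sat v (var n) ↔ p ∈ M.val n) := by
        rintro v ⟨h1, h2⟩ hv
        obtain ⟨q, hq⟩ := (hmain v).1 hv
        obtain ⟨p', hp, hd⟩ := v.2.2.dia_of_suffix hM h1 q hq
        rw [← h2, hu] at hp
        cases hp
        rw [hvar n hn v q hq]
        exact (hM.2.2.2 n p q hd).symm
      by_cases hp : p ∈ M.val n
      · left; intro v h1 h2; exact (this v h1 h2).2 hp
      · right; intro v h1 h2; exact fun h => hp ((this v h1 h2).1 h)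

theorem commutator_of_s4s5Satisfiable {φ : Formula} (h : S4S5Satisfiable φ) :
    S4S5CommutatorSatisfiable φ := by
  obtain ⟨W₁, W₂, R₁, R₂, σ, h₁, h₂, w, hw⟩ := h
  refine ⟨productModel R₁ R₂ σ, ⟨⟨fun a => ⟨h₁.1 _, rfl⟩, ?_⟩, ⟨fun a => ⟨rfl, h₂.refl _⟩, ?_, ?_⟩,
    ?_, ?_⟩, w, hw⟩
  · rintro a b c ⟨h, h'⟩ ⟨k, k'⟩
    exact ⟨h₁.2 _ _ _ h k, h'.trans k'⟩
  · rintro a b ⟨h, h'⟩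
    exact ⟨h.symm, h₂.symm h'⟩
  · rintro a b c ⟨h, h'⟩ ⟨k, k'⟩
    exact ⟨h.trans k, h₂.trans h' k'⟩
  · rintro ⟨p, p'⟩ ⟨q, q'⟩ ⟨r, r'⟩ ⟨h, rfl⟩ ⟨rfl, h'⟩
    exact ⟨(p, r'), ⟨rfl, h'⟩, h, rfl⟩
  · rintro ⟨p, p'⟩ ⟨q, q'⟩ ⟨r, r'⟩ ⟨rfl, h'⟩ ⟨h, rfl⟩
    exact ⟨(r, p'), ⟨h, rfl⟩, rfl, h'⟩

theorem ssl_iff_s4s5 (φ : Formula) :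
    (SSLSatisfiable φ ↔ S4S5Satisfiable φ.That) ∧
      (SSLSatisfiable φ ↔ S4S5CommutatorSatisfiable φ.That) :=
  ⟨⟨s4s5Satisfiable_of_ssl, fun h => sslSatisfiable_of_commutator (commutator_of_s4s5Satisfiable h)⟩,
    ⟨fun h => commutator_of_s4s5Satisfiable (s4s5Satisfiable_of_ssl h),
      sslSatisfiable_of_commutator⟩⟩

end Bimodal

/-! ### Unique readability of formulas, and their recognition without a stack -/

namespace Bimodal

open Formula

/-! ### Binary representations -/

def Sym.isDigit : Sym → Bool
  | .zero => true
  | .one => true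
  | _ => false

def digitSym (b : Bool) : Sym := if b then Sym.one else Sym.zero

@[simp] theorem isDigit_digitSym (b : Bool) : (digitSym b).isDigit = true := by cases b <;> rfl

theorem digitSym_injective : Function.Injective digitSym := by
  intro a b; cases a <;> cases b <;> simp [digitSym]

theorem bin_zero : bin 0 = [Sym.zero] := rfl

theorem bin_of_ne_zero {n : ℕ} (h : n ≠ 0) : bin n = n.bits.reverse.map digitSym := by
  simp only [bin, if_neg h]; rfl

theorem bin_bit (b : Bool) {n : ℕ} (h : n ≠ 0) : bin (Nat.bit b n) = bin n ++ [digitSym b] := by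
  rw [bin_of_ne_zero h, bin_of_ne_zero (by simp [Nat.bit_eq_zero_iff, h]),
    Nat.bits_append_bit _ _ (fun h' => absurd h' h)]
  simp

theorem bin_one : bin 1 = [Sym.one] := by simp [bin]

theorem isDigit_of_mem_bin {n : ℕ} {a : Sym} (h : a ∈ bin n) : a.isDigit = true := by
  by_cases hn : n = 0
  · subst hn; simp [bin_zero] at h; subst h; rfl
  · rw [bin_of_ne_zero hn] at h
    obtain ⟨b, -, rfl⟩ := List.mem_map.1 h
    exact isDigit_digitSym b

theorem bin_ne_nil (n : ℕ) : bin n ≠ [] := by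
  induction n using Nat.binaryRec' with
  | zero => simp [bin_zero]
  | bit b n h ih =>
    by_cases hn : n = 0
    · subst hn
      rw [h rfl]
      simp [Nat.bit, bin_one]
    · rw [bin_bit b hn]; simp

theorem bin_head_one {n : ℕ} (h : n ≠ 0) : ∃ l, bin n = Sym.one :: l := by
  induction n using Nat.binaryRec' with
  | zero => exact absurd rfl h
  | bit b n hb ih =>
    by_cases hn : n = 0
    · subst hn
      rw [hb rfl]
      exact ⟨[], by simp [Nat.bit, bin_one]⟩
    · obtain ⟨l, hl⟩ := ih hn
      exact ⟨l ++ [digitSym b], by rw [bin_bit b hn, hl]; rfl⟩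

/-- The number with the given binary digits, least significant digit first. -/
def bitsVal : List Bool → ℕ
  | [] => 0
  | b :: l => Nat.bit b (bitsVal l)

theorem bitsVal_bits (n : ℕ) : bitsVal n.bits = n := by
  induction n using Nat.binaryRec' with
  | zero => simp [bitsVal]
  | bit b n h ih => rw [Nat.bits_append_bit _ _ h, bitsVal, ih]

theorem bin_injective : Function.Injective bin := by
  have h0 : ∀ n, bin 0 = bin n → n = 0 := by
    intro n h
    by_contra hn
    obtain ⟨l, hl⟩ := bin_head_one hn
    rw [hl, bin_zero] at h
    simp at h
  intro n m h
  by_cases hn : n = 0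
  · subst hn; exact (h0 m h).symm
  by_cases hm : m = 0
  · subst hm; exact h0 n h.symm
  rw [bin_of_ne_zero hn, bin_of_ne_zero hm] at h
  have := List.reverse_injective (List.map_injective_iff.2 digitSym_injective h)
  rw [← bitsVal_bits n, ← bitsVal_bits m, this]

/-! ### Unique readability -/

/-- The maximal initial segment of a string that consists of digits. -/
def digits (l : List Sym) : List Sym := l.takeWhile Sym.isDigit

/-- The string does not start with a digit. -/
def NoDigit (l : List Sym) : Prop := ∀ a ∈ l.head?, a.isDigit = false

@[simp] theorem noDigit_nil : NoDigit [] := by simp [NoDigit]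

@[simp] theorem noDigit_cons (a : Sym) (l : List Sym) : NoDigit (a :: l) ↔ a.isDigit = false := by
  simp [NoDigit]

theorem digits_append {d l : List Sym} (hd : ∀ a ∈ d, a.isDigit = true) (hl : NoDigit l) :
    digits (d ++ l) = d := by
  rw [digits, List.takeWhile_append_of_pos hd]
  cases l with
  | nil => simp
  | cons a l =>
    rw [noDigit_cons] at hl
    simp [hl]

theorem digits_bin_append (n : ℕ) {l : List Sym} (hl : NoDigit l) : digits (bin n ++ l) = bin n :=
  digits_append (fun _ => isDigit_of_mem_bin) hl

/-- Only a trailing variable fails to announce its own end, because further digits could belong to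
its index. Requiring that the remainders do not start with a digit removes this ambiguity. -/
theorem str_append_inj (φ : Formula) : ∀ (ψ : Formula) {r s : List Sym}, NoDigit r → NoDigit s →
    φ.str ++ r = ψ.str ++ s → φ = ψ ∧ r = s := by
  induction φ with
  | var n =>
    intro ψ r s hr hs h
    cases ψ with
    | var m =>
      simp only [Formula.str, List.cons_append, List.cons.injEq, true_and] at h
      have h' := congrArg digits h
      rw [digits_bin_append n hr, digits_bin_append m hs] at h'
      cases bin_injective h'
      exact ⟨rfl, List.append_cancel_left h⟩
    | _ => simp [Formula.str] at h
  | neg φ ih =>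
    intro ψ r s hr hs h
    cases ψ with
    | neg ψ =>
      simp only [Formula.str, List.cons_append, List.cons.injEq, true_and] at h
      obtain ⟨rfl, rfl⟩ := ih ψ hr hs h
      exact ⟨rfl, rfl⟩
    | _ => simp [Formula.str] at h
  | K φ ih =>
    intro ψ r s hr hs h
    cases ψ with
    | K ψ =>
      simp only [Formula.str, List.cons_append, List.cons.injEq, true_and] at h
      obtain ⟨rfl, rfl⟩ := ih ψ hr hs h
      exact ⟨rfl, rfl⟩
    | _ => simp [Formula.str] at h
  | box φ ih =>
    intro ψ r s hr hs h
    cases ψ with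
    | box ψ =>
      simp only [Formula.str, List.cons_append, List.cons.injEq, true_and] at h
      obtain ⟨rfl, rfl⟩ := ih ψ hr hs h
      exact ⟨rfl, rfl⟩
    | _ => simp [Formula.str] at h
  | and φ χ ih₁ ih₂ =>
    intro ψ r s hr hs h
    cases ψ with
    | and ψ ξ =>
      simp only [Formula.str, List.cons_append, List.append_assoc, List.cons.injEq,
        true_and] at h
      obtain ⟨rfl, h'⟩ := ih₁ ψ (by simp [Sym.isDigit]) (by simp [Sym.isDigit]) h
      rw [List.cons.injEq] at h'
      obtain ⟨rfl, h''⟩ := ih₂ ξ (by simp [Sym.isDigit]) (by simp [Sym.isDigit]) h'.2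
      exact ⟨rfl, by simpa using h''⟩
    | _ => simp [Formula.str] at h

theorem str_injective : Function.Injective Formula.str := fun φ ψ h =>
  (str_append_inj φ ψ (r := []) (s := []) (by simp) (by simp) (by simpa using h)).1

theorem stringTranslation_str (φ : Formula) : stringTranslation φ.str = φ.That.str := by
  have h : ∃ ψ : Formula, ψ.str = φ.str := ⟨φ, rfl⟩
  rw [stringTranslation, dif_pos h, str_injective h.choose_spec]

theorem stringTranslation_of_notMem {w : List Sym} (h : w ∉ formulaLanguage) :
    stringTranslation w = [Sym.and] := dif_neg h

theorem and_notMem : [Sym.and] ∉ formulaLanguage := by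
  rintro ⟨φ, hφ⟩
  cases φ <;> simp [Formula.str] at hφ

theorem mem_satProblem_iff (w : List Sym) : w ∈ satProblem SSLSatisfiable ↔
    stringTranslation w ∈ satProblem S4S5Satisfiable := by
  by_cases h : w ∈ formulaLanguage
  · obtain ⟨φ, rfl⟩ := h
    have key : ∀ (P : Formula → Prop) (φ : Formula), φ.str ∈ satProblem P ↔ P φ := fun P φ =>
      ⟨fun ⟨ψ, h, hψ⟩ => str_injective h ▸ hψ, fun h => ⟨φ, rfl, h⟩⟩
    rw [stringTranslation_str, key, key]
    exact (ssl_iff_s4s5 φ).1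
  · rw [stringTranslation_of_notMem h]
    exact iff_of_false (fun ⟨φ, h', _⟩ => h ⟨φ, h'⟩) fun ⟨φ, h', _⟩ => and_notMem ⟨φ, h'⟩

/-! ### One-counter scans -/

inductive CtrOp : Type
  | stay | inc | dec

def CtrOp.apply : CtrOp → ℕ → ℕ
  | .stay, c => c
  | .inc, c => c + 1
  | .dec, c => c - 1

/-- The final state and the output of a one-counter automaton reading a string. -/
def scan {α β E : Type} (δ : E → Bool → α → E × CtrOp × List β) : E → ℕ → List α → E × List β
  | e, _, [] => (e, [])
  | e, c, a :: l =>
    let r := δ e (decide (c = 0)) a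
    let x := scan δ r.1 (r.2.1.apply c) l
    (x.1, r.2.2 ++ x.2)

/-! ### Recognizing formulas -/

inductive TopState : Type
  | run (seen : Bool) | done (seen : Bool)
  deriving DecidableEq, Fintype

/-- Reading a string backwards, this finds the last unmatched left parenthesis, and whether it is
followed by an `∧` on its own level. -/
def topStep {β : Type} : TopState → Bool → Sym → TopState × CtrOp × List β
  | .done s, _, _ => (.done s, .stay, [])
  | .run s, _, .rpar => (.run s, .inc, [])
  | .run s, true, .lpar => (.done s, .stay, [])
  | .run s, false, .lpar => (.run s, .dec, [])
  | .run _, true, .and => (.run true, .stay, [])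
  | .run s, _, _ => (.run s, .stay, [])

/-- This plays the role of the top entry of the parser's stack. It is computed from the reversed
prefix `u` instead of being stored. -/
def top (s : Bool) (c : ℕ) (u : List Sym) : TopState :=
  (scan (topStep (β := Empty)) (.run s) c u).1

/-- The scan is silent, so its result does not depend on the output alphabet of the machine that
performs it. -/
theorem scan_topStep {β : Type} (s : Bool) (c : ℕ) (u : List Sym) :
    scan (topStep (β := β)) (.run s) c u = (top s c u, []) := by
  have h : ∀ e c, scan (topStep (β := β)) e c u = ((scan (topStep (β := Empty)) e c u).1, []) := by
    induction u with
    | nil => exact fun _ _ => rfl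
    | cons a u ih =>
      intro e c
      rcases e with s | s
      · cases a <;> rcases c with _ | c <;> simp [scan, topStep, ih]
      · simp [scan, topStep, ih]
  exact h _ _

theorem top_append_digits (s : Bool) (c : ℕ) (d u : List Sym) (hd : ∀ a ∈ d, a.isDigit = true) :
    top s c (d ++ u) = top s c u := by
  induction d with
  | nil => rfl
  | cons a d ih =>
    rw [← ih fun b hb => hd b (by simp [hb])]
    have := hd a (by simp)
    cases a <;> simp_all [top, scan, topStep, Sym.isDigit, CtrOp.apply]

/-- Formulas are balanced, so the counter returns to its initial value. Each `∧` inside is read at a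
positive counter and hence does not count as an `∧` on the level sought. -/
theorem top_str (φ : Formula) : ∀ (s : Bool) (c : ℕ) (u : List Sym),
    top s c (φ.str.reverse ++ u) = top s c u := by
  induction φ with
  | var n =>
    intro s c u
    simp only [Formula.str, List.reverse_cons, List.append_assoc]
    rw [top_append_digits _ _ _ _ (by simpa using fun _ => isDigit_of_mem_bin)]
    simp [top, scan, topStep, CtrOp.apply]
  | and φ ψ ih₁ ih₂ =>
    intro s c u
    have h : ∀ l, top s c (.rpar :: l) = top s (c + 1) l := by
      intro l; simp [top, scan, topStep, CtrOp.apply]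
    have h' : ∀ l, top s (c + 1) (.and :: l) = top s (c + 1) l := by
      intro l; simp [top, scan, topStep, CtrOp.apply]
    have h'' : ∀ l, top s (c + 1) (.lpar :: l) = top s c l := by
      intro l; simp [top, scan, topStep, CtrOp.apply]
    simp only [Formula.str, List.reverse_cons, List.reverse_append, List.append_assoc,
      List.reverse_nil, List.nil_append, List.cons_append]
    rw [h, ih₂, h', ih₁, h'']
  | neg φ ih | K φ ih | box φ ih =>
    intro s c u
    simp only [Formula.str, List.reverse_cons, List.append_assoc]
    rw [ih]
    simp [top, scan, topStep, CtrOp.apply]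

theorem scan_topStep_done (s : Bool) (c : ℕ) (u : List Sym) :
    (scan (topStep (β := Empty)) (.done s) c u).1 = .done s := by
  induction u generalizing c with
  | nil => rfl
  | cons a u ih => simp [scan, topStep, ih]

inductive Mode : Type
  | want | var | zero | digs | got | fail

instance : Finite Mode :=
  Finite.of_surjective (fun i : Fin 6 => [Mode.want, .var, .zero, .digs, .got, .fail][i]) fun m => by
    cases m
    exacts [⟨0, rfl⟩, ⟨1, rfl⟩, ⟨2, rfl⟩, ⟨3, rfl⟩, ⟨4, rfl⟩, ⟨5, rfl⟩]

/-- An operand has just been completed (apart from further digits). -/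
def Mode.isGot : Mode → Bool
  | .zero => true
  | .digs => true
  | .got => true
  | _ => false

/-- The letters for which the recognizer has to know the innermost open parenthesis. -/
def needsTop : Mode → Sym → Bool
  | m, .and => m.isGot
  | m, .rpar => m.isGot
  | _, _ => false

/-- The modes `zero` and `digs` are separate because no digit may follow the index `0`, whereas an
index starting with `1` can always be prolonged. -/
def modeStep : Mode → TopState → Sym → Mode
  | .want, _, .neg => .want
  | .want, _, .K => .want
  | .want, _, .box => .want
  | .want, _, .lpar => .want
  | .want, _, .x => .var
  | .var, _, .zero => .zero
  | .var, _, .one => .digs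
  | .digs, _, .zero => .digs
  | .digs, _, .one => .digs
  | m, t, .and => if m.isGot ∧ t = .done false then .want else .fail
  | m, t, .rpar => if m.isGot ∧ t = .done true then .got else .fail
  | _, _, _ => .fail

/-- The mode of the recognizer after reading a string, where `u` is what was read before, backwards. -/
def modeRun : Mode → List Sym → List Sym → Mode
  | m, _, [] => m
  | m, u, a :: r => modeRun (modeStep m (top false 0 u) a) (a :: u) r

/-- The recognizer of formulas. -/
def accepts (w : List Sym) : Bool :=
  (modeRun .want [] w).isGot && decide (top false 0 w.reverse = .run false)

theorem modeRun_digs (d u r : List Sym) (hd : ∀ a ∈ d, a.isDigit = true) :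
    modeRun .digs u (d ++ r) = modeRun .digs (d.reverse ++ u) r := by
  induction d generalizing u with
  | nil => rfl
  | cons a d ih =>
    have h := ih (a :: u) fun b hb => hd b (by simp [hb])
    have := hd a (by simp)
    cases a <;> simp_all [Sym.isDigit, modeRun, modeStep]

/-- The mode reached depends on the last letter of `φ`, hence the existential. In a conjunction,
`top_str` lets the recognizer look past a finished conjunct to the parenthesis that opened it. -/
theorem modeRun_str (φ : Formula) : ∀ u r, ∃ m : Mode, m.isGot = true ∧
    modeRun .want u (φ.str ++ r) = modeRun m (φ.str.reverse ++ u) r := by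
  induction φ with
  | var n =>
    intro u r
    by_cases hn : n = 0
    · subst hn
      exact ⟨.zero, rfl, by simp [Formula.str, bin_zero, modeRun, modeStep]⟩
    · obtain ⟨l, hl⟩ := bin_head_one hn
      refine ⟨.digs, rfl, ?_⟩
      simp only [Formula.str, hl, List.cons_append, modeRun, modeStep]
      rw [modeRun_digs]
      · simp
      · intro a ha
        exact isDigit_of_mem_bin (n := n) (by simp [hl, ha])
  | and φ ψ ih₁ ih₂ =>
    intro u r
    refine ⟨.got, rfl, ?_⟩
    simp only [Formula.str, List.cons_append, List.append_assoc, modeRun, modeStep]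
    obtain ⟨m, hm, h⟩ := ih₁ (.lpar :: u) (.and :: (ψ.str ++ (.rpar :: r)))
    simp only [List.nil_append]
    rw [h]
    simp only [modeRun]
    have h1 : modeStep m (top false 0 (φ.str.reverse ++ .lpar :: u)) .and = .want := by
      rw [top_str]
      have : top false 0 (.lpar :: u) = .done false := by
        simp [top, scan, topStep, scan_topStep_done]
      cases m <;> simp_all [modeStep, Mode.isGot]
    rw [h1]
    obtain ⟨m', hm', h'⟩ := ih₂ (.and :: (φ.str.reverse ++ .lpar :: u)) (.rpar :: r)
    rw [h']
    simp only [modeRun]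
    have h2 : modeStep m' (top false 0 (ψ.str.reverse ++ .and :: (φ.str.reverse ++ .lpar :: u)))
        .rpar = .got := by
      rw [top_str]
      have h3 : top false 0 (.and :: (φ.str.reverse ++ .lpar :: u)) =
          top true 0 (φ.str.reverse ++ .lpar :: u) := by
        simp [top, scan, topStep, CtrOp.apply]
      have : top true 0 (.lpar :: u) = .done true := by
        simp [top, scan, topStep, scan_topStep_done]
      rw [h3, top_str, this]
      cases m' <;> simp_all [modeStep, Mode.isGot]
    rw [h2]
    simp
  | neg φ ih | K φ ih | box φ ih =>
    intro u r
    simp only [Formula.str, List.cons_append, modeRun, modeStep]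
    obtain ⟨m, hm, h⟩ := ih (_ :: u) r
    exact ⟨m, hm, by rw [h]; simp⟩

theorem accepts_str (φ : Formula) : accepts φ.str = true := by
  obtain ⟨m, hm, h⟩ := modeRun_str φ [] []
  rw [List.append_nil] at h
  have h2 := top_str φ false 0 []
  rw [List.append_nil] at h2
  rw [accepts, h, h2]
  simp [modeRun, hm, top, scan]

/-- What surrounds an operand from the left. -/
inductive Ctx : Type
  | neg | K | box | lpar | mid (φ : Formula)

def Ctx.str : Ctx → List Sym
  | .neg => [.neg]
  | .K => [.K]
  | .box => [.box]
  | .lpar => [.lpar]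
  | .mid φ => .lpar :: (φ.str ++ [.and])

/-- The string of a list of contexts, the innermost of which comes first. -/
def ctxStr : List Ctx → List Sym
  | [] => []
  | f :: l => ctxStr l ++ f.str

/-- The innermost context is not a unary operator. -/
def BinaryTop : List Ctx → Prop
  | [] => True
  | .lpar :: _ => True
  | .mid _ :: _ => True
  | _ => False

/-- Unary operators directly before a finished operand are absorbed into it. What is then left in
front of the operand is empty or ends with a context that `top` detects. -/
theorem exists_binaryTop (l : List Ctx) : ∀ φ : Formula, ∃ l' φ',
    BinaryTop l' ∧ ctxStr l ++ φ.str = ctxStr l' ++ Formula.str φ' := by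
  induction l with
  | nil => exact fun φ => ⟨[], φ, trivial, rfl⟩
  | cons f l ih =>
    intro φ
    cases f with
    | lpar => exact ⟨.lpar :: l, φ, trivial, rfl⟩
    | mid ψ => exact ⟨.mid ψ :: l, φ, trivial, rfl⟩
    | neg =>
      obtain ⟨l', φ', h, h'⟩ := ih (.neg φ)
      exact ⟨l', φ', h, by rw [← h']; simp [ctxStr, Ctx.str, Formula.str]⟩
    | K =>
      obtain ⟨l', φ', h, h'⟩ := ih (.K φ)
      exact ⟨l', φ', h, by rw [← h']; simp [ctxStr, Ctx.str, Formula.str]⟩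
    | box =>
      obtain ⟨l', φ', h, h'⟩ := ih (.box φ)
      exact ⟨l', φ', h, by rw [← h']; simp [ctxStr, Ctx.str, Formula.str]⟩

theorem top_ctxStr {l : List Ctx} (hl : BinaryTop l) (φ : Formula) :
    top false 0 (ctxStr l ++ φ.str).reverse = match l with
      | [] => .run false
      | .mid _ :: _ => .done true
      | _ => .done false := by
  rw [List.reverse_append, top_str]
  match l, hl with
  | [], _ => rfl
  | .lpar :: l, _ =>
    simp [ctxStr, Ctx.str, top, scan, topStep, CtrOp.apply, scan_topStep_done]
  | .mid ψ :: l, _ =>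
    have h3 : ∀ u, top false 0 (.and :: u) = top true 0 u := by
      simp [top, scan, topStep, CtrOp.apply]
    simp only [ctxStr, Ctx.str, List.reverse_append, List.reverse_cons, List.reverse_nil,
      List.nil_append, List.append_assoc, List.cons_append]
    rw [h3, top_str]
    simp [top, scan, topStep, CtrOp.apply, scan_topStep_done]

/-- What is known about the string read so far when the recognizer is in a given mode. -/
def ModeInv : Mode → List Sym → Prop
  | .want, v => ∃ l, v = ctxStr l
  | .var, v => ∃ l, v = ctxStr l ++ [.x]
  | .zero, v => ∃ l φ, v = ctxStr l ++ Formula.str φ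
  | .digs, v => ∃ l n, n ≠ 0 ∧ v = ctxStr l ++ Formula.str (.var n)
  | .got, v => ∃ l φ, v = ctxStr l ++ Formula.str φ
  | .fail, _ => True

theorem ModeInv.of_isGot {m : Mode} {v : List Sym} (h : ModeInv m v) (hm : m.isGot = true) :
    ∃ l φ, BinaryTop l ∧ v = ctxStr l ++ Formula.str φ := by
  obtain ⟨l, φ, rfl⟩ : ∃ l φ, v = ctxStr l ++ Formula.str φ := by
    cases m with
    | zero => exact h
    | got => exact h
    | digs => obtain ⟨l, n, -, h⟩ := h; exact ⟨l, _, h⟩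
    | _ => cases hm
  obtain ⟨l', φ', h1, h2⟩ := exists_binaryTop l φ
  exact ⟨l', φ', h1, h2⟩

theorem ModeInv.and_step {m : Mode} {v : List Sym} (h : ModeInv m v) (hm : m.isGot = true)
    (ht : top false 0 v.reverse = .done false) : ModeInv .want (v ++ [.and]) := by
  obtain ⟨l, φ, hl, rfl⟩ := h.of_isGot hm
  rw [top_ctxStr hl] at ht
  match l, hl with
  | [], _ => cases ht
  | .mid ψ :: l, _ => cases ht
  | .lpar :: l, _ => exact ⟨.mid φ :: l, by simp [ctxStr, Ctx.str]⟩

theorem ModeInv.rpar_step {m : Mode} {v : List Sym} (h : ModeInv m v) (hm : m.isGot = true)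
    (ht : top false 0 v.reverse = .done true) : ModeInv .got (v ++ [.rpar]) := by
  obtain ⟨l, φ, hl, rfl⟩ := h.of_isGot hm
  rw [top_ctxStr hl] at ht
  match l, hl with
  | [], _ => cases ht
  | .mid ψ :: l, _ => exact ⟨l, .and ψ φ, by simp [ctxStr, Ctx.str, Formula.str]⟩
  | .lpar :: l, _ => cases ht

theorem ModeInv.step {m : Mode} {v : List Sym} (h : ModeInv m v) (a : Sym) :
    ModeInv (modeStep m (top false 0 v.reverse) a) (v ++ [a]) := by
  have hand : ModeInv (if m.isGot ∧ top false 0 v.reverse = .done false then .want else .fail)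
      (v ++ [.and]) := by
    split_ifs with hc
    · exact h.and_step hc.1 hc.2
    · trivial
  have hrpar : ModeInv (if m.isGot ∧ top false 0 v.reverse = .done true then .got else .fail)
      (v ++ [.rpar]) := by
    split_ifs with hc
    · exact h.rpar_step hc.1 hc.2
    · trivial
  -- Appending a digit to `bin n` yields a binary representation only for `n ≠ 0`; this is why the
  -- invariant of `digs` records that condition.
  have hbit : ∀ b, m = .digs → ModeInv .digs (v ++ [digitSym b]) := by
    rintro b rfl
    obtain ⟨l, n, hn, rfl⟩ := h
    exact ⟨l, Nat.bit b n, by simp [Nat.bit_eq_zero_iff, hn], by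
      rw [Formula.str, Formula.str, bin_bit b hn]; simp⟩
  cases m with
  | want =>
    obtain ⟨l, rfl⟩ := h
    cases a <;> first | exact hand | exact hrpar | trivial | skip
    · exact ⟨.lpar :: l, rfl⟩
    · exact ⟨.neg :: l, rfl⟩
    · exact ⟨.box :: l, rfl⟩
    · exact ⟨.K :: l, rfl⟩
    · exact ⟨l, rfl⟩
  | var =>
    obtain ⟨l, rfl⟩ := h
    cases a <;> first | exact hand | exact hrpar | trivial | skip
    · exact ⟨l, .var 0, by simp [Formula.str, bin_zero]⟩
    · exact ⟨l, 1, one_ne_zero, by simp [Formula.str, bin_one]⟩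
  | digs =>
    cases a <;> first | exact hand | exact hrpar | trivial | skip
    · exact hbit false rfl
    · exact hbit true rfl
  | _ => cases a <;> first | exact hand | exact hrpar | trivial

theorem modeInv_modeRun {m : Mode} {v : List Sym} (h : ModeInv m v) (r : List Sym) :
    ModeInv (modeRun m v.reverse r) (v ++ r) := by
  induction r generalizing m v with
  | nil => simpa [modeRun] using h
  | cons a r ih =>
    have := ih (h.step a)
    simpa [modeRun] using this

theorem accepts_iff (w : List Sym) : accepts w = true ↔ w ∈ formulaLanguage := by
  constructor
  · intro h
    rw [accepts, Bool.and_eq_true, decide_eq_true_iff] at h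
    have h1 : ModeInv (modeRun .want [] w) w :=
      modeInv_modeRun (m := .want) (v := []) ⟨[], rfl⟩ w
    obtain ⟨l, φ, hl, hw⟩ := h1.of_isGot h.1
    have h2 := h.2
    -- No parenthesis is open at the end, so no context remains and the operand is the whole string.
    rw [hw, top_ctxStr hl] at h2
    match l, hl with
    | [], _ => exact ⟨φ, hw.symm⟩
    | .mid ψ :: l, _ => cases h2
    | .lpar :: l, _ => cases h2
  · rintro ⟨φ, rfl⟩
    exact accepts_str φ

end Bimodal

/-! ### The string of the translated formula, read off the string of the formula -/

namespace Bimodal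

open Formula

/-! ### Occurrences of variables -/

/-- The digit strings of the variables that occur in a string. -/
def occ : List Sym → List (List Sym)
  | [] => []
  | a :: l => if a = .x then digits l :: occ l else occ l

/-- The indices of the variables of a formula, from left to right, with repetitions. -/
def leaves : Formula → List ℕ
  | .var n => [n]
  | .neg φ => leaves φ
  | .and φ ψ => leaves φ ++ leaves ψ
  | .K φ => leaves φ
  | .box φ => leaves φ

theorem mem_leaves_iff (φ : Formula) (n : ℕ) : n ∈ leaves φ ↔ n ∈ φ.vars := by
  induction φ with
  | var m => rfl
  | neg φ ih | K φ ih | box φ ih => exact ih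
  | and φ ψ ih₁ ih₂ => simp [leaves, vars, ih₁, ih₂]; tauto

theorem occ_digits_append (d l : List Sym) (hd : ∀ a ∈ d, a.isDigit = true) :
    occ (d ++ l) = occ l := by
  induction d with
  | nil => rfl
  | cons a d ih =>
    have := hd a (by simp)
    rw [List.cons_append, occ, if_neg (by rintro rfl; cases this), ih fun b hb => hd b (by simp [hb])]

theorem occ_str_append (φ : Formula) : ∀ {r : List Sym}, NoDigit r →
    occ (φ.str ++ r) = (leaves φ).map bin ++ occ r := by
  induction φ with
  | var n =>
    intro r hr
    simp only [Formula.str, List.cons_append, occ, if_true, leaves]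
    rw [digits_bin_append n hr, occ_digits_append _ _ fun _ => isDigit_of_mem_bin]
    rfl
  | neg φ ih | K φ ih | box φ ih => intro r hr; simp [Formula.str, occ, leaves, ih hr]
  | and φ ψ ih₁ ih₂ =>
    intro r hr
    simp only [Formula.str, List.cons_append, List.append_assoc, occ, leaves]
    rw [ih₁ (by simp [Sym.isDigit]), occ, ih₂ (by simp [Sym.isDigit])]
    simp [occ]

theorem occ_str (φ : Formula) : occ φ.str = (leaves φ).map bin := by
  simpa [occ] using occ_str_append φ noDigit_nil

/-- First occurrences in a list, apart from the elements of `seen`. -/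
def firsts {γ : Type} [DecidableEq γ] : List γ → List γ → List γ
  | _, [] => []
  | seen, d :: l => if d ∈ seen then firsts (d :: seen) l else d :: firsts (d :: seen) l

section firsts

variable {γ : Type} [DecidableEq γ]

theorem firsts_append (seen l l' : List γ) :
    firsts seen (l ++ l') = firsts seen l ++ firsts (l.reverse ++ seen) l' := by
  induction l generalizing seen with
  | nil => rfl
  | cons d l ih =>
    simp only [List.cons_append, firsts, ih, List.reverse_cons, List.append_assoc, List.nil_append]
    split_ifs <;> rfl

/-- This links the left-to-right definition, which a machine can follow, with the recursive use of
`filter` in `vars`. -/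
theorem firsts_eq_filter (seen l : List γ) :
    firsts seen l = (firsts [] l).filter (fun d => d ∉ seen) := by
  induction l using List.reverseRecOn generalizing seen with
  | nil => rfl
  | append_singleton l d ih =>
    rw [firsts_append, firsts_append, List.filter_append, ih]
    congr 1
    simp only [firsts, List.mem_append, List.mem_reverse, List.append_nil]
    by_cases h1 : d ∈ l <;> by_cases h2 : d ∈ seen <;> simp [h1, h2]

theorem firsts_map {γ' : Type} [DecidableEq γ'] {f : γ → γ'} (hf : Function.Injective f)
    (seen l : List γ) : firsts (seen.map f) (l.map f) = (firsts seen l).map f := by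
  induction l generalizing seen with
  | nil => rfl
  | cons d l ih =>
    have := ih (d :: seen)
    rw [List.map_cons] at this
    simp only [List.map_cons, firsts, this, List.mem_map_of_injective hf]
    split_ifs <;> rfl

theorem firsts_length_le (seen l : List γ) : (firsts seen l).length ≤ l.length := by
  induction l generalizing seen with
  | nil => rfl
  | cons d l ih =>
    have := ih (d :: seen)
    rw [firsts]
    split_ifs
    · exact this.trans (by simp)
    · simpa using this

end firsts

theorem firsts_leaves (φ : Formula) : firsts [] (leaves φ) = φ.vars := by
  induction φ with
  | var m => rfl
  | neg φ ih | K φ ih | box φ ih => exact ih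
  | and φ ψ ih₁ ih₂ =>
    rw [leaves, firsts_append, ih₁, firsts_eq_filter, ih₂, vars]
    simp [mem_leaves_iff]

theorem firsts_occ_str (φ : Formula) : firsts [] (occ φ.str) = φ.vars.map bin := by
  rw [occ_str, ← firsts_leaves, ← firsts_map bin_injective, List.map_nil]

theorem occ_length_le (l : List Sym) : (occ l).length ≤ l.length := by
  induction l with
  | nil => rfl
  | cons a l ih => rw [occ]; split_ifs <;> simp <;> omega

theorem vars_length_le (φ : Formula) : φ.vars.length ≤ φ.str.length := by
  have h := (firsts_length_le [] (occ φ.str)).trans (occ_length_le _)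
  rwa [firsts_occ_str, List.length_map] at h

theorem mem_occ_str (φ : Formula) (n : ℕ) : bin n ∈ occ φ.str ↔ n ∈ φ.vars := by
  rw [occ_str, List.mem_map_of_injective bin_injective, mem_leaves_iff]

theorem bin_mainIdx_notMem (φ : Formula) : bin φ.mainIdx ∉ occ φ.str := by
  rw [mem_occ_str]; exact mainIdx_notMem φ

theorem bin_mem_of_lt_mainIdx {φ : Formula} {n : ℕ} (h : n < φ.mainIdx) : bin n ∈ occ φ.str := by
  rw [mem_occ_str, mem_vars_iff]
  exact not_not.1 (Nat.find_min (exists_fresh φ) h)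

/-- All numbers below `mainIdx` are indices of variables of `φ`, and each variable takes up a letter
`x` of the string. So `main` has an index with logarithmically many digits. -/
theorem mainIdx_le (φ : Formula) : φ.mainIdx ≤ φ.str.length := by
  refine le_trans ?_ (vars_length_le φ)
  have : Finset.range φ.mainIdx ⊆ φ.vars.toFinset := fun n hn => by
    rw [List.mem_toFinset, ← mem_occ_str]
    exact bin_mem_of_lt_mainIdx (Finset.mem_range.1 hn)
  simpa using (Finset.card_le_card this).trans (List.toFinset_card_le _)

theorem vars_ne_nil (φ : Formula) : φ.vars ≠ [] := by
  induction φ with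
  | var n => simp [vars]
  | neg φ ih | K φ ih | box φ ih => exact ih
  | and φ ψ ih₁ ih₂ => simp [vars, ih₁]

/-! ### The translation of strings -/

inductive CloseState : Type
  | start | inner | digits | chain | fin

instance : Finite CloseState :=
  Finite.of_surjective (fun i : Fin 5 => [CloseState.start, .inner, .digits, .chain, .fin][i])
    fun m => by
      cases m
      exacts [⟨0, rfl⟩, ⟨1, rfl⟩, ⟨2, rfl⟩, ⟨3, rfl⟩, ⟨4, rfl⟩]

/-- Reading a string backwards whose last letter ends a variable or a conjunction, this writes a
right parenthesis for each modal operator whose scope ends there. -/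
def closeStep : CloseState → Bool → Sym → CloseState × CtrOp × List Sym
  | .start, _, .rpar => (.inner, .stay, [])
  | .start, _, .zero => (.digits, .stay, [])
  | .start, _, .one => (.digits, .stay, [])
  | .inner, _, .rpar => (.inner, .inc, [])
  | .inner, true, .lpar => (.chain, .stay, [])
  | .inner, false, .lpar => (.inner, .dec, [])
  | .inner, _, _ => (.inner, .stay, [])
  | .digits, _, .zero => (.digits, .stay, [])
  | .digits, _, .one => (.digits, .stay, [])
  | .digits, _, .x => (.chain, .stay, [])
  | .chain, _, .K => (.chain, .stay, [.rpar])
  | .chain, _, .box => (.chain, .stay, [.rpar])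
  | .chain, _, .neg => (.chain, .stay, [])
  | _, _, _ => (.fin, .stay, [])

/-- Here `u` is the reversed prefix up to and including the last letter of a variable or of a
conjunction. -/
def closers (u : List Sym) : List Sym := (scan closeStep .start 0 u).2

/-- One right parenthesis for each `K` or `□` in the block of unary operators that ends the prefix:
these are the operators applied to the operand that comes next. -/
def chain (u : List Sym) : List Sym := (scan closeStep .chain 0 u).2

def inner (c : ℕ) (u : List Sym) : List Sym := (scan closeStep .inner c u).2

theorem scan_closeStep_fin (c : ℕ) (u : List Sym) : (scan closeStep .fin c u).2 = [] := by
  induction u generalizing c with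
  | nil => rfl
  | cons a u ih => simp [scan, closeStep, ih]

theorem inner_digits (c : ℕ) (d u : List Sym) (hd : ∀ a ∈ d, a.isDigit = true) :
    inner c (d ++ u) = inner c u := by
  induction d with
  | nil => rfl
  | cons a d ih =>
    rw [← ih fun b hb => hd b (by simp [hb])]
    have := hd a (by simp)
    cases a <;> simp_all [inner, scan, closeStep, Sym.isDigit, CtrOp.apply]

theorem inner_str (φ : Formula) : ∀ c u, inner c (φ.str.reverse ++ u) = inner c u := by
  induction φ with
  | var n =>
    intro c u
    simp only [Formula.str, List.reverse_cons, List.append_assoc]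
    rw [inner_digits _ _ _ (by simpa using fun _ => isDigit_of_mem_bin)]
    simp [inner, scan, closeStep, CtrOp.apply]
  | and φ ψ ih₁ ih₂ =>
    intro c u
    have h : ∀ l, inner c (.rpar :: l) = inner (c + 1) l := by
      intro l; simp [inner, scan, closeStep, CtrOp.apply]
    have h' : ∀ l, inner (c + 1) (.and :: l) = inner (c + 1) l := by
      intro l; simp [inner, scan, closeStep, CtrOp.apply]
    have h'' : ∀ l, inner (c + 1) (.lpar :: l) = inner c l := by
      intro l; simp [inner, scan, closeStep, CtrOp.apply]
    simp only [Formula.str, List.reverse_cons, List.reverse_append, List.append_assoc,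
      List.reverse_nil, List.nil_append, List.cons_append]
    rw [h, ih₂, h', ih₁, h'']
  | neg φ ih | K φ ih | box φ ih =>
    intro c u
    simp only [Formula.str, List.reverse_cons, List.append_assoc]
    rw [ih]
    simp [inner, scan, closeStep, CtrOp.apply]

theorem closers_conj (φ ψ : Formula) (u : List Sym) :
    closers (.rpar :: (ψ.str.reverse ++ .and :: (φ.str.reverse ++ .lpar :: u))) = chain u := by
  have h : ∀ l, closers (.rpar :: l) = inner 0 l := by
    intro l; simp [closers, inner, scan, closeStep, CtrOp.apply]
  have h' : ∀ l, inner 0 (.and :: l) = inner 0 l := by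
    intro l; simp [inner, scan, closeStep, CtrOp.apply]
  rw [h, inner_str, h', inner_str]
  simp [inner, chain, scan, closeStep, CtrOp.apply]

theorem closers_var (a : Sym) (d u : List Sym) (ha : a.isDigit = true)
    (hd : ∀ a ∈ d, a.isDigit = true) : closers (a :: (d ++ .x :: u)) = chain u := by
  have h : (scan closeStep .digits 0 (d ++ .x :: u)).2 = chain u := by
    induction d with
    | nil => simp [chain, scan, closeStep, CtrOp.apply]
    | cons a d ih =>
      rw [← ih fun b hb => hd b (by simp [hb])]
      have := hd a (by simp)
      cases a <;> simp_all [scan, closeStep, Sym.isDigit, CtrOp.apply]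
  rw [← h]
  cases a <;> simp_all [closers, scan, closeStep, Sym.isDigit, CtrOp.apply]

/-- What the translation writes when it reads the letter `a`, after `u` (read backwards) and
before `r`; the variable `main` is written as `M`. -/
def outAt (M u : List Sym) (a : Sym) (r : List Sym) : List Sym :=
  match a with
  | .K => [.K, .neg, .lpar] ++ (M ++ [.and, .neg])
  | .box => [.box, .neg, .lpar] ++ (M ++ [.and, .neg])
  | .rpar => .rpar :: closers (.rpar :: u)
  | .zero => .zero :: if r.head?.any Sym.isDigit then [] else closers (.zero :: u)
  | .one => .one :: if r.head?.any Sym.isDigit then [] else closers (.one :: u)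
  | a => [a]

/-- The output for each letter depends on the surrounding string rather than on a parse tree, so
that one pass over the input produces it. -/
def trans (M : List Sym) : List Sym → List Sym → List Sym
  | _, [] => []
  | u, a :: r => outAt M u a r ++ trans M (a :: u) r

/-- The digits `d'` of the index have been read already, in reverse. Only the last digit of `d` is
not followed by a digit, so the closing parentheses are written exactly once. -/
theorem trans_digits (M u : List Sym) {r : List Sym} (hr : NoDigit r) (d d' : List Sym)
    (hd : ∀ a ∈ d, a.isDigit = true) (hd' : ∀ a ∈ d', a.isDigit = true) (hne : d ≠ []) :
    trans M (d' ++ .x :: u) (d ++ r) =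
      d ++ (chain u ++ trans M (d.reverse ++ (d' ++ .x :: u)) r) := by
  induction d generalizing d' with
  | nil => exact absurd rfl hne
  | cons a d ih =>
    have ha := hd a (by simp)
    have hout : ∀ s : List Sym, outAt M (d' ++ .x :: u) a s =
        a :: if s.head?.any Sym.isDigit then [] else closers (a :: (d' ++ .x :: u)) := by
      cases a <;> simp_all [outAt, Sym.isDigit]
    rw [List.cons_append, trans, hout]
    cases d with
    | nil =>
      have : r.head?.any Sym.isDigit = false := by
        cases r with
        | nil => rfl
        | cons b r => simpa using hr
      simp [this, closers_var a d' u ha hd']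
    | cons b d =>
      have h := ih (a :: d') (fun c hc => hd c (by simp [hc]))
        (fun c hc => by rcases List.mem_cons.1 hc with rfl | hc; exacts [ha, hd' c hc]) (by simp)
      have hb := hd b (by simp)
      rw [List.cons_append] at h
      rw [h]
      simp [hb]

/-- At the end of `φ` the pass closes every modal operator of the block reaching back into `u`; this
is the summand `chain u`. For `φ = Kψ` the `K` lengthens the block before `ψ` by one parenthesis,
which is the one that ends `T φ`. -/
theorem trans_str (m : ℕ) (φ : Formula) : ∀ (u : List Sym) {r : List Sym}, NoDigit r →
    trans (Formula.var m).str u (φ.str ++ r) =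
      (T (.var m) φ).str ++ (chain u ++ trans (Formula.var m).str (φ.str.reverse ++ u) r) := by
  set M := (Formula.var m).str
  have hM' : Sym.x :: bin m = M := rfl
  induction φ with
  | var n =>
    intro u r hr
    have := trans_digits M u hr (bin n) [] (fun _ => isDigit_of_mem_bin) (by simp) (bin_ne_nil n)
    rw [List.nil_append] at this
    simp [Formula.str, trans, outAt, T, this]
  | neg φ ih =>
    intro u r hr
    have : chain (.neg :: u) = chain u := by simp [chain, scan, closeStep, CtrOp.apply]
    simp [Formula.str, trans, outAt, T, ih _ hr, this]
  | K φ ih =>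
    intro u r hr
    have : chain (.K :: u) = .rpar :: chain u := by simp [chain, scan, closeStep, CtrOp.apply]
    simp [Formula.str, trans, outAt, T, ih _ hr, this, hM']
  | box φ ih =>
    intro u r hr
    have : chain (.box :: u) = .rpar :: chain u := by simp [chain, scan, closeStep, CtrOp.apply]
    simp [Formula.str, trans, outAt, T, ih _ hr, this, hM']
  | and φ ψ ih₁ ih₂ =>
    intro u r hr
    have h1 : ∀ u, chain (.and :: u) = [] := by
      intro u; simp [chain, scan, closeStep, CtrOp.apply, scan_closeStep_fin]
    have h2 : ∀ u, chain (.lpar :: u) = [] := by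
      intro u; simp [chain, scan, closeStep, CtrOp.apply, scan_closeStep_fin]
    simp only [Formula.str, List.cons_append, List.append_assoc, trans, outAt, T]
    rw [ih₁ _ (by simp [Sym.isDigit])]
    simp only [trans, outAt, List.nil_append]
    rw [ih₂ _ (by simp [Sym.isDigit])]
    simp [trans, outAt, h1, h2, closers_conj]

/-- The string of `K(□(main → A) ∨ □(main → ¬A))`, where `main` is written as `M` and `A` as `x`
followed by `d`. -/
def item (M d : List Sym) : List Sym := List.flatten
  [[.K, .neg, .lpar, .neg, .box, .neg, .lpar, .neg, .neg], M, [.and, .neg, .x], d,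
    [.rpar, .and, .neg, .box, .neg, .lpar, .neg, .neg], M, [.and, .neg, .neg, .x], d,
    [.rpar, .rpar]]

/-- The beginning of a conjunction bracketed to the right, up to its last member. -/
def items (M : List Sym) : List (List Sym) → List Sym
  | [] => []
  | d :: l => if l = [] then item M d else .lpar :: (item M d ++ .and :: items M l)

/-- Bracketing to the right gathers the closing parentheses of the conjunction at its end, so it is
enough to remember how many there are. -/
theorem str_bigAnd (m : ℕ) (l : List ℕ) (hl : l ≠ []) :
    (bigAnd (l.map fun n => K (or (box (imp (.var m) (.var n)))
      (box (imp (.var m) (neg (.var n))))))).str =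
    items (Formula.var m).str (l.map bin) ++ List.replicate (l.length - 1) .rpar := by
  induction l with
  | nil => exact absurd rfl hl
  | cons n l ih =>
    cases l with
    | nil => simp [bigAnd, items, item, Formula.str, Formula.or, Formula.imp]
    | cons n' l =>
      have h := ih (by simp)
      simp only [List.map_cons] at h
      simp only [List.map_cons, bigAnd, items, Formula.str]
      rw [h]
      simp [items, item, Formula.str, Formula.or, Formula.imp, List.replicate_succ']

/-- The beginning of the translated formula. -/
def prologue (M : List Sym) : List Sym := List.flatten
  [[.lpar], M, [.and, .lpar, .K, .box, .neg, .lpar, .neg, .neg, .neg], M,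
    [.and, .neg, .box, .neg], M, [.rpar, .and, .lpar]]

/-- The right-hand side is the output in the order in which the machine writes it. The last three
parentheses close the three outer conjunctions of `That`. -/
theorem str_That (φ : Formula) : φ.That.str =
    prologue (Formula.var φ.mainIdx).str ++
      (items (Formula.var φ.mainIdx).str (firsts [] (occ φ.str)) ++
        (List.replicate ((firsts [] (occ φ.str)).length - 1) .rpar ++ ([.and] ++
        (trans (Formula.var φ.mainIdx).str [] φ.str ++ [.rpar, .rpar, .rpar])))) := by
  have h := trans_str φ.mainIdx φ [] noDigit_nil
  simp only [List.append_nil, chain, scan, trans] at h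
  have h' := str_bigAnd φ.mainIdx φ.vars (vars_ne_nil φ)
  rw [That, firsts_occ_str, List.length_map, h]
  simp only [Formula.str, persistent, h']
  simp [prologue, Formula.str, Formula.or, Formula.imp]

end Bimodal

namespace Bimodal

/-! ### Machine fragments -/

/-- Contents of a cell of a work tape that stores a number: the left end of the tape is marked, and
the binary digits follow, the least significant digit first. -/
inductive Cell : Type
  | blank | mark | bit (b : Bool)
  deriving DecidableEq

instance : Finite Cell :=
  Finite.of_surjective (fun i : Fin 4 => [Cell.blank, .mark, .bit false, .bit true][i]) fun m => by
    rcases m with _ | _ | b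
    · exact ⟨0, rfl⟩
    · exact ⟨1, rfl⟩
    · cases b
      exacts [⟨2, rfl⟩, ⟨3, rfl⟩]

instance {α : Type} [Finite α] : Finite (InCell α) :=
  Finite.of_surjective (fun x : Option (Option α) => match x with
    | none => InCell.leftEnd
    | some none => .rightEnd
    | some (some a) => .letter a) fun m => by
    cases m with
    | leftEnd => exact ⟨none, rfl⟩
    | rightEnd => exact ⟨some none, rfl⟩
    | letter a => exact ⟨some (some a), rfl⟩

/-- A configuration without the state. -/
@[ext] structure Phys (β ι : Type) where
  inHead : ℕ
  head : ι → ℕ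
  tape : ι → ℕ → Cell
  out : List β

/-- The part of a machine that performs a certain task; when it is done, it exits with a value in
`E`. -/
structure Frag (α β ι E : Type) where
  Q : Type
  finQ : Finite Q
  start : Q ⊕ E
  δ : Q → InCell α → (ι → Cell) → Action β (Q ⊕ E) ι Cell

namespace Action

variable {β ι Q Q' Γ : Type}

def mapNext (f : Q → Q') (a : Action β Q ι Γ) : Action β Q' ι Γ :=
  { a with next := f a.next }

/-- Changing nothing but the state. -/
def idle (x : Q) (g : ι → Γ) : Action β Q ι Γ where
  next := x
  inMove := .stay
  write := g
  workMove _ := .stay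
  emit := none

/-- Working on the tape `i` only. -/
def on [DecidableEq ι] (i : ι) (x : Q) (g : ι → Γ) (c : Γ) (m : Move) : Action β Q ι Γ where
  next := x
  inMove := .stay
  write := Function.update g i c
  workMove := Function.update (fun _ => .stay) i m
  emit := none

end Action

namespace Phys

variable {β ι Q : Type}

def apply (n : ℕ) (c : Phys β ι) (a : Action β Q ι Cell) : Phys β ι where
  inHead := min (Machine.moveHead c.inHead a.inMove) (n + 1)
  head i := Machine.moveHead (c.head i) (a.workMove i)
  tape i := Function.update (c.tape i) (c.head i) (a.write i)
  out := c.out ++ a.emit.toList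

def read (c : Phys β ι) (i : ι) : Cell := c.tape i (c.head i)

/-- The configuration with the tape `i` and the position of its head replaced. -/
def set [DecidableEq ι] (c : Phys β ι) (i : ι) (t : ℕ → Cell) (h : ℕ) : Phys β ι :=
  { c with head := Function.update c.head i h, tape := Function.update c.tape i t }

theorem apply_idle {n : ℕ} {c : Phys β ι} (hc : c.inHead ≤ n + 1) (x : Q) :
    c.apply n (Action.idle x c.read) = c := by
  ext <;> simp [apply, Action.idle, read, Machine.moveHead, hc]

variable [DecidableEq ι]

@[simp] theorem read_set (c : Phys β ι) (i : ι) (t : ℕ → Cell) (h : ℕ) :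
    (c.set i t h).read i = t h := by simp [read, set]

@[simp] theorem inHead_set (c : Phys β ι) (i : ι) (t : ℕ → Cell) (h : ℕ) :
    (c.set i t h).inHead = c.inHead := rfl

@[simp] theorem out_set (c : Phys β ι) (i : ι) (t : ℕ → Cell) (h : ℕ) :
    (c.set i t h).out = c.out := rfl

theorem head_set (c : Phys β ι) (i j : ι) (t : ℕ → Cell) (h : ℕ) :
    (c.set i t h).head j = if j = i then h else c.head j := by
  simp [set, Function.update_apply]

theorem apply_on {n : ℕ} {c : Phys β ι} (hc : c.inHead ≤ n + 1) (i : ι) (t : ℕ → Cell) (h : ℕ)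
    (x : Q) (b : Cell) (m : Move) :
    (c.set i t h).apply n (Action.on i x (c.set i t h).read b m) =
      c.set i (Function.update t h b) (Machine.moveHead h m) := by
  ext j k
  · simp [apply, Action.on, Machine.moveHead, hc]
  · by_cases hj : j = i
    · subst hj; simp [apply, Action.on, set]
    · simp [apply, Action.on, set, hj, Machine.moveHead]
  · by_cases hj : j = i
    · subst hj; simp [apply, Action.on, set]
    · simp [apply, Action.on, set, hj, read]
  · simp [apply, Action.on]

end Phys

/-- A run up to the exit of a fragment, during which the heads of the work tapes stay in the first
`L` cells. -/
inductive Runs {α β ι E Q : Type} (δ : Q → InCell α → (ι → Cell) → Action β (Q ⊕ E) ι Cell)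
    (w : List α) (L : ℕ) : Q ⊕ E → Phys β ι → E → Phys β ι → Prop
  | done (e : E) (c : Phys β ι) (h : ∀ i, c.head i < L) : Runs δ w L (.inr e) c e c
  | step (q : Q) (c : Phys β ι) (e : E) (c' : Phys β ι) (h : ∀ i, c.head i < L)
      (r : Runs δ w L (δ q (Machine.inCell w c.inHead) c.read).next
        (c.apply w.length (δ q (Machine.inCell w c.inHead) c.read)) e c') :
      Runs δ w L (.inl q) c e c'

namespace Frag

variable {α β ι E E' : Type}

/-- The fragment that exits immediately. -/
def pure (e : E) : Frag α β ι E where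
  Q := Empty
  finQ := inferInstance
  start := .inr e
  δ := Empty.elim

def bindLeft (F : Frag α β ι E) (G : E → Frag α β ι E') :
    F.Q ⊕ E → (F.Q ⊕ Σ e, (G e).Q) ⊕ E'
  | .inl q => .inl (.inl q)
  | .inr e => match (G e).start with
    | .inl q => .inl (.inr ⟨e, q⟩)
    | .inr e' => .inr e'

def bindRight (F : Frag α β ι E) (G : E → Frag α β ι E') (e : E) :
    (G e).Q ⊕ E' → (F.Q ⊕ Σ e, (G e).Q) ⊕ E'
  | .inl q => .inl (.inr ⟨e, q⟩)
  | .inr e' => .inr e'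

/-- First `F`, then `G e`, where `e` is the value with which `F` exits. -/
def bind [Finite E] (F : Frag α β ι E) (G : E → Frag α β ι E') : Frag α β ι E' where
  Q := F.Q ⊕ Σ e, (G e).Q
  finQ :=
    have := F.finQ
    have := fun e => (G e).finQ
    inferInstance
  start := bindLeft F G F.start
  δ q cell g := match q with
    | .inl q => (F.δ q cell g).mapNext (bindLeft F G)
    | .inr ⟨e, q⟩ => ((G e).δ q cell g).mapNext (bindRight F G e)

def seq (F : Frag α β ι Unit) (G : Frag α β ι E') : Frag α β ι E' := F.bind fun _ => G

def iterNext (F : E → Frag α β ι (E ⊕ E')) (e : E) :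
    (F e).Q ⊕ (E ⊕ E') → (E ⊕ Σ e, (F e).Q) ⊕ E'
  | .inl q => .inl (.inr ⟨e, q⟩)
  | .inr (.inl e') => .inl (.inl e')
  | .inr (.inr r) => .inr r

/-- Every round begins with an idle step in a state of its own. Since a body may exit without making
a step, passing from its exit directly to the next start could be circular. -/
def iterδ (F : E → Frag α β ι (E ⊕ E')) (q : E ⊕ Σ e, (F e).Q) (cell : InCell α) (g : ι → Cell) :
    Action β ((E ⊕ Σ e, (F e).Q) ⊕ E') ι Cell :=
  match q with
  | .inl e => Action.idle (iterNext F e (F e).start) g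
  | .inr ⟨e, q⟩ => ((F e).δ q cell g).mapNext (iterNext F e)

/-- A loop: `F e` exits either with the value for its next round, or with the final value. -/
def iter [Finite E] (F : E → Frag α β ι (E ⊕ E')) (e : E) : Frag α β ι E' where
  Q := E ⊕ Σ e, (F e).Q
  finQ :=
    have := fun e => (F e).finQ
    inferInstance
  start := .inl (.inl e)
  δ := iterδ F

/-- A single step that leaves the work tapes alone. -/
def one (f : InCell α → Move × Option β × E) : Frag α β ι E where
  Q := Unit
  finQ := inferInstance
  start := .inl ()
  δ _ cell g :=
    { next := .inr (f cell).2.2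
      inMove := (f cell).1
      write := g
      workMove := fun _ => .stay
      emit := (f cell).2.1 }

/-- Marking the left ends of the work tapes. -/
def marks : Frag α β ι Unit where
  Q := Unit
  finQ := inferInstance
  start := .inl ()
  δ _ _ _ := Action.idle (.inr ()) fun _ => .mark

variable [DecidableEq ι]

/-- Rewriting the digits on tape `i` from the least significant one on with `f`, until `f` returns a
value; then the head goes back to the left end. -/
def sweep [Finite E] (i : ι) (f : Cell → Cell × Option E) : Frag α β ι E where
  Q := Option (Option E)
  finQ := inferInstance
  start := .inl none
  δ q _ g := match q with
    | none => .on i (.inl (some none)) g (g i) .right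
    | some none => match f (g i) with
      | (c, none) => .on i (.inl (some none)) g c .right
      | (c, some r) => .on i (.inl (some (some r))) g c .left
    | some (some r) => if g i = .mark then .idle (.inr r) g
      else .on i (.inl (some (some r))) g (g i) .left

/-- Reading the number on tape `i`, the most significant digit first. For each digit, the state `e`
is updated, the input head may move, and a letter may be written. -/
def feed [Finite E] (i : ι) (A : E → Bool → InCell α → E × Move × Option β) (e : E) :
    Frag α β ι E where
  Q := Option (E × Bool)
  finQ := inferInstance
  start := .inl none
  δ q cell g := match q with
    | none => match g i with
      | .blank => .on i (.inl (some (e, false))) g .blank .left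
      | c => .on i (.inl none) g c .right
    | some (e, s) => match g i with
      | .bit b => if !s && !b then .on i (.inl (some (e, s))) g (.bit b) .left
        else
          { Action.on (β := β) i (.inl (some ((A e b cell).1, true))) g (.bit b) .left with
            inMove := (A e b cell).2.1
            emit := (A e b cell).2.2 }
      | _ => .idle (.inr e) g

end Frag

section Runs

variable {α β ι E E' : Type} {w : List α} {L : ℕ}

theorem Runs.bindRight {F : Frag α β ι E} {G : E → Frag α β ι E'} [Finite E] {e : E}
    {x : (G e).Q ⊕ E'} {c c' : Phys β ι} {e' : E'} (h : Runs (G e).δ w L x c e' c') :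
    Runs (F.bind G).δ w L (Frag.bindRight F G e x) c e' c' := by
  induction h with
  | done e' c h => exact .done _ _ h
  | step q c e' c' h r ih => exact .step _ _ _ _ h ih

theorem Runs.bind {F : Frag α β ι E} {G : E → Frag α β ι E'} [Finite E] {e : E}
    {x : F.Q ⊕ E} {c c' c'' : Phys β ι} {e' : E'} (h : Runs F.δ w L x c e c')
    (h' : Runs (G e).δ w L (G e).start c' e' c'') :
    Runs (F.bind G).δ w L (Frag.bindLeft F G x) c e' c'' := by
  induction h with
  | done e c h =>
    have := h'.bindRight (F := F)
    simp only [Frag.bindLeft]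
    revert this
    generalize (G e).start = y
    cases y <;> exact id
  | step q c e' c' h r ih => exact .step _ _ _ _ h (ih h')

theorem Runs.iter_loop {F : E → Frag α β ι (E ⊕ E')} {e e' : E}
    {x : (F e).Q ⊕ (E ⊕ E')} {c c' c'' : Phys β ι} {r : E'}
    (h : Runs (F e).δ w L x c (.inl e') c')
    (h' : Runs (Frag.iterδ F) w L (.inl (.inl e')) c' r c'') :
    Runs (Frag.iterδ F) w L (Frag.iterNext F e x) c r c'' := by
  generalize hy : (Sum.inl e' : E ⊕ E') = y at h
  induction h with
  | done y c h => subst hy; exact h'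
  | step q c y c' h _ ih => exact .step _ _ _ _ h (ih h' hy)

theorem Runs.iter_exit {F : E → Frag α β ι (E ⊕ E')} {e : E}
    {x : (F e).Q ⊕ (E ⊕ E')} {c c' : Phys β ι} {r : E'}
    (h : Runs (F e).δ w L x c (.inr r) c') :
    Runs (Frag.iterδ F) w L (Frag.iterNext F e x) c r c' := by
  generalize hy : (Sum.inr r : E ⊕ E') = y at h
  induction h with
  | done y c h => subst hy; exact .done _ _ h
  | step q c y c' h _ ih => exact .step _ _ _ _ h (ih hy)

theorem Runs.head_lt {Q : Type} {δ : Q → InCell α → (ι → Cell) → Action β (Q ⊕ E) ι Cell}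
    {x : Q ⊕ E} {c c' : Phys β ι} {e : E} (h : Runs δ w L x c e c') (i : ι) : c.head i < L := by
  cases h with
  | done _ _ h => exact h i
  | step _ _ _ _ h => exact h i

end Runs

theorem Runs.of_step {α β ι E Q : Type}
    {δ : Q → InCell α → (ι → Cell) → Action β (Q ⊕ E) ι Cell} {w : List α} {L : ℕ} {q : Q}
    {c c₁ c' : Phys β ι} {e : E} {a : Action β (Q ⊕ E) ι Cell} {x : Q ⊕ E}
    (h : ∀ i, c.head i < L) (ha : δ q (Machine.inCell w c.inHead) c.read = a) (hx : a.next = x)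
    (hc : c.apply w.length a = c₁) (r : Runs δ w L x c₁ e c') : Runs δ w L (.inl q) c e c' := by
  subst ha hx hc
  exact .step _ _ _ _ h r

/-! ### Numbers on tapes -/

/-- The contents of a tape on which the digits `l` are written. -/
def enc (l : List Bool) : ℕ → Cell
  | 0 => .mark
  | j + 1 => match l[j]? with
    | some b => .bit b
    | none => .blank

theorem enc_append_cons (l l' : List Bool) (b : Bool) :
    enc (l ++ b :: l') (l.length + 1) = .bit b := by simp [enc]

theorem enc_length (l : List Bool) : enc l (l.length + 1) = .blank := by simp [enc]

theorem enc_ne_mark (l : List Bool) (j : ℕ) : enc l (j + 1) ≠ .mark := by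
  simp only [enc]; split <;> simp

theorem update_enc (l l' : List Bool) (b b' : Bool) :
    Function.update (enc (l ++ b :: l')) (l.length + 1) (.bit b') = enc (l ++ b' :: l') := by
  funext j
  rcases j with _ | j
  · simp [enc]
  · by_cases hj : j = l.length
    · subst hj; simp [enc]
    · rw [Function.update_of_ne (by simpa using hj)]
      simp only [enc]
      rw [← List.getElem?_set_ne (l := l ++ b :: l') (i := l.length) (a := b') (Ne.symm hj)]
      simp

theorem update_enc_end (l : List Bool) (b : Bool) :
    Function.update (enc l) (l.length + 1) (.bit b) = enc (l ++ [b]) := by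
  funext j
  rcases j with _ | j
  · simp [enc]
  · by_cases hj : j = l.length
    · subst hj; simp [enc]
    · rw [Function.update_of_ne (by simpa using hj)]
      simp only [enc]
      rcases lt_or_gt_of_ne hj with h | h
      · rw [List.getElem?_append_left h]
      · rw [List.getElem?_eq_none h.le, List.getElem?_eq_none (by simp; omega)]

/-- The effect of `Frag.sweep` on the digits of a tape. -/
inductive Sweeps {E : Type} (f : Cell → Cell × Option E) : List Bool → List Bool → E → Prop
  | more {b b' : Bool} {l l' : List Bool} {r : E} (h : f (.bit b) = (.bit b', none))
      (h' : Sweeps f l l' r) : Sweeps f (b :: l) (b' :: l') r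
  | halt {b b' : Bool} {l : List Bool} {r : E} (h : f (.bit b) = (.bit b', some r)) :
      Sweeps f (b :: l) (b' :: l) r
  | blank {r : E} (h : f .blank = (.blank, some r)) : Sweeps f [] [] r
  | new {b : Bool} {r : E} (h : f .blank = (.bit b, some r)) : Sweeps f [] [b] r

section Sweep

variable {α β ι E : Type} {w : List α} {L : ℕ} [DecidableEq ι] [Finite E]

theorem runs_sweep_back (i : ι) (f : Cell → Cell × Option E) (r : E) (l : List Bool)
    (c : Phys β ι) (hc : c.inHead ≤ w.length + 1) (h0 : ∀ j, c.head j = 0) (k : ℕ) (hk : k < L) :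
    Runs (α := α) (Frag.sweep i f).δ w L (.inl (some (some r))) (c.set i (enc l) k) r
      (c.set i (enc l) 0) := by
  have hL : ∀ k < L, ∀ j, (c.set i (enc l) k).head j < L := by
    intro k hk j
    rw [Phys.head_set]
    split_ifs
    · exact hk
    · rw [h0]; omega
  induction k with
  | zero =>
    refine .step _ _ _ _ (hL _ hk) ?_
    have : (Frag.sweep (α := α) (β := β) i f).δ (some (some r)) (Machine.inCell w (c.set i (enc l) 0).inHead)
        (c.set i (enc l) 0).read = Action.idle (.inr r) (c.set i (enc l) 0).read := by
      simp [Frag.sweep, enc]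
    rw [this, Phys.apply_idle (by simpa using hc)]
    exact .done _ _ (hL _ hk)
  | succ k ih =>
    refine .step _ _ _ _ (hL _ hk) ?_
    have : (Frag.sweep (α := α) (β := β) i f).δ (some (some r))
        (Machine.inCell w (c.set i (enc l) (k + 1)).inHead) (c.set i (enc l) (k + 1)).read =
        Action.on i (.inl (some (some r))) (c.set i (enc l) (k + 1)).read
          (enc l (k + 1)) .left := by
      simp [Frag.sweep, enc_ne_mark]
    rw [this, Phys.apply_on hc, Function.update_eq_self]
    exact ih (by omega)

/-- The digits `pre` have been dealt with. The head is in cell `pre.length + 1` because the mark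
occupies cell `0`. -/
theorem runs_sweep_go (i : ι) {f : Cell → Cell × Option E} {r : E} {l l' : List Bool}
    (h : Sweeps f l l' r) (pre : List Bool) (c : Phys β ι) (hc : c.inHead ≤ w.length + 1)
    (h0 : ∀ j, c.head j = 0) (hk : pre.length + l.length + 1 < L) :
    Runs (α := α) (Frag.sweep i f).δ w L (.inl (some none))
      (c.set i (enc (pre ++ l)) (pre.length + 1)) r (c.set i (enc (pre ++ l')) 0) := by
  have hL : ∀ t, ∀ j, (c.set i t (pre.length + 1)).head j < L := by
    intro t j
    rw [Phys.head_set]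
    split_ifs
    · omega
    · rw [h0]; omega
  induction h generalizing pre with
  | @more b b' l l' r hf h' ih =>
    have : (Frag.sweep (α := α) (β := β) i f).δ (some none) (Machine.inCell w c.inHead)
        (c.set i (enc (pre ++ b :: l)) (pre.length + 1)).read =
        Action.on i (.inl (some none)) (c.set i (enc (pre ++ b :: l)) (pre.length + 1)).read
          (.bit b') .right := by
      simp [Frag.sweep, enc_append_cons, hf]
    refine .of_step (hL _) this rfl (Phys.apply_on hc ..) ?_
    rw [update_enc]
    have := ih (pre ++ [b']) (by simp at hk ⊢; omega) (by
      intro t j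
      rw [Phys.head_set]
      simp at hk ⊢
      split_ifs
      · omega
      · rw [h0]; omega)
    simp only [List.append_assoc, List.singleton_append, List.length_append, List.length_singleton]
      at this
    exact this
  | @halt b b' l r hf =>
    refine .step _ _ _ _ (hL _) ?_
    have : (Frag.sweep (α := α) (β := β) i f).δ (some none) (Machine.inCell w c.inHead)
        (c.set i (enc (pre ++ b :: l)) (pre.length + 1)).read =
        Action.on i (.inl (some (some r))) (c.set i (enc (pre ++ b :: l)) (pre.length + 1)).read
          (.bit b') .left := by
      simp [Frag.sweep, enc_append_cons, hf]
    rw [Phys.inHead_set, this, Phys.apply_on hc, update_enc]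
    exact runs_sweep_back i f r _ c hc h0 _ (by simp [Machine.moveHead]; omega)
  | @blank r hf =>
    refine .step _ _ _ _ (hL _) ?_
    have : (Frag.sweep (α := α) (β := β) i f).δ (some none) (Machine.inCell w c.inHead)
        (c.set i (enc (pre ++ [])) (pre.length + 1)).read =
        Action.on i (.inl (some (some r))) (c.set i (enc (pre ++ [])) (pre.length + 1)).read
          (enc (pre ++ []) (pre.length + 1)) .left := by
      simp [Frag.sweep, enc_length, hf]
    rw [Phys.inHead_set, this, Phys.apply_on hc, Function.update_eq_self]
    exact runs_sweep_back i f r _ c hc h0 _ (by simp [Machine.moveHead]; omega)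
  | @new b r hf =>
    refine .step _ _ _ _ (hL _) ?_
    have : (Frag.sweep (α := α) (β := β) i f).δ (some none) (Machine.inCell w c.inHead)
        (c.set i (enc (pre ++ [])) (pre.length + 1)).read =
        Action.on i (.inl (some (some r))) (c.set i (enc (pre ++ [])) (pre.length + 1)).read
          (.bit b) .left := by
      simp [Frag.sweep, enc_length, hf]
    rw [Phys.inHead_set, this, Phys.apply_on hc, List.append_nil, update_enc_end]
    exact runs_sweep_back i f r _ c hc h0 _ (by simp [Machine.moveHead]; omega)

/-- The sweep may reach the blank cell behind the last digit, whose number is `l.length + 1`; hence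
the form of `hk`. -/
theorem runs_sweep (i : ι) {f : Cell → Cell × Option E} {r : E} {l l' : List Bool}
    (h : Sweeps f l l' r) (c : Phys β ι) (hc : c.inHead ≤ w.length + 1)
    (h0 : ∀ j, c.head j = 0) (ht : c.tape i = enc l) (hk : l.length + 1 < L) :
    Runs (α := α) (Frag.sweep i f).δ w L (Frag.sweep (α := α) (β := β) i f).start c r
      (c.set i (enc l') 0) := by
  have hset : c = c.set i (enc l) 0 := by
    rw [Phys.set, ← ht, ← h0 i, Function.update_eq_self, Function.update_eq_self]
  have : (Frag.sweep (α := α) (β := β) i f).δ none (Machine.inCell w c.inHead)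
      c.read = Action.on i (.inl (some none)) (c.set i (enc l) 0).read (enc l 0) .right := by
    rw [← hset]; simp [Frag.sweep, Phys.read, h0, ht]
  refine .of_step (fun j => by rw [h0]; omega) this rfl
    ((congrArg (Phys.apply _ · _) hset).trans (Phys.apply_on hc ..)) ?_
  rw [Function.update_eq_self]
  have := runs_sweep_go (α := α) i h [] c hc h0 (by simpa using hk)
  simp only [List.nil_append, List.length_nil] at this
  exact this

end Sweep

section Feed

variable {α β ι E : Type} {w : List α} {L : ℕ} [DecidableEq ι] [Finite E]

/-- The effect of reading one digit in `Frag.feed` on the state, the input head and the output. -/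
def feedStep (w : List α) (A : E → Bool → InCell α → E × Move × Option β)
    (x : E × ℕ × List β) (b : Bool) : E × ℕ × List β :=
  let y := A x.1 b (Machine.inCell w x.2.1)
  (y.1, min (Machine.moveHead x.2.1 y.2.1) (w.length + 1), x.2.2 ++ y.2.2.toList)

/-- The flag `s` records whether a digit `1` has been met, so that leading zeros are passed over in
silence. The induction takes digits off the end of `pre`, the order in which the head meets them. -/
theorem runs_feed_left (i : ι) (A : E → Bool → InCell α → E × Move × Option β) (e₀ : E)
    (pre post : List Bool) (s : Bool) (e : E) (c : Phys β ι) (hc : c.inHead ≤ w.length + 1)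
    (h0 : ∀ j, c.head j = 0) (hk : pre.length < L) {e' : E} {p : ℕ} {o : List β}
    (h : (if s then pre.reverse else pre.reverse.dropWhile (!·)).foldl (feedStep w A)
      (e, c.inHead, c.out) = (e', p, o)) :
    Runs (Frag.feed i A e₀).δ w L (.inl (some (e, s))) (c.set i (enc (pre ++ post)) pre.length) e'
      ({ c with inHead := p, out := o }.set i (enc (pre ++ post)) 0) ∧ p ≤ w.length + 1 := by
  have hL : ∀ t k, k < L → ∀ j, (c.set i t k).head j < L := by
    intro t k hk j
    rw [Phys.head_set]
    split_ifs
    · exact hk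
    · rw [h0]; omega
  induction pre using List.reverseRecOn generalizing post s e c with
  | nil =>
    simp only [List.reverse_nil, List.dropWhile_nil, ite_self, List.foldl_nil, Prod.mk.injEq] at h
    obtain ⟨rfl, rfl, rfl⟩ := h
    refine ⟨.step _ _ _ _ (hL _ _ hk) ?_, hc⟩
    have : (Frag.feed i A e₀).δ (some (e, s)) (Machine.inCell w c.inHead)
        (c.set i (enc ([] ++ post)) 0).read =
        Action.idle (.inr e) (c.set i (enc ([] ++ post)) 0).read := by
      simp [Frag.feed, enc]
    rw [Phys.inHead_set, List.length_nil, this, Phys.apply_idle (by simpa using hc)]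
    exact .done _ _ (hL _ _ hk)
  | append_singleton pre b ih =>
    have hk' : pre.length < L := by simp at hk; omega
    rw [List.append_assoc, List.singleton_append, List.length_append, List.length_singleton]
    by_cases hb : s = false ∧ b = false
    · obtain ⟨rfl, rfl⟩ := hb
      have h' := ih (false :: post) false e c hc h0 hk' (by simpa using h) hL
      refine ⟨.step _ _ _ _ (hL _ _ (by simpa using hk)) ?_, h'.2⟩
      have : (Frag.feed i A e₀).δ (some (e, false)) (Machine.inCell w c.inHead)
          (c.set i (enc (pre ++ false :: post)) (pre.length + 1)).read =
          Action.on i (.inl (some (e, false)))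
            (c.set i (enc (pre ++ false :: post)) (pre.length + 1)).read (.bit false) .left := by
        simp [Frag.feed, enc_append_cons]
      rw [Phys.inHead_set, this, Phys.apply_on hc, update_enc]
      exact h'.1
    · set y := A e b (Machine.inCell w c.inHead) with hy
      have hsb : (!s && !b) = false := by cases s <;> cases b <;> simp at hb ⊢
      have h1 : ((pre.reverse).foldl (feedStep w A)
          (y.1, min (Machine.moveHead c.inHead y.2.1) (w.length + 1), c.out ++ y.2.2.toList)) =
          (e', p, o) := by
        rw [← h]
        cases s <;> cases b <;> simp at hb <;> simp [feedStep, hy]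
      have h' := ih (b :: post) true y.1
        { c with inHead := min (Machine.moveHead c.inHead y.2.1) (w.length + 1)
                 out := c.out ++ y.2.2.toList } (min_le_right _ _) h0 hk' (by simpa using h1) hL
      have h2 : (Frag.feed i A e₀).δ (some (e, s)) (Machine.inCell w c.inHead)
          (c.set i (enc (pre ++ b :: post)) (pre.length + 1)).read =
          { Action.on (β := β) i (.inl (some (y.1, true)))
              (c.set i (enc (pre ++ b :: post)) (pre.length + 1)).read (.bit b) .left with
            inMove := y.2.1
            emit := y.2.2 } := by
        simp [Frag.feed, enc_append_cons, hsb, hy]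
      have h3 := Phys.apply_on hc i (enc (pre ++ b :: post)) (pre.length + 1)
        (Sum.inl (some (y.1, true)) : Option (E × Bool) ⊕ E) (.bit b) .left
      rw [update_enc] at h3
      refine ⟨.of_step (hL _ _ (by simpa using hk)) h2 rfl ?_ h'.1, h'.2⟩
      rw [Phys.ext_iff] at h3 ⊢
      exact ⟨rfl, h3.2.1, h3.2.2.1, rfl⟩

theorem runs_feed_right (i : ι) (A : E → Bool → InCell α → E × Move × Option β) (e₀ : E)
    (pre post : List Bool) (c : Phys β ι) (hc : c.inHead ≤ w.length + 1)
    (h0 : ∀ j, c.head j = 0) (hk : pre.length + post.length + 1 < L) {e' : E} {c' : Phys β ι}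
    (h : Runs (Frag.feed i A e₀).δ w L (.inl (some (e₀, false)))
      (c.set i (enc (pre ++ post)) (pre.length + post.length)) e' c') :
    Runs (Frag.feed i A e₀).δ w L (.inl none) (c.set i (enc (pre ++ post)) (pre.length + 1)) e'
      c' := by
  have hL : ∀ t k, k < L → ∀ j, (c.set i t k).head j < L := by
    intro t k hk j
    rw [Phys.head_set]
    split_ifs
    · exact hk
    · rw [h0]; omega
  induction post generalizing pre with
  | nil =>
    refine .step _ _ _ _ (hL _ _ (by omega)) ?_
    have : (Frag.feed i A e₀).δ none (Machine.inCell w c.inHead)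
        (c.set i (enc (pre ++ [])) (pre.length + 1)).read =
        Action.on i (.inl (some (e₀, false))) (c.set i (enc (pre ++ [])) (pre.length + 1)).read
          (enc (pre ++ []) (pre.length + 1)) .left := by
      simp [Frag.feed, enc_length]
    rw [Phys.inHead_set, this, Phys.apply_on hc, Function.update_eq_self]
    exact h
  | cons b post ih =>
    refine .step _ _ _ _ (hL _ _ (by simp at hk; omega)) ?_
    have : (Frag.feed i A e₀).δ none (Machine.inCell w c.inHead)
        (c.set i (enc (pre ++ b :: post)) (pre.length + 1)).read =
        Action.on i (.inl none) (c.set i (enc (pre ++ b :: post)) (pre.length + 1)).read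
          (enc (pre ++ b :: post) (pre.length + 1)) .right := by
      simp [Frag.feed, enc_append_cons]
    rw [Phys.inHead_set, this, Phys.apply_on hc, Function.update_eq_self]
    have := ih (pre ++ [b]) (by simp at hk ⊢; omega) (by
      simp only [List.append_assoc, List.singleton_append, List.length_append, List.length_singleton]
      rw [List.length_cons] at h
      convert h using 2
      omega)
    simp only [List.append_assoc, List.singleton_append, List.length_append, List.length_singleton]
      at this
    exact this

theorem runs_feed (i : ι) (A : E → Bool → InCell α → E × Move × Option β) (e : E)
    (l : List Bool) (c : Phys β ι) (hc : c.inHead ≤ w.length + 1) (h0 : ∀ j, c.head j = 0)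
    (ht : c.tape i = enc l) (hk : l.length + 1 < L) {e' : E} {p : ℕ} {o : List β}
    (h : (l.reverse.dropWhile (!·)).foldl (feedStep w A) (e, c.inHead, c.out) = (e', p, o)) :
    Runs (Frag.feed i A e).δ w L (Frag.feed i A e).start c e'
      { c with inHead := p, out := o } ∧ p ≤ w.length + 1 := by
  have hset : ∀ c : Phys β ι, (∀ j, c.head j = 0) → c.tape i = enc l → c = c.set i (enc l) 0 := by
    intro c h0 ht
    rw [Phys.set, ← ht, ← h0 i, Function.update_eq_self, Function.update_eq_self]
  have h1 := runs_feed_left (L := L) i A e l [] false e c hc h0 (by omega) (by simpa using h)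
  rw [List.append_nil] at h1
  refine ⟨?_, h1.2⟩
  rw [hset { c with inHead := p, out := o } h0 ht]
  have : (Frag.feed i A e).δ none (Machine.inCell w c.inHead)
      c.read = Action.on i (.inl none) (c.set i (enc l) 0).read (enc l 0) .right := by
    rw [← hset c h0 ht]; simp [Frag.feed, Phys.read, h0, ht, enc]
  refine .of_step (fun j => by rw [h0]; omega) this rfl
    ((congrArg (Phys.apply _ · _) (hset c h0 ht)).trans (Phys.apply_on hc ..)) ?_
  rw [Function.update_eq_self]
  have := runs_feed_right (L := L) i A e [] l c hc h0 (by simpa using hk) (by simpa using h1.1)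
  simp only [List.nil_append, List.length_nil] at this
  exact this

end Feed

/-- Decrementing leaves leading zeros on a tape; skipping them restores the canonical digits. The
number `0` then has no digits at all, so its representation `0` needs separate treatment later. -/
theorem dropWhile_reverse (l : List Bool) :
    l.reverse.dropWhile (!·) = (bitsVal l).bits.reverse := by
  induction l with
  | nil => simp [bitsVal]
  | cons b l ih =>
    rw [List.reverse_cons, List.dropWhile_append, ih, bitsVal]
    by_cases h : bitsVal l = 0
    · rw [h]; cases b <;> simp [Nat.bit]
    · have : (bitsVal l).bits ≠ [] := by
        intro h'
        have := bitsVal_bits (bitsVal l)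
        rw [h', bitsVal] at this
        exact h this.symm
      rw [Nat.bits_append_bit _ _ fun h' => absurd h' h]
      simp [this]

end Bimodal

namespace Bimodal

/-! ### Specifications of fragments -/

/-- The configuration has the input head in cell `p`, the numbers `v` on the work tapes, and the
heads of the work tapes in their leftmost cells. -/
structure Rep {α β ι : Type} (w : List α) (p : ℕ) (v : ι → ℕ) (c : Phys β ι) : Prop where
  inHead : c.inHead = p
  le : c.inHead ≤ w.length + 1
  head : ∀ i, c.head i = 0
  tape : ∀ i, ∃ l, c.tape i = enc l ∧ bitsVal l = v i ∧ l.length ≤ Nat.log 2 (w.length + 2) + 1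

/-- A number of cells that suffices for the numbers up to `n + 2`. -/
def tapeBound (n : ℕ) : ℕ := Nat.log 2 (n + 2) + 3

/-- On the input `w`, from the position `p` of the input head and the numbers `v` on the work tapes,
`F` exits with `e`, the position `p'`, the numbers `v'`, and having written `o`. -/
def Spec {α β ι E : Type} (F : Frag α β ι E) (w : List α) (p : ℕ) (v : ι → ℕ) (e : E) (p' : ℕ)
    (v' : ι → ℕ) (o : List β) : Prop :=
  ∀ c, Rep w p v c → ∃ c', Rep w p' v' c' ∧ c'.out = c.out ++ o ∧
    Runs F.δ w (tapeBound w.length) F.start c e c'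

namespace Frag

variable {α β ι : Type} [DecidableEq ι]

def incCell : Cell → Cell × Option Unit
  | .bit true => (.bit false, none)
  | .bit false => (.bit true, some ())
  | _ => (.bit true, some ())

def decCell : Cell → Cell × Option Unit
  | .bit true => (.bit false, some ())
  | .bit false => (.bit true, none)
  | c => (c, some ())

def testCell : Cell → Cell × Option Bool
  | .bit true => (.bit true, some true)
  | .bit false => (.bit false, none)
  | c => (c, some false)

def inc (i : ι) : Frag α β ι Unit := sweep i incCell

/-- Decrementing a number; the exit value tells whether it was positive. -/
def dec (i : ι) : Frag α β ι Bool :=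
  (sweep i testCell).bind fun b => if b then (sweep i decCell).seq (pure true) else pure false

end Frag

def incBits : List Bool → List Bool
  | [] => [true]
  | false :: l => true :: l
  | true :: l => false :: incBits l

def decBits : List Bool → List Bool
  | [] => []
  | true :: l => false :: l
  | false :: l => true :: decBits l

theorem bitsVal_incBits (l : List Bool) : bitsVal (incBits l) = bitsVal l + 1 := by
  induction l with
  | nil => rfl
  | cons b l ih => cases b <;> simp [incBits, bitsVal, Nat.bit, ih]; omega

/-- A new cell is used only when all digits are `1`. So the length of a tape is controlled by the
size of the numbers stored, not by the number of operations performed. -/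
theorem length_incBits (l : List Bool) :
    (incBits l).length = l.length ∨ (incBits l).length = l.length + 1 ∧ bitsVal l + 1 = 2 ^ l.length := by
  induction l with
  | nil => exact .inr ⟨rfl, rfl⟩
  | cons b l ih =>
    cases b
    · exact .inl rfl
    · rcases ih with h | ⟨h, h'⟩
      · left; simp [incBits, h]
      · right
        simp only [incBits, List.length_cons, h, bitsVal, Nat.bit, cond_true, pow_succ, ← h', true_and]
        omega

theorem length_decBits (l : List Bool) : (decBits l).length = l.length := by
  induction l with
  | nil => rfl
  | cons b l ih => cases b <;> simp [decBits, ih]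

theorem bitsVal_decBits (l : List Bool) (h : bitsVal l ≠ 0) :
    bitsVal (decBits l) = bitsVal l - 1 := by
  induction l with
  | nil => exact absurd rfl h
  | cons b l ih =>
    cases b
    · have : bitsVal l ≠ 0 := by
        intro h'; exact h (by simp [bitsVal, h'])
      simp [decBits, bitsVal, Nat.bit, ih this]; omega
    · simp [decBits, bitsVal, Nat.bit]

theorem sweeps_inc (l : List Bool) : Sweeps Frag.incCell l (incBits l) () := by
  induction l with
  | nil => exact .new rfl
  | cons b l ih =>
    cases b
    · exact .halt rfl
    · exact .more rfl ih

theorem sweeps_dec (l : List Bool) : Sweeps Frag.decCell l (decBits l) () := by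
  induction l with
  | nil => exact .blank rfl
  | cons b l ih =>
    cases b
    · exact .more rfl ih
    · exact .halt rfl

theorem sweeps_test (l : List Bool) : Sweeps Frag.testCell l l (decide (bitsVal l ≠ 0)) := by
  induction l with
  | nil => exact .blank rfl
  | cons b l ih =>
    cases b
    · have : bitsVal (false :: l) ≠ 0 ↔ bitsVal l ≠ 0 := by simp [bitsVal]
      simp only [this]
      exact .more rfl ih
    · exact .halt (by simp [bitsVal, Nat.bit, Frag.testCell])

namespace Spec

variable {α β ι E E' : Type} {w : List α} {p p' p'' : ℕ} {v v' v'' : ι → ℕ} {o o' : List β}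

theorem tapeBound_pos (n : ℕ) : 0 < tapeBound n := by simp [tapeBound]

theorem pure (e : E) : Spec (β := β) (Frag.pure e) w p v e p v [] := fun c hc =>
  ⟨c, hc, by simp, .done _ _ fun i => by rw [hc.head]; exact tapeBound_pos _⟩

theorem bind [Finite E] {F : Frag α β ι E} {G : E → Frag α β ι E'} {e : E} {e' : E'}
    (h : Spec F w p v e p' v' o) (h' : Spec (G e) w p' v' e' p'' v'' o') :
    Spec (F.bind G) w p v e' p'' v'' (o ++ o') := by
  intro c hc
  obtain ⟨c', hc', ho, hr⟩ := h c hc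
  obtain ⟨c'', hc'', ho', hr'⟩ := h' c' hc'
  exact ⟨c'', hc'', by rw [ho', ho, List.append_assoc], hr.bind hr'⟩

theorem seq {F : Frag α β ι Unit} {G : Frag α β ι E'} {e' : E'}
    (h : Spec F w p v () p' v' o) (h' : Spec G w p' v' e' p'' v'' o') :
    Spec (F.seq G) w p v e' p'' v'' (o ++ o') := h.bind h'

theorem iter_loop [Finite E] {F : E → Frag α β ι (E ⊕ E')} {e e' : E} {r : E'}
    (h : Spec (F e) w p v (.inl e') p' v' o) (h' : Spec (Frag.iter F e') w p' v' r p'' v'' o') :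
    Spec (Frag.iter F e) w p v r p'' v'' (o ++ o') := by
  intro c hc
  obtain ⟨c', hc', ho, hr⟩ := h c hc
  obtain ⟨c'', hc'', ho', hr'⟩ := h' c' hc'
  exact ⟨c'', hc'', by rw [ho', ho, List.append_assoc],
    .of_step hr.head_lt rfl rfl (Phys.apply_idle hc.le _) (hr.iter_loop hr')⟩

theorem iter_exit [Finite E] {F : E → Frag α β ι (E ⊕ E')} {e : E} {r : E'}
    (h : Spec (F e) w p v (.inr r) p' v' o) :
    Spec (Frag.iter F e) w p v r p' v' o := by
  intro c hc
  obtain ⟨c', hc', ho, hr⟩ := h c hc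
  exact ⟨c', hc', ho, .of_step hr.head_lt rfl rfl (Phys.apply_idle hc.le _) hr.iter_exit⟩

theorem one {f : InCell α → Move × Option β × E} {m : Move} {b : Option β} {e : E}
    (h : f (Machine.inCell w p) = (m, b, e)) :
    Spec (Frag.one f) w p v e (min (Machine.moveHead p m) (w.length + 1)) v b.toList := by
  intro c hc
  refine ⟨{ c with inHead := min (Machine.moveHead p m) (w.length + 1), out := c.out ++ b.toList },
    ⟨rfl, min_le_right _ _, hc.head, hc.tape⟩, rfl, ?_⟩
  have hlt : ∀ i, c.head i < tapeBound w.length := fun i => by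
    rw [hc.head]; exact tapeBound_pos _
  refine .of_step (x := .inr e) hlt rfl (by simp [Frag.one, hc.inHead, h]) ?_ (.done e _ hlt)
  ext i j <;> simp [Phys.apply, Machine.moveHead, Phys.read, Frag.one, hc.inHead, h]

variable [DecidableEq ι]

/-- The hypothesis ranges over all digit strings of the given value, because leading zeros make the
representation of a number ambiguous. -/
theorem sweep [Finite E] {i : ι} {f : Cell → Cell × Option E} {r : E} {x : ℕ}
    (h : ∀ l, bitsVal l = v i → l.length ≤ Nat.log 2 (w.length + 2) + 1 →
      ∃ l', Sweeps f l l' r ∧ bitsVal l' = x ∧ l'.length ≤ Nat.log 2 (w.length + 2) + 1) :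
    Spec (β := β) (Frag.sweep i f) w p v r p (Function.update v i x) [] := by
  intro c hc
  obtain ⟨l, hl, hv, hlen⟩ := hc.tape i
  obtain ⟨l', hs, hv', hlen'⟩ := h l hv hlen
  refine ⟨c.set i (enc l') 0, ⟨hc.inHead, hc.le, fun j => ?_, fun j => ?_⟩, by simp,
    runs_sweep i hs c hc.le hc.head hl (by rw [tapeBound]; omega)⟩
  · rw [Phys.head_set, hc.head, ite_self]
  · by_cases hj : j = i
    · subst hj
      exact ⟨l', by simp [Phys.set], by simpa using hv', hlen'⟩
    · simpa [Phys.set, hj] using hc.tape j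

theorem inc (i : ι) (h : v i ≤ w.length + 1) :
    Spec (β := β) (Frag.inc i) w p v () p (Function.update v i (v i + 1)) [] := by
  refine sweep fun l hl hlen => ⟨_, sweeps_inc l, by rw [bitsVal_incBits, hl], ?_⟩
  rcases length_incBits l with h1 | ⟨h1, h2⟩
  · omega
  -- When the string grows, `2 ^ l.length` equals the new number, which is at most `w.length + 2`.
  · have : l.length ≤ Nat.log 2 (w.length + 2) := Nat.le_log_of_pow_le (by norm_num) (by omega)
    omega

theorem dec_zero {i : ι} (h : v i = 0) : Spec (β := β) (Frag.dec i) w p v false p v [] := by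
  have h1 : Spec (β := β) (Frag.sweep i Frag.testCell) w p v false p (Function.update v i (v i)) [] :=
    sweep fun l hl hlen => ⟨l, by simpa [hl, h] using sweeps_test l, hl, hlen⟩
  rw [Function.update_eq_self] at h1
  exact h1.bind (pure _)

theorem dec_succ {i : ι} {k : ℕ} (h : v i = k + 1) :
    Spec (β := β) (Frag.dec i) w p v true p (Function.update v i k) [] := by
  have h1 : Spec (β := β) (Frag.sweep i Frag.testCell) w p v true p (Function.update v i (v i)) [] :=
    sweep fun l hl hlen => ⟨l, by simpa [hl, h] using sweeps_test l, hl, hlen⟩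
  rw [Function.update_eq_self] at h1
  have h2 : Spec (β := β) (Frag.sweep i Frag.decCell) w p v () p (Function.update v i k) [] :=
    sweep fun l hl hlen => ⟨_, sweeps_dec l, by rw [bitsVal_decBits _ (by omega), hl, h]; rfl,
      by rwa [length_decBits]⟩
  exact h1.bind (h2.seq (pure _))

theorem feed [Finite E] {i : ι} {A : E → Bool → InCell α → E × Move × Option β} {e e' : E}
    (h : ∀ o' : List β, (v i).bits.reverse.foldl (feedStep w A) (e, p, o') = (e', p', o' ++ o)) :
    Spec (Frag.feed i A e) w p v e' p' v o := by
  intro c hc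
  obtain ⟨l, hl, hv, hlen⟩ := hc.tape i
  obtain ⟨h1, h2⟩ := runs_feed (L := tapeBound w.length) (e' := e') (p := p')
    (o := c.out ++ o) i A e l c hc.le hc.head hl
    (by rw [tapeBound]; omega) (by rw [dropWhile_reverse, hv, hc.inHead]; exact h c.out)
  exact ⟨{ c with inHead := p', out := c.out ++ o }, ⟨rfl, h2, hc.head, hc.tape⟩, rfl, h1⟩

end Spec

/-! ### From fragments to machines -/

/-- The machine that runs a fragment and then halts. -/
def Frag.toMachine {α β ι E : Type} [Finite E] [Finite ι] (F : Frag α β ι E) (acc : Set E) :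
    Machine α β where
  Q := F.Q ⊕ E
  finQ := have := F.finQ; inferInstance
  ι := ι
  finι := inferInstance
  Γ := Cell
  finΓ := inferInstance
  blank := .blank
  start := F.start
  accept := Sum.inr '' acc
  δ q cell g := match q with
    | .inl q => some (F.δ q cell g)
    | .inr _ => none

section toMachine

variable {α β ι E : Type} [Finite E] [Finite ι]

def Phys.toCfg (F : Frag α β ι E) (acc : Set E) (x : F.Q ⊕ E) (c : Phys β ι) :
    (F.toMachine acc).Cfg where
  state := x
  inHead := c.inHead
  head := c.head
  tape := c.tape
  out := c.out

/-- The step is a function, so whatever is reachable from the start of a run lies on the run, and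
the run carries the bound on the heads. -/
theorem Runs.machine {F : Frag α β ι E} (acc : Set E) {w : List α} {L : ℕ} {x : F.Q ⊕ E}
    {c c' : Phys β ι} {e : E} (h : Runs F.δ w L x c e c') :
    StateTransition.Reaches ((F.toMachine acc).step w) (c.toCfg F acc x) (c'.toCfg F acc (.inr e)) ∧
      ∀ d, StateTransition.Reaches ((F.toMachine acc).step w) (c.toCfg F acc x) d →
        ∀ i, d.head i < L := by
  induction h with
  | done e c h =>
    refine ⟨.refl, fun d hd => ?_⟩
    rcases Relation.ReflTransGen.cases_head hd with rfl | ⟨d', h', -⟩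
    · exact h
    · cases h'
  | step q c e c' h r ih =>
    have hs : (F.toMachine acc).step w (c.toCfg F acc (.inl q)) =
        some ((c.apply w.length (F.δ q (Machine.inCell w c.inHead) c.read)).toCfg F acc
          (F.δ q (Machine.inCell w c.inHead) c.read).next) := rfl
    refine ⟨.head hs ih.1, fun d hd => ?_⟩
    rcases Relation.ReflTransGen.cases_head hd with rfl | ⟨d', h', hd'⟩
    · exact h
    · rw [hs, Option.mem_some_iff] at h'
      subst h'
      exact ih.2 d hd'

/-- From `n + 2 < 2 ^ (Nat.log 2 n + 3)` the logarithm of `n + 2` exceeds that of `n` by at most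
`2`; together with the `3` in `tapeBound` this gives the factor `5`. -/
theorem tapeBound_le (n : ℕ) : tapeBound n ≤ 5 * (Nat.log 2 n + 1) := by
  have : n + 2 < 2 ^ (Nat.log 2 n + 3) := by
    have := Nat.lt_pow_succ_log_self (b := 2) (by norm_num) n
    rw [pow_succ _ (_ + 2), pow_succ _ (_ + 1)]
    have := Nat.one_le_two_pow (n := Nat.log 2 n + 1)
    simp only [Nat.succ_eq_add_one] at *
    omega
  have := Nat.log_lt_of_lt_pow (by omega) this
  rw [tapeBound]
  omega

theorem exists_machine (F : Frag α β ι E) (acc : Set E)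
    (h : ∀ w, ∃ e p v o, Spec F w 0 (fun _ => 0) e p v o) :
    ∃ M : Machine α β, M.Logspace ∧ ∀ w e p v o, Spec F w 0 (fun _ => 0) e p v o →
      ∃ c, M.HaltsIn w c ∧ c.out = o ∧ (c.state ∈ M.accept ↔ e ∈ acc) := by
  have key : ∀ w e p v o, Spec F w 0 (fun _ => 0) e p v o → ∃ c' : Phys β ι, c'.out = o ∧
      Runs (Frag.marks.seq F).δ w (tapeBound w.length) (Frag.marks.seq F).start
        ⟨0, fun _ => 0, fun _ _ => Cell.blank, []⟩ e c' := by
    intro w e p v o hF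
    -- Once its left end is marked, a blank tape is `enc []`, which represents `0`.
    obtain ⟨c', -, ho, hr⟩ := hF ⟨0, fun _ => 0, fun _ => enc [], []⟩
      ⟨rfl, by simp, fun _ => rfl, fun _ => ⟨[], rfl, rfl, by simp⟩⟩
    refine ⟨c', ho, Runs.bind (F := Frag.marks) (G := fun _ => F) (x := Frag.marks.start) (e := ()) ?_ hr⟩
    have hlt : ∀ i : ι, 0 < tapeBound w.length := fun _ => Spec.tapeBound_pos _
    refine .of_step hlt rfl rfl ?_ (.done () _ hlt)
    ext i j
    · simp [Phys.apply, Action.idle, Machine.moveHead, Frag.marks]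
    · simp [Phys.apply, Action.idle, Machine.moveHead, Frag.marks]
    · rcases j with _ | j <;> simp [Phys.apply, Action.idle, Frag.marks, enc]
    · simp [Phys.apply, Action.idle, Frag.marks]
  refine ⟨(Frag.marks.seq F).toMachine acc, ⟨5, fun w d hd i => ?_⟩, ?_⟩
  · obtain ⟨e, p, v, o, hF⟩ := h w
    obtain ⟨c', -, hr⟩ := key w e p v o hF
    exact lt_of_lt_of_le ((hr.machine acc).2 d hd i) (tapeBound_le _)
  · intro w e p v o hF
    obtain ⟨c', ho, hr⟩ := key w e p v o hF
    refine ⟨c'.toCfg _ acc (.inr e), StateTransition.mem_eval.2 ⟨(hr.machine acc).1, rfl⟩, ho, ?_⟩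
    exact Sum.inr_injective.mem_set_image

theorem logspaceComputable_of_spec {f : List α → List β} (F : Frag α β ι Unit)
    (h : ∀ w, ∃ p v, Spec F w 0 (fun _ => 0) () p v (f w)) : LogspaceComputable f := by
  obtain ⟨M, hM, h'⟩ := exists_machine F Set.univ fun w => by
    obtain ⟨p, v, hw⟩ := h w
    exact ⟨_, _, _, _, hw⟩
  refine ⟨M, hM, fun w => ?_⟩
  obtain ⟨p, v, hw⟩ := h w
  obtain ⟨c, hc, ho, -⟩ := h' _ _ _ _ _ hw
  exact ⟨c, hc, ho⟩

theorem logspaceDecidable_of_spec {A : Language α} (F : Frag α Empty ι Bool)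
    (h : ∀ w, ∃ b p v, Spec F w 0 (fun _ => 0) b p v [] ∧ (b = true ↔ w ∈ A)) :
    LogspaceDecidable A := by
  obtain ⟨M, hM, h'⟩ := exists_machine F {true} fun w => by
    obtain ⟨b, p, v, hw, -⟩ := h w
    exact ⟨_, _, _, _, hw⟩
  refine ⟨M, hM, fun w => ?_⟩
  obtain ⟨b, p, v, hw, hb⟩ := h w
  obtain ⟨c, hc, -, hs⟩ := h' _ _ _ _ _ hw
  exact ⟨c, hc, hs.trans hb⟩

end toMachine

end Bimodal

namespace Bimodal

/-! ### Programs -/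

def InCell.letter? {α : Type} : InCell α → Option α
  | .letter a => some a
  | _ => none

theorem letter?_inCell {α : Type} (w : List α) (k : ℕ) :
    (Machine.inCell w (k + 1)).letter? = w[k]? := by
  simp only [Machine.inCell]
  split <;> simp_all [InCell.letter?]

namespace Frag

variable {α β ι E E' : Type}

def moveHead (m : Move) : Frag α β ι Unit := one fun _ => (m, none, ())

def headCell : Frag α β ι (InCell α) := one fun c => (.stay, none, c)

def emit (b : β) : Frag α β ι Unit := one fun _ => (.stay, some b, ())

def emits : List β → Frag α β ι Unit
  | [] => pure ()
  | b :: l => (emit b).seq (emits l)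

/-- Moving the input head to the left end. -/
def rewind [Finite α] : Frag α β ι Unit :=
  iter (fun _ : Unit => headCell.bind fun c => match c with
    | .leftEnd => pure (.inr ())
    | _ => (moveHead .left).seq (pure (.inl ()))) ()

variable [DecidableEq ι]

def test (i : ι) : Frag α β ι Bool := sweep i testCell

/-- Repeating `F`, counting down the number on tape `i`. -/
def downLoop [Finite E] (i : ι) (F : E → Frag α β ι E) : E → Frag α β ι E :=
  iter fun e => (dec i).bind fun b => if b then (F e).bind fun e' => pure (.inl e') else pure (.inr e)

/-- The number is used up on the way; the head position then holds the information from which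
`unseek` recovers it. -/
def seek (i : ι) : Frag α β ι Unit := downLoop i (fun _ => moveHead .right) ()

/-- Moving the input head to the left end, and adding its position to the number on tape `i`. -/
def unseek [Finite α] (i : ι) : Frag α β ι Unit :=
  iter (fun _ : Unit => headCell.bind fun c => match c with
    | .leftEnd => pure (.inr ())
    | _ => (moveHead .left).seq ((inc i).seq (pure (.inl ())))) ()

/-- The letter of the input at the position given by the number on tape `i`. -/
def get [Finite α] (i : ι) : Frag α β ι (Option α) :=
  -- Letter `k` of the input is in cell `k + 1`, behind the end marker; hence the extra step to the
  -- right, which is undone before `unseek`.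
  (seek i).seq <| (moveHead .right).seq <| headCell.bind fun c =>
    (moveHead .left).seq <| (unseek i).seq <| pure c.letter?

def clear (i : ι) : Frag α β ι Unit := downLoop i (fun _ => pure ()) ()

/-- Adding the number on tape `i` to the number on tape `j`, by means of the tape `t`. -/
def copy (i j t : ι) : Frag α β ι Unit :=
  (downLoop i (fun _ => (inc j).seq (inc t)) ()).seq (downLoop t (fun _ => inc i) ())

/-- Going through the input from the position on tape `i` to its end. -/
def upLoop [Finite α] [Finite E] (i : ι) (F : E → α → Frag α β ι E) : E → Frag α β ι E :=
  iter fun e => (get i).bind fun a => match a with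
    | none => pure (.inr e)
    | some a => (F e a).bind fun e' => (inc i).seq (pure (.inl e'))

def ctrOp (i : ι) : CtrOp → Frag α β ι Unit
  | .stay => pure ()
  | .inc => inc i
  | .dec => (dec i).bind fun _ => pure ()

end Frag

namespace Spec

variable {α β ι E E' : Type} {w : List α} {p p' : ℕ} {v v' v'' : ι → ℕ} {o o' : List β}

theorem cast {F : Frag α β ι E} {e e' : E} (h : Spec F w p v e p' v' o) (he : e = e')
    (hv : v' = v'') (ho : o = o') : Spec F w p v e' p' v'' o' := by
  subst he hv ho; exact h

theorem right (h : p ≤ w.length) :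
    Spec (β := β) (Frag.moveHead .right) w p v () (p + 1) v [] := by
  have := one (β := β) (w := w) (p := p) (v := v) (f := fun _ => (.right, none, ())) rfl
  rwa [Machine.moveHead, min_eq_left (by omega)] at this

theorem left (h : p ≤ w.length + 1) :
    Spec (β := β) (Frag.moveHead .left) w p v () (p - 1) v [] := by
  have := one (β := β) (w := w) (p := p) (v := v) (f := fun _ => (.left, none, ())) rfl
  rwa [Machine.moveHead, min_eq_left (by omega)] at this

theorem headCell (h : p ≤ w.length + 1) :
    Spec (β := β) Frag.headCell w p v (Machine.inCell w p) p v [] := by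
  have := one (β := β) (w := w) (p := p) (v := v) (f := fun c => (.stay, none, c)) rfl
  rwa [Machine.moveHead, min_eq_left h] at this

theorem emit (b : β) : Spec (Frag.emit b) w 0 v () 0 v [b] := by
  have := one (β := β) (w := w) (p := 0) (v := v) (f := fun _ => (.stay, some b, ())) rfl
  rwa [Machine.moveHead, min_eq_left (by omega)] at this

theorem emits (l : List β) : Spec (Frag.emits l) w 0 v () 0 v l := by
  induction l with
  | nil => exact pure ()
  | cons b l ih => exact (emit b).seq ih

theorem rewind [Finite α] (h : p ≤ w.length + 1) :
    Spec (β := β) Frag.rewind w p v () 0 v [] := by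
  induction p with
  | zero => exact iter_exit ((headCell h).bind (pure _))
  | succ p ih =>
    refine iter_loop (e' := ()) ((headCell h).bind (o' := []) ?_) (ih (by omega))
    have : Spec (β := β) ((Frag.moveHead .left).seq (Frag.pure (.inl () : Unit ⊕ Unit))) w (p + 1) v
        (.inl ()) p v [] := (left h).seq (pure _)
    simp only [Machine.inCell]
    cases w[p]? <;> exact this

variable [DecidableEq ι]

theorem test (i : ι) : Spec (β := β) (Frag.test i) w p v (decide (v i ≠ 0)) p v [] := by
  have h1 : Spec (β := β) (Frag.sweep i Frag.testCell) w p v (decide (v i ≠ 0)) p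
      (Function.update v i (v i)) [] :=
    sweep fun l hl hlen => ⟨l, by rw [← hl]; exact sweeps_test l, hl, hlen⟩
  rwa [Function.update_eq_self] at h1

theorem downLoop_exit [Finite E] {i : ι} {F : E → Frag α β ι E} {e : E} (h : v i = 0) :
    Spec (Frag.downLoop i F e) w p v e p v [] :=
  iter_exit ((dec_zero h).bind (pure _))

theorem downLoop_step [Finite E] {i : ι} {F : E → Frag α β ι E} {e e' r : E} {k p'' : ℕ}
    (h : v i = k + 1)
    (h1 : Spec (F e) w p (Function.update v i k) e' p' v' o)
    (h2 : Spec (Frag.downLoop i F e') w p' v' r p'' v'' o') :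
    Spec (Frag.downLoop i F e) w p v r p'' v'' (o ++ o') := by
  have h3 : Spec ((F e).bind fun e' => Frag.pure (.inl e')) w p (Function.update v i k)
    (.inl e' : E ⊕ E) p' v' (o ++ []) := h1.bind (pure _)
  exact (iter_loop ((dec_succ h).bind h3) h2).cast rfl rfl (by simp)

/-- Exit value, head position and numbers are indexed by the number of rounds that remain. -/
theorem downLoop [Finite E] {i : ι} {F : E → Frag α β ι E} (m : ℕ) (e : ℕ → E) (q : ℕ → ℕ)
    (s : ℕ → ι → ℕ) (hs : ∀ k ≤ m, s k i = k)
    (h : ∀ k < m, Spec (F (e (k + 1))) w (q (k + 1)) (Function.update (s (k + 1)) i k)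
      (e k) (q k) (s k) []) :
    Spec (Frag.downLoop i F (e m)) w (q m) (s m) (e 0) (q 0) (s 0) [] := by
  induction m with
  | zero => exact downLoop_exit (hs 0 le_rfl)
  | succ m ih =>
    exact downLoop_step (hs _ le_rfl) (h m (by omega))
      (ih (fun k hk => hs k (by omega)) fun k hk => h k (by omega))

theorem seek {i : ι} {k : ℕ} (h : v i = k) (hk : k ≤ w.length + 1) :
    Spec (β := β) (Frag.seek i) w 0 v () k (Function.update v i 0) [] := by
  have := downLoop (β := β) (w := w) (i := i) (F := fun _ => Frag.moveHead .right) k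
    (fun _ => ()) (fun j => k - j) (fun j => Function.update v i j) (by simp) (fun j hj => by
      simp only [Function.update_idem]
      have := right (β := β) (w := w) (v := Function.update v i j) (p := k - (j + 1)) (by omega)
      rwa [show k - (j + 1) + 1 = k - j by omega] at this)
  simp only [Nat.sub_self, Nat.sub_zero, ← h, Function.update_eq_self] at this ⊢
  exact this

theorem unseek [Finite α] (i : ι) (h : p + v i ≤ w.length + 1) :
    Spec (β := β) (Frag.unseek i) w p v () 0 (Function.update v i (v i + p)) [] := by
  induction p generalizing v with
  | zero =>
    rw [add_zero, Function.update_eq_self]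
    exact iter_exit ((headCell (by omega)).bind (pure _))
  | succ p ih =>
    have h2 := ih (v := Function.update v i (v i + 1)) (by simp; omega)
    refine (iter_loop (e' := ()) ((headCell (by omega)).bind (o' := []) ?_) h2).cast rfl ?_ rfl
    · have : Spec (β := β) ((Frag.moveHead .left).seq ((Frag.inc i).seq
          (Frag.pure (.inl () : Unit ⊕ Unit)))) w (p + 1) v (.inl ()) p
          (Function.update v i (v i + 1)) [] :=
        (left (by omega)).seq ((inc i (by omega)).seq (pure _))
      simp only [Machine.inCell]
      cases w[p]? <;> exact this
    · simp only [Function.update_idem, Function.update_self]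
      congr 1
      omega

theorem get [Finite α] {i : ι} (h : v i ≤ w.length) :
    Spec (β := β) (Frag.get i) w 0 v w[v i]? 0 v [] := by
  have h1 := unseek (β := β) (w := w) (p := v i) (v := Function.update v i 0) i (by simp; omega)
  rw [← letter?_inCell]
  refine ((seek rfl (by omega)).seq ((right h).seq ((headCell (by omega)).bind
    ((left (by omega)).seq (h1.seq (pure _)))))).cast rfl ?_ rfl
  simp

theorem clear (i : ι) : Spec (β := β) (Frag.clear i) w 0 v () 0 (Function.update v i 0) [] := by
  have := downLoop (β := β) (w := w) (i := i) (F := fun _ => Frag.pure ()) (v i)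
    (fun _ => ()) (fun j => 0) (fun j => Function.update v i j) (by simp) (fun j hj => by
      simp only [Function.update_idem]
      exact pure _)
  simp only [Function.update_eq_self] at this
  exact this

theorem copy {i j t : ι} (hij : i ≠ j) (hit : i ≠ t) (hjt : j ≠ t) (ht : v t = 0)
    (h : v i + v j ≤ w.length + 2) :
    Spec (β := β) (Frag.copy i j t) w 0 v () 0 (Function.update v j (v j + v i)) [] := by
  have h1 := downLoop (β := β) (w := w) (i := i) (F := fun _ => (Frag.inc j).seq (Frag.inc t)) (v i)
    (fun _ => ()) (fun _ => 0) (fun k => Function.update (Function.update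
      (Function.update v i k) j (v j + (v i - k))) t (v i - k)) (by simp [hij, hit])
    (fun k hk => by
      refine ((inc j ?_).seq (inc t ?_)).cast rfl ?_ rfl
      · simp [hij.symm, hjt]; omega
      · simp [hit.symm, hjt.symm]; omega
      · funext r
        simp only [Function.update_apply]
        split_ifs <;> simp_all <;> omega)
  have h2 := downLoop (β := β) (w := w) (i := t) (F := fun _ => Frag.inc i) (v i)
    (fun _ => ()) (fun _ => 0) (fun k => Function.update (Function.update
      (Function.update v i (v i - k)) j (v j + v i)) t k) (by simp)
    (fun k hk => by
      refine (inc i ?_).cast rfl ?_ rfl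
      · simp [hij, hit]; omega
      · funext r
        simp only [Function.update_apply]
        split_ifs <;> simp_all; omega)
  simp only [Nat.sub_self, Nat.sub_zero, add_zero] at h1 h2
  have e1 : Function.update (Function.update (Function.update v i (v i)) j (v j)) t 0 = v := by
    rw [Function.update_eq_self, Function.update_eq_self, ← ht, Function.update_eq_self]
  have e2 : Function.update (Function.update (Function.update v i (v i)) j (v j + v i)) t 0 =
      Function.update v j (v j + v i) := by
    rw [Function.update_eq_self, ← ht, Function.update_comm hjt, Function.update_eq_self]
  rw [e1] at h1
  rw [e2] at h2
  exact h1.seq h2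

/-- What a loop through the input writes. -/
def _root_.Bimodal.sweepOut (o : List α → α → List α → List β) : List α → List α → List β
  | _, [] => []
  | u, a :: r => o u a r ++ sweepOut o (a :: u) r

/-- The loop invariant is given by functions of the reversed prefix `u` already read. The body has
to leave the number on tape `i` alone; the loop advances it afterwards. -/
theorem upLoop [Finite α] [Finite E] {i : ι} {F : E → α → Frag α β ι E} (e : List α → E)
    (s : List α → ι → ℕ) (o : List α → α → List α → List β) (hs : ∀ u, s u i = u.length)
    (h : ∀ u a r, w = u.reverse ++ a :: r → Spec (F (e u) a) w 0 (s u) (e (a :: u)) 0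
      (Function.update (s (a :: u)) i u.length) (o u a r)) (u r : List α) (hw : w = u.reverse ++ r) :
    Spec (Frag.upLoop i F (e u)) w 0 (s u) (e w.reverse) 0 (s w.reverse) (sweepOut o u r) := by
  induction r generalizing u with
  | nil =>
    have h1 : u = w.reverse := by simp [hw]
    have h2 := get (β := β) (w := w) (v := s u) (i := i) (by simp [hs, h1])
    rw [hs, List.getElem?_eq_none (by simp [hw])] at h2
    rw [← h1]
    exact iter_exit (h2.bind (pure _))
  | cons a r ih =>
    have h2 := get (β := β) (w := w) (v := s u) (i := i) (by simp [hs, hw])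
    rw [hs, show w[u.length]? = some a by simp [hw]] at h2
    have h3 := inc (β := β) (w := w) (p := 0) (v := Function.update (s (a :: u)) i u.length) i
      (by simp [hw]; omega)
    have h4 : Function.update (Function.update (s (a :: u)) i u.length) i
        (Function.update (s (a :: u)) i u.length i + 1) = s (a :: u) := by
      have := hs (a :: u)
      simp only [Function.update_idem, Function.update_self]
      rw [← List.length_cons (a := a), ← this, Function.update_eq_self]
    rw [h4] at h3
    exact (iter_loop (h2.bind ((h u a r hw).bind (h3.seq (pure _)))) (ih (a :: u) (by simp [hw]))).cast
      rfl rfl (by simp [sweepOut])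

theorem ctrOp (i : ι) (op : CtrOp) (h : v i ≤ w.length + 1) :
    Spec (β := β) (Frag.ctrOp i op) w 0 v () 0 (Function.update v i (op.apply (v i))) [] := by
  cases op with
  | stay => rw [CtrOp.apply, Function.update_eq_self]; exact pure ()
  | inc => exact inc i h
  | dec =>
    rcases hv : v i with _ | k
    · refine ((dec_zero hv).bind (pure ())).cast rfl ?_ rfl
      rw [CtrOp.apply, show 0 - 1 = v i from hv.symm, Function.update_eq_self]
    · exact (dec_succ hv).bind (pure ())

end Spec

end Bimodal

/-! ### The machine that recognizes formulas -/

namespace Bimodal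

open Function (update)

instance : Finite Sym :=
  Finite.of_surjective
    (fun i : Fin 9 => [Sym.lpar, .rpar, .neg, .box, .K, .and, .x, .zero, .one][i]) fun a => by
    cases a
    exacts [⟨0, rfl⟩, ⟨1, rfl⟩, ⟨2, rfl⟩, ⟨3, rfl⟩, ⟨4, rfl⟩, ⟨5, rfl⟩, ⟨6, rfl⟩, ⟨7, rfl⟩, ⟨8, rfl⟩]

/-- The work tapes of the machines. -/
inductive Reg : Type
  | pos | loop | left | right | tmp | scan | ctr | main | cnt | par
  deriving DecidableEq

instance : Finite Reg :=
  Finite.of_surjective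
    (fun i : Fin 10 => [Reg.pos, .loop, .left, .right, .tmp, .scan, .ctr, .main, .cnt, .par][i])
    fun a => by
      cases a
      exacts [⟨0, rfl⟩, ⟨1, rfl⟩, ⟨2, rfl⟩, ⟨3, rfl⟩, ⟨4, rfl⟩, ⟨5, rfl⟩, ⟨6, rfl⟩, ⟨7, rfl⟩,
        ⟨8, rfl⟩, ⟨9, rfl⟩]

/-- The auxiliary tapes contain `0`. -/
structure Clean (v : Reg → ℕ) : Prop where
  loop : v .loop = 0
  left : v .left = 0
  right : v .right = 0
  tmp : v .tmp = 0
  scan : v .scan = 0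
  ctr : v .ctr = 0

namespace Clean

variable {v : Reg → ℕ}

theorem pos (h : Clean v) (x : ℕ) : Clean (update v .pos x) := by
  constructor <;> simp [h.1, h.2, h.3, h.4, h.5, h.6]

theorem main (h : Clean v) (x : ℕ) : Clean (update v .main x) := by
  constructor <;> simp [h.1, h.2, h.3, h.4, h.5, h.6]

theorem cnt (h : Clean v) (x : ℕ) : Clean (update v .cnt x) := by
  constructor <;> simp [h.1, h.2, h.3, h.4, h.5, h.6]

theorem par (h : Clean v) (x : ℕ) : Clean (update v .par x) := by
  constructor <;> simp [h.1, h.2, h.3, h.4, h.5, h.6]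

end Clean

namespace Frag

variable {β E : Type}

/-- Running a one-counter automaton backwards over the input before the position on tape `pos`. -/
def backScanLoop [Finite E] (δ : E → Bool → Sym → E × CtrOp × List β) : E → Frag Sym β Reg E :=
  downLoop .scan fun e => (get .scan).bind fun a => match a with
    | none => pure e
    | some a => (test .ctr).bind fun b =>
      (emits (δ e (!b) a).2.2).seq ((ctrOp .ctr (δ e (!b) a).2.1).seq (pure (δ e (!b) a).1))

/-- The loop consumes a copy of `pos`, and the automaton may stop with a positive counter. Clearing
`ctr` leaves all tapes as they were. -/
def backScan [Finite E] (δ : E → Bool → Sym → E × CtrOp × List β) (e : E) : Frag Sym β Reg E :=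
  (copy .pos .scan .tmp).seq <| (backScanLoop δ e).bind fun e => (clear .ctr).seq (pure e)

def validBody (m : Mode) (a : Sym) : Frag Sym β Reg Mode :=
  if needsTop m a then (backScan topStep (.run false)).bind fun t => pure (modeStep m t a)
  else pure (modeStep m (.run false) a)

/-- Recognizing formulas. -/
def valid : Frag Sym β Reg Bool :=
  (upLoop .pos validBody .want).bind fun m => (backScan topStep (.run false)).bind fun t =>
    (clear .pos).seq (pure (m.isGot && decide (t = .run false)))

end Frag

theorem update_zero {v : Reg → ℕ} {i : Reg} (h : v i = 0) : update v i 0 = v := by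
  rw [← h, Function.update_eq_self]

theorem sweepOut_nil {α β : Type} (u r : List α) :
    sweepOut (fun _ _ _ => ([] : List β)) u r = [] := by
  induction r generalizing u with
  | nil => rfl
  | cons a r ih => simp [sweepOut, ih]

namespace Spec

variable {β E : Type} {w : List Sym} {v : Reg → ℕ}

/-- Each letter raises the counter by at most one, so the bound on `v .ctr + u.length` keeps it
within the tape. Its final value is left unspecified, being erased afterwards. -/
theorem backScanLoop [Finite E] (δ : E → Bool → Sym → E × CtrOp × List β) (u : List Sym) :
    ∀ (e : E) (v : Reg → ℕ) (r : List Sym), w = u.reverse ++ r → v .scan = u.length →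
      v .ctr + u.length ≤ w.length → ∃ c, Spec (Frag.backScanLoop δ e) w 0 v
        (scan δ e (v .ctr) u).1 0 (update (update v .scan 0) .ctr c) (scan δ e (v .ctr) u).2 := by
  induction u with
  | nil =>
    intro e v r _ h1 _
    refine ⟨v .ctr, (downLoop_exit h1).cast rfl ?_ rfl⟩
    have h1 : v .scan = 0 := h1
    funext i
    cases i <;> simp [h1]
  | cons a u ih =>
    intro e v r hw h1 h2
    rw [List.reverse_cons, List.append_assoc, List.singleton_append] at hw
    rw [List.length_cons] at h1 h2
    set v₁ := update v .scan u.length with hv₁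
    have hc : v₁ .ctr = v .ctr := by simp [hv₁]
    have hs : v₁ .scan = u.length := by simp [hv₁]
    have hget := get (β := β) (w := w) (v := v₁) (i := .scan) (by rw [hs]; omega)
    rw [hs, show w[u.length]? = some a by simp [hw]] at hget
    have htest := test (β := β) (w := w) (p := 0) (v := v₁) .ctr
    rw [hc] at htest
    have hop := ctrOp (β := β) (w := w) (v := v₁) .ctr (δ e (decide (v .ctr = 0)) a).2.1 (by omega)
    rw [hc] at hop
    set v₂ := update v₁ .ctr ((δ e (decide (v .ctr = 0)) a).2.1.apply (v .ctr)) with hv₂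
    have hc₂ : v₂ .ctr = (δ e (decide (v .ctr = 0)) a).2.1.apply (v .ctr) := by simp [hv₂]
    obtain ⟨c, hc'⟩ := ih (δ e (decide (v .ctr = 0)) a).1 v₂ (a :: r) hw (by simp [hv₂, hs]) (by
      rw [hc₂]
      cases (δ e (decide (v .ctr = 0)) a).2.1 <;> simp only [CtrOp.apply] <;> omega)
    have hbody : Spec ((Frag.emits (δ e (!decide (v .ctr ≠ 0)) a).2.2).seq
        ((Frag.ctrOp .ctr (δ e (!decide (v .ctr ≠ 0)) a).2.1).seq
          (Frag.pure (δ e (!decide (v .ctr ≠ 0)) a).1))) w 0 v₁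
        (δ e (decide (v .ctr = 0)) a).1 0 v₂ (δ e (decide (v .ctr = 0)) a).2.2 := by
      have hb : (!decide (v .ctr ≠ 0)) = decide (v .ctr = 0) := by simp
      rw [hb]
      exact ((emits _).seq (hop.seq (pure _))).cast rfl rfl (by simp)
    refine ⟨c, (downLoop_step h1 (hget.bind (htest.bind hbody)) hc').cast ?_ ?_ ?_⟩
    · rw [hc₂]; rfl
    · funext i
      cases i <;> simp [hv₂, hv₁]
    · rw [hc₂]; rfl

theorem backScan [Finite E] (δ : E → Bool → Sym → E × CtrOp × List β) (e : E) {u r : List Sym}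
    (hw : w = u.reverse ++ r) (h1 : v .pos = u.length) (hs : v .scan = 0) (hc : v .ctr = 0)
    (ht : v .tmp = 0) :
    Spec (Frag.backScan δ e) w 0 v (scan δ e 0 u).1 0 v (scan δ e 0 u).2 := by
  have hlen : w.length = u.length + r.length := by simp [hw]
  have h2 := copy (β := β) (w := w) (v := v) (i := .pos) (j := .scan) (t := .tmp) (by simp) (by simp)
    (by simp) ht (by rw [h1, hs]; omega)
  rw [hs, zero_add, h1] at h2
  obtain ⟨c, h3⟩ := backScanLoop δ u e (update v .scan u.length) r hw (by simp)
    (by simp [hc, hlen])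
  have hc' : update v .scan u.length .ctr = 0 := by simp [hc]
  rw [hc'] at h3
  refine (h2.seq (h3.bind (seq (clear Reg.ctr) (pure _)))).cast rfl ?_ (by simp)
  funext i
  cases i <;> simp [hs, hc]

/-- For these letters the scan can be skipped and a dummy value passed instead. -/
theorem modeStep_eq {m : Mode} {a : Sym} (h : needsTop m a = false) (t t' : TopState) :
    modeStep m t a = modeStep m t' a := by
  cases a <;> cases m <;> first | rfl | cases h

theorem modeRun_append (r : List Sym) (a : Sym) : ∀ (m : Mode) (u : List Sym),
    modeRun m u (r ++ [a]) = modeStep (modeRun m u r) (top false 0 (r.reverse ++ u)) a := by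
  induction r with
  | nil => exact fun _ _ => rfl
  | cons b r ih => intro m u; simp [modeRun, ih]

theorem valid (h0 : v .pos = 0) (hs : v .scan = 0) (hc : v .ctr = 0) (ht : v .tmp = 0) :
    Spec (β := β) Frag.valid w 0 v (accepts w) 0 v [] := by
  have hv : ∀ k, update (update v .pos k) .pos 0 = v := by
    intro k
    rw [Function.update_idem, update_zero h0]
  have h1 := upLoop (β := β) (w := w) (i := .pos) (F := Frag.validBody)
    (fun u => modeRun .want [] u.reverse) (fun u => update v .pos u.length) (fun _ _ _ => [])
    (by simp) (fun u a r hw => by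
      have hstep : modeRun .want [] (a :: u).reverse =
          modeStep (modeRun .want [] u.reverse) (top false 0 u) a := by
        rw [List.reverse_cons, modeRun_append, List.append_nil, List.reverse_reverse]
      simp only [Function.update_idem, Frag.validBody]
      rw [hstep]
      split_ifs with hn
      · have := backScan (β := β) (v := update v .pos u.length) topStep (.run false) hw (by simp)
          (by simp [hs]) (by simp [hc]) (by simp [ht])
        rw [scan_topStep] at this
        exact this.bind (pure _)
      · rw [modeStep_eq (by simpa using hn) (top false 0 u) (.run false)]
        exact pure _) [] w rfl
  rw [sweepOut_nil] at h1
  have h2 := backScan (β := β) (w := w) (v := update v .pos w.length) topStep (.run false)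
    (u := w.reverse) (r := []) (by simp) (by simp) (by simp [hs]) (by simp [hc]) (by simp [ht])
  rw [scan_topStep] at h2
  rw [List.length_nil, update_zero h0, List.length_reverse, List.reverse_reverse] at h1
  refine (h1.bind (h2.bind (seq (clear Reg.pos) (pure _)))).cast ?_ (hv _) rfl
  rfl

end Spec

theorem logspaceDecidable_formulaLanguage : LogspaceDecidable formulaLanguage :=
  logspaceDecidable_of_spec Frag.valid fun w =>
    ⟨accepts w, 0, _, Spec.valid rfl rfl rfl rfl, accepts_iff w⟩

end Bimodal

/-! ### Machines that compare variables and find `main` -/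

namespace Bimodal

open Function (update)

namespace Frag

variable {β : Type}

/-- Comparing the digit strings at the positions on the tapes `left` and `right`. -/
def eqDigitsLoop : Frag Sym β Reg Bool :=
  iter (fun _ : Unit => (get .left).bind fun a => (get .right).bind fun b =>
    if a.any Sym.isDigit = true ∧ a = b then
      (inc .left).seq ((inc .right).seq (pure (.inl ())))
    else pure (.inr (!a.any Sym.isDigit && !b.any Sym.isDigit))) ()

def eqDigits : Frag Sym β Reg Bool :=
  eqDigitsLoop.bind fun b => (clear .left).seq ((clear .right).seq (pure b))

def seenBody (found : Bool) : Frag Sym β Reg Bool :=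
  (get .loop).bind fun a => if a = some .x then
      (copy .loop .left .tmp).seq <| (inc .left).seq <| (copy .pos .right .tmp).seq <|
        (inc .right).seq <| eqDigits.bind fun b => pure (b || found)
    else pure found

/-- Whether the variable at the position on tape `pos` occurs before. -/
def seen : Frag Sym β Reg Bool :=
  (copy .pos .loop .tmp).seq (downLoop .loop seenBody false)

def matchStep (e : Bool) (b : Bool) (c : InCell Sym) : Bool × Move × Option β :=
  if e = true ∧ c.letter? = some (digitSym b) then (true, .right, none) else (false, .stay, none)

/-- Whether the variable at the position on tape `loop` has the index on tape `main`. -/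
def matchMain : Frag Sym β Reg Bool :=
  (copy .loop .left .tmp).seq <| (inc .left).seq <| (seek .left).seq <| (moveHead .right).seq <|
    (test .main).bind fun b =>
      -- For the number `0`, `feed` would read no digit, so the single letter `0` is compared
      -- directly.
      (if b then feed .main matchStep true
        else one fun c => ((matchStep (β := β) true false c).2.1, none, (matchStep (β := β) true false c).1)).bind
      fun e => headCell.bind fun c => rewind.seq (pure (e && !c.letter?.any Sym.isDigit))

def occursBody (found : Bool) (a : Sym) : Frag Sym β Reg Bool :=
  if a = .x then matchMain.bind fun b => pure (b || found) else pure found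

/-- Whether the variable with the index on tape `main` occurs in the input. -/
def occurs : Frag Sym β Reg Bool :=
  (upLoop .loop occursBody false).bind fun b => (clear .loop).seq (pure b)

/-- Finding the least index of a variable that does not occur in the input. -/
def findMain : Frag Sym β Reg Unit :=
  iter (fun _ : Unit => occurs.bind fun b =>
    if b then (inc .main).seq (pure (.inl ())) else pure (.inr ())) ()

/-- Writing the variable with the index on tape `main`. -/
def emitMain : Frag Sym Sym Reg Unit :=
  (emit .x).seq <| (test .main).bind fun b =>
    if b then feed .main (fun _ b _ => ((), .stay, some (digitSym b))) () else emit .zero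

end Frag

/-- The digit strings of the variables in `u.reverse`, where `r` is what follows. -/
def occBefore : List Sym → List Sym → List (List Sym)
  | [], _ => []
  | a :: u, r => if a = .x then digits r :: occBefore u (a :: r) else occBefore u (a :: r)

theorem occ_reverse_append (u r : List Sym) :
    occ (u.reverse ++ r) = (occBefore u r).reverse ++ occ r := by
  induction u generalizing r with
  | nil => rfl
  | cons a u ih =>
    rw [List.reverse_cons, List.append_assoc, List.singleton_append, ih, occ, occBefore]
    split_ifs <;> simp

/-- The description by positions is the one that a loop accessing the input through indices can
verify. -/
theorem mem_occBefore {w u r : List Sym} (hw : w = u.reverse ++ r) (d : List Sym) :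
    d ∈ occBefore u r ↔ ∃ j < u.length, w[j]? = some .x ∧ digits (w.drop (j + 1)) = d := by
  induction u generalizing r with
  | nil => simp [occBefore]
  | cons a u ih =>
    rw [List.reverse_cons, List.append_assoc, List.singleton_append] at hw
    have h1 : w[u.length]? = some a := by simp [hw]
    have h2 : w.drop (u.length + 1) = r := by
      rw [hw, show u.length + 1 = (u.reverse ++ [a]).length by simp,
        show u.reverse ++ a :: r = (u.reverse ++ [a]) ++ r by simp, List.drop_left]
    have h3 : d ∈ occBefore (a :: u) r ↔ (a = .x ∧ digits r = d) ∨ d ∈ occBefore u (a :: r) := by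
      rw [occBefore]
      split_ifs with h <;> simp [h, eq_comm]
    rw [h3, ih hw]
    constructor
    · rintro (⟨rfl, rfl⟩ | ⟨j, hj, h⟩)
      · exact ⟨u.length, by simp, h1, by rw [h2]⟩
      · exact ⟨j, by simp; omega, h⟩
    · rintro ⟨j, hj, h, h'⟩
      rw [List.length_cons] at hj
      rcases Nat.lt_succ_iff_lt_or_eq.1 hj with hj | rfl
      · exact .inr ⟨j, hj, h, h'⟩
      · rw [h1] at h
        rw [h2] at h'
        exact .inl ⟨by simpa using h, h'⟩

theorem digits_cons (a : Sym) (l : List Sym) :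
    digits (a :: l) = if a.isDigit then a :: digits l else [] := by
  rw [digits, List.takeWhile_cons]; rfl

/-- The comparison stops at the first place where the two strings do not show the same digit. From
there on the digit strings agree only if both have ended. -/
theorem digits_eq_digits_iff (l l' : List Sym) (h : ¬ (l.head?.any Sym.isDigit = true ∧
    l.head? = l'.head?)) : decide (digits l = digits l') =
      (!l.head?.any Sym.isDigit && !l'.head?.any Sym.isDigit) := by
  rcases l with _ | ⟨a, l⟩ <;> rcases l' with _ | ⟨b, l'⟩
  · rfl
  · cases hb : b.isDigit <;> simp [hb, digits]
  · cases ha : a.isDigit <;> simp [ha, digits]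
  · cases ha : a.isDigit <;> cases hb : b.isDigit <;> simp [digits_cons, ha, hb] at h ⊢
    exact fun h' => absurd h' h

/-- A prefix test alone would confuse an index with a longer one beginning with the same digits; the
next letter decides. -/
theorem digits_eq_iff_prefix {d : List Sym} (hd : ∀ a ∈ d, a.isDigit = true) (l : List Sym) :
    digits l = d ↔ d <+: l ∧ (l[d.length]?).any Sym.isDigit = false := by
  induction d generalizing l with
  | nil =>
    rcases l with _ | ⟨a, l⟩
    · simp [digits]
    · cases ha : a.isDigit <;> simp [digits_cons, ha]
  | cons b d ih =>
    have hb := hd b (by simp)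
    rcases l with _ | ⟨a, l⟩
    · simp [digits]
    · rw [digits_cons, List.cons_prefix_cons]
      have := ih (fun a ha => hd a (by simp [ha])) l
      by_cases hab : b = a
      · subst hab
        simp [hb, this]
      · have : (if a.isDigit then a :: digits l else []) ≠ b :: d := by
          split_ifs
          · simp [Ne.symm hab]
          · simp
        simp [hab, this]

namespace Spec

variable {β : Type} {w : List Sym} {v : Reg → ℕ}

theorem eqDigitsLoop (l : List Sym) : ∀ v : Reg → ℕ, l = w.drop (v .left) → v .left ≤ w.length →
    v .right ≤ w.length → ∃ x y, Spec (β := β) Frag.eqDigitsLoop w 0 v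
      (decide (digits l = digits (w.drop (v .right)))) 0 (update (update v .left x) .right y) [] := by
  induction l with
  | nil =>
    intro v hl h1 h2
    refine ⟨v .left, v .right, ?_⟩
    have g1 := get (β := β) h1
    have g2 := get (β := β) h2
    rw [← List.head?_drop] at g1 g2
    rw [← hl] at g1
    simp only [Function.update_eq_self]
    refine iter_exit (g1.bind (o' := []) (g2.bind (o' := []) ?_))
    rw [if_neg (by simp), digits_eq_digits_iff _ _ (by simp)]
    exact pure _
  | cons a l ih =>
    intro v hl h1 h2
    have g1 := get (β := β) h1
    have g2 := get (β := β) h2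
    rw [← List.head?_drop] at g1 g2
    rw [← hl] at g1
    by_cases hc : ((a :: l).head?.any Sym.isDigit = true ∧ (a :: l).head? = (w.drop (v .right)).head?)
    · have hlt : v .left < w.length := by
        by_contra h
        rw [List.drop_eq_nil_of_le (by omega)] at hl
        cases hl
      have hlt' : v .right < w.length := by
        by_contra h
        rw [List.drop_eq_nil_of_le (by omega : w.length ≤ v .right)] at hc
        cases hc.2
      have hd : w.drop (v .right) = a :: w.drop (v .right + 1) := by
        have := List.drop_eq_getElem_cons hlt'
        rw [this] at hc ⊢
        have h2 := hc.2
        simp only [List.head?_cons, Option.some.injEq] at h2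
        rw [h2]
      have hl' : l = w.drop (v .left + 1) := by
        rw [List.drop_eq_getElem_cons hlt] at hl
        exact (List.cons.inj hl).2
      set v₁ := update (update v .left (v .left + 1)) .right (v .right + 1) with hv₁
      have e1 : v₁ .left = v .left + 1 := by simp [hv₁]
      have e2 : v₁ .right = v .right + 1 := by simp [hv₁]
      obtain ⟨x, y, h⟩ := ih v₁ (by rw [e1, hl']) (by omega) (by omega)
      refine ⟨x, y, (iter_loop (e' := ()) (g1.bind (o' := []) (g2.bind (o' := []) ?_)) h).cast ?_ ?_ rfl⟩
      · rw [if_pos hc]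
        have i1 := inc (β := β) (w := w) (p := 0) (v := v) Reg.left (by omega)
        have i2 := inc (β := β) (w := w) (p := 0) (v := update v .left (v .left + 1)) Reg.right
          (by simp; omega)
        exact (i1.seq (i2.seq (pure _))).cast rfl (by simp [hv₁]) rfl
      · have ha : a.isDigit = true := by simpa using hc.1
        rw [e2, hd, digits_cons, digits_cons, if_pos ha, if_pos ha]
        simp
      · funext i
        cases i <;> simp [hv₁]
    · refine ⟨v .left, v .right, ?_⟩
      simp only [Function.update_eq_self]
      refine iter_exit (g1.bind (o' := []) (g2.bind (o' := []) ?_))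
      rw [if_neg hc, digits_eq_digits_iff _ _ hc]
      exact pure _

theorem eqDigits (h1 : v .left ≤ w.length) (h2 : v .right ≤ w.length) :
    Spec (β := β) Frag.eqDigits w 0 v
      (decide (digits (w.drop (v .left)) = digits (w.drop (v .right)))) 0
      (update (update v .left 0) .right 0) [] := by
  obtain ⟨x, y, h⟩ := eqDigitsLoop (β := β) _ v rfl h1 h2
  refine (h.bind (seq (clear Reg.left) (seq (clear Reg.right) (pure _)))).cast rfl ?_ rfl
  funext i
  cases i <;> simp

theorem seen {u r : List Sym} {a : Sym} (hw : w = u.reverse ++ a :: r) (hp : v .pos = u.length)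
    (hv : Clean v) : Spec (β := β) Frag.seen w 0 v (decide (digits r ∈ occBefore u (a :: r))) 0 v [] := by
  have hlen : w.length = u.length + r.length + 1 := by simp [hw]; omega
  have hr : w.drop (u.length + 1) = r := by
    rw [hw, show u.length + 1 = (u.reverse ++ [a]).length by simp,
      show u.reverse ++ a :: r = (u.reverse ++ [a]) ++ r by simp, List.drop_left]
  have hcopy := copy (β := β) (w := w) (v := v) (i := .pos) (j := .loop) (t := .tmp) (by simp)
    (by simp) (by simp) hv.tmp (by rw [hp, hv.loop]; omega)
  rw [hv.loop, zero_add, hp] at hcopy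
  -- The loop counts down from `u.length`; when it has reached `k`, the positions from `k` up to
  -- `u.length - 1` have been examined.
  let P : ℕ → Prop := fun k => ∃ j, k ≤ j ∧ j < u.length ∧ w[j]? = some .x ∧
    digits (w.drop (j + 1)) = digits r
  classical
  have hP : ∀ k < u.length, P k ↔ (w[k]? = some .x ∧ digits (w.drop (k + 1)) = digits r) ∨
      P (k + 1) := by
    intro k hk
    constructor
    · rintro ⟨j, h1, h2, h3⟩
      rcases h1.eq_or_lt with rfl | h1
      · exact .inl h3
      · exact .inr ⟨j, h1, h2, h3⟩
    · rintro (h | ⟨j, h1, h2, h3⟩)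
      · exact ⟨k, le_rfl, hk, h⟩
      · exact ⟨j, by omega, h2, h3⟩
  have hloop := downLoop (β := β) (w := w) (i := .loop) (F := Frag.seenBody) u.length
    (fun k => decide (P k)) (fun _ => 0) (fun k => update v .loop k) (by simp) (fun k hk => by
      simp only [Function.update_idem]
      set v₁ := update v .loop k with hv₁
      have hg := get (β := β) (w := w) (v := v₁) (i := .loop) (by simp [hv₁]; omega)
      rw [show v₁ .loop = k by simp [hv₁]] at hg
      refine hg.bind (o' := []) ?_
      split_ifs with hx
      · have c1 := copy (β := β) (w := w) (v := v₁) (i := .loop) (j := .left) (t := .tmp) (by simp)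
          (by simp) (by simp) (by simp [hv₁, hv.tmp]) (by simp [hv₁, hv.left]; omega)
        have i1 := inc (β := β) (w := w) (p := 0) (v := update v₁ .left k) Reg.left (by simp; omega)
        have c2 := copy (β := β) (w := w) (v := update v₁ .left (k + 1)) (i := .pos) (j := .right)
          (t := .tmp) (by simp) (by simp) (by simp) (by simp [hv₁, hv.tmp])
          (by simp [hv₁, hv.right, hp]; omega)
        have i2 := inc (β := β) (w := w) (p := 0)
          (v := update (update v₁ .left (k + 1)) .right u.length) Reg.right (by simp; omega)
        have q := eqDigits (β := β) (w := w)
          (v := update (update v₁ .left (k + 1)) .right (u.length + 1))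
          (by simp; omega) (by simp; omega)
        refine ((c1.cast rfl ?_ rfl).seq ((i1.cast rfl ?_ rfl).seq ((c2.cast rfl ?_ rfl).seq
          ((i2.cast rfl ?_ rfl).seq
          (q.bind (G := fun b => Frag.pure (b || decide (P (k + 1)))) (pure _)))))).cast ?_ ?_ rfl
        · simp [hv₁, hv.left]
        · simp
        · simp [hv₁, hv.right, hp]
        · simp
        · simp [hP k hk, hx, hr]
        · funext i
          cases i <;> simp [hv₁, hv.left, hv.right]
      · have : P k ↔ P (k + 1) := by simp [hP k hk, hx]
        simp only [this]
        exact pure _)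
  have hfalse : decide (P u.length) = false := by
    simp only [P, decide_eq_false_iff_not]
    rintro ⟨j, h1, h2, -⟩
    omega
  rw [hfalse] at hloop
  refine (hcopy.seq hloop).cast ?_ (update_zero hv.loop) rfl
  rw [decide_eq_decide, mem_occBefore hw]
  simp [P]

theorem foldl_match_false (ds : List Bool) {p : ℕ} (hp : p ≤ w.length + 1) (o : List β) :
    ds.foldl (feedStep w Frag.matchStep) (false, p, o) = (false, p, o) := by
  induction ds with
  | nil => rfl
  | cons b ds ih => simpa [feedStep, Frag.matchStep, Machine.moveHead, hp] using ih

/-- The final head position is specified only after a successful match, where it is the cell just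
behind the matched digits that has to be inspected. -/
theorem foldl_match (ds : List Bool) : ∀ j ≤ w.length, ∃ q ≤ w.length + 1,
    (ds.map digitSym <+: w.drop j → q = j + ds.length + 1) ∧ ∀ o : List β,
    ds.foldl (feedStep w Frag.matchStep) (true, j + 1, o) =
      (decide (ds.map digitSym <+: w.drop j), q, o) := by
  induction ds with
  | nil => exact fun j hj => ⟨j + 1, by omega, by simp, by simp⟩
  | cons b ds ih =>
    intro j hj
    by_cases hb : w[j]? = some (digitSym b)
    · have hlt : j < w.length := by
        by_contra h
        rw [List.getElem?_eq_none (by omega)] at hb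
        cases hb
      obtain ⟨q, hq, h1, h2⟩ := ih (j + 1) (by omega)
      have hd : w.drop j = digitSym b :: w.drop (j + 1) := by
        rw [List.drop_eq_getElem_cons hlt]
        rw [List.getElem?_eq_getElem hlt, Option.some.injEq] at hb
        rw [hb]
      have hpre : (b :: ds).map digitSym <+: w.drop j ↔ ds.map digitSym <+: w.drop (j + 1) := by
        rw [hd, List.map_cons, List.prefix_cons_inj]
      simp only [hpre]
      refine ⟨q, hq, fun h => by rw [h1 h, List.length_cons]; omega, fun o => ?_⟩
      rw [List.foldl_cons, ← h2]
      simp [feedStep, Frag.matchStep, letter?_inCell, hb, Machine.moveHead]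
      rw [min_eq_left (by omega)]
    · have hn : ¬ (b :: ds).map digitSym <+: w.drop j := by
        rintro ⟨t, ht⟩
        rw [← List.head?_drop, ← ht] at hb
        simp at hb
      refine ⟨j + 1, by omega, fun h => absurd h hn, fun o => ?_⟩
      rw [decide_eq_false hn, List.foldl_cons, ← foldl_match_false (w := w) ds (by omega) o]
      simp [feedStep, Frag.matchStep, letter?_inCell, hb, Machine.moveHead, hj]

theorem matchMain (hl : v .loop < w.length) (h1 : v .left = 0) (ht : v .tmp = 0) :
    Spec (β := β) Frag.matchMain w 0 v (decide (digits (w.drop (v .loop + 1)) = bin (v .main))) 0 v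
      [] := by
  set k := v .loop with hk
  have c1 := copy (β := β) (w := w) (v := v) (i := .loop) (j := .left) (t := .tmp) (by simp)
    (by simp) (by simp) ht (by rw [h1]; omega)
  rw [h1, zero_add, ← hk] at c1
  have i1 := inc (β := β) (w := w) (p := 0) (v := update v .left k) Reg.left (by simp; omega)
  simp only [Function.update_self, Function.update_idem] at i1
  have s1 := seek (β := β) (w := w) (v := update v .left (k + 1)) (i := Reg.left) (k := k + 1)
    (by simp) (by omega)
  rw [Function.update_idem, update_zero h1] at s1
  have m1 := right (β := β) (w := w) (v := v) (p := k + 1) (by omega)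
  have t1 := test (β := β) (w := w) (v := v) (p := k + 1 + 1) Reg.main
  let ds : List Bool := if v .main = 0 then [false] else (v .main).bits.reverse
  have hds : bin (v .main) = ds.map digitSym := by
    by_cases h0 : v .main = 0
    · simp only [ds, h0, if_true]; rfl
    · simp only [ds, if_neg h0, bin_of_ne_zero h0]
  obtain ⟨q, hq, hq', hfold⟩ := foldl_match (β := β) (w := w) ds (k + 1) (by omega)
  have f1 : Spec (β := β) (if decide (v .main ≠ 0) = true then
        Frag.feed .main Frag.matchStep true
      else Frag.one fun c => ((Frag.matchStep (β := β) true false c).2.1, none,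
        (Frag.matchStep (β := β) true false c).1)) w (k + 1 + 1) v
      (decide (ds.map digitSym <+: w.drop (k + 1))) q v [] := by
    by_cases h0 : v .main = 0
    · rw [if_neg (by simp [h0])]
      have hd : ds = [false] := by simp only [ds, h0, if_true]
      have h2 := hfold []
      rw [hd, List.foldl_cons, List.foldl_nil] at h2
      have h3 := one (β := β) (w := w) (p := k + 1 + 1) (v := v) (f := fun c =>
        ((Frag.matchStep (β := β) true false c).2.1, none, (Frag.matchStep (β := β) true false c).1)) rfl
      simp only [feedStep, Prod.mk.injEq] at h2
      rw [h2.1, h2.2.1] at h3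
      rw [hd]
      exact h3
    · rw [if_pos (by simp [h0])]
      have hd : ds = (v .main).bits.reverse := by simp only [ds, if_neg h0]
      rw [hd] at hfold ⊢
      exact feed fun o => by simpa using hfold o
  have hc := headCell (β := β) (w := w) (p := q) (v := v) hq
  refine (c1.seq (i1.seq (s1.seq (m1.seq (t1.bind (f1.bind (hc.bind
    ((rewind hq).seq (pure _))))))))).cast ?_ rfl rfl
  have hdig := digits_eq_iff_prefix (d := ds.map digitSym)
    (fun a ha => by obtain ⟨b, -, rfl⟩ := List.mem_map.1 ha; exact isDigit_digitSym b) (w.drop (k + 1))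
  rw [hds, Bool.eq_iff_iff]
  by_cases hpre : ds.map digitSym <+: w.drop (k + 1)
  · rw [hq' hpre, letter?_inCell]
    simp only [decide_eq_true_eq, hdig, Bool.and_eq_true, Bool.not_eq_true', hpre, true_and,
      List.length_map, List.getElem?_drop]
  · simp [hdig, hpre]

theorem occurs (h0 : v .loop = 0) (h1 : v .left = 0) (ht : v .tmp = 0) :
    Spec (β := β) Frag.occurs w 0 v (decide (bin (v .main) ∈ occ w)) 0 v [] := by
  have hl := upLoop (β := β) (w := w) (i := .loop) (F := Frag.occursBody)
    (fun u => decide (bin (v .main) ∈ occBefore u (w.drop u.length)))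
    (fun u => update v .loop u.length) (fun _ _ _ => []) (by simp) (fun u a r hw => by
      have hr : w.drop u.length = a :: r := by
        rw [hw, ← List.length_reverse, List.drop_left]
      have hr' : w.drop (u.length + 1) = r := by
        rw [← List.drop_drop, hr]; rfl
      simp only [Function.update_idem, Frag.occursBody, List.length_cons, hr, hr', occBefore]
      split_ifs with hx
      · have := matchMain (β := β) (w := w) (v := update v .loop u.length) (by simp [hw])
          (by simp [h1]) (by simp [ht])
        simp only [Function.update_self, hr', Function.update_of_ne (show Reg.main ≠ .loop by simp)] at this
        refine (this.bind (G := fun b => Frag.pure (b || decide (bin (v .main) ∈ occBefore u (a :: r))))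
          (pure _)).cast ?_ rfl rfl
        simp [eq_comm]
      · exact pure _) [] w rfl
  rw [sweepOut_nil, List.length_nil, update_zero h0, List.length_reverse, List.drop_length,
    List.drop_zero] at hl
  refine (hl.bind (seq (clear Reg.loop) (pure _))).cast ?_ ?_ rfl
  · have := occ_reverse_append w.reverse []
    rw [List.reverse_reverse, List.append_nil] at this
    rw [this]
    simp [occ]
  · rw [Function.update_idem, update_zero h0]

theorem findMain (φ : Formula) (h0 : v .loop = 0) (h1 : v .left = 0) (ht : v .tmp = 0)
    (hm : v .main ≤ φ.mainIdx) : Spec (β := β) Frag.findMain φ.str 0 v () 0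
      (update v .main φ.mainIdx) [] := by
  obtain ⟨k, hk⟩ := Nat.exists_eq_add_of_le hm
  induction k generalizing v with
  | zero =>
    rw [add_zero] at hk
    have := occurs (β := β) (w := φ.str) h0 h1 ht
    rw [← hk, decide_eq_false (bin_mainIdx_notMem φ)] at this
    rw [hk, Function.update_eq_self]
    exact iter_exit (this.bind (pure _))
  | succ k ih =>
    have h2 := occurs (β := β) (w := φ.str) h0 h1 ht
    rw [decide_eq_true (bin_mem_of_lt_mainIdx (show v .main < φ.mainIdx by omega))] at h2
    -- The search never passes `mainIdx`, so `mainIdx_le` keeps the candidate within the tape bound.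
    have h3 := inc (β := β) (w := φ.str) (p := 0) (v := v) Reg.main (by
      have := mainIdx_le φ; omega)
    have h4 := ih (v := update v .main (v .main + 1)) (by simp [h0]) (by simp [h1]) (by simp [ht])
      (by simp; omega) (by simp; omega)
    refine (iter_loop (h2.bind (o' := []) (h3.seq (pure (Sum.inl ())))) h4).cast rfl ?_ rfl
    rw [Function.update_idem]

theorem emitMain : Spec Frag.emitMain w 0 v () 0 v (Formula.var (v .main)).str := by
  refine Spec.cast ((emit Sym.x).seq ((test Reg.main).bind (o' := bin (v .main)) ?_)) rfl rfl rfl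
  by_cases h0 : v .main = 0
  · rw [if_neg (by simp [h0]), h0]
    exact emit _
  · rw [if_pos (by simp [h0])]
    refine feed fun o => ?_
    rw [bin_of_ne_zero h0]
    generalize (v .main).bits.reverse = ds
    induction ds generalizing o with
    | nil => simp
    | cons b ds ih =>
      have := ih (o ++ [digitSym b])
      simpa [feedStep, Machine.moveHead] using this

end Spec

end Bimodal

/-! ### The machine that computes the translation -/

namespace Bimodal

open Function (update)

namespace Frag

/-- Writing the index of the variable at the position on tape `pos`. -/
def emitDigitsLoop : Frag Sym Sym Reg Unit :=
  iter (fun _ : Unit => (get .left).bind fun a => match a with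
    | none => pure (.inr ())
    | some a => if a.isDigit = true then (emit a).seq ((inc .left).seq (pure (.inl ())))
      else pure (.inr ())) ()

def emitDigits : Frag Sym Sym Reg Unit :=
  (copy .pos .left .tmp).seq <| (inc .left).seq <| emitDigitsLoop.seq (clear .left)

def emitItem : Frag Sym Sym Reg Unit :=
  (emits [.K, .neg, .lpar, .neg, .box, .neg, .lpar, .neg, .neg]).seq <| emitMain.seq <|
  (emits [.and, .neg, .x]).seq <| emitDigits.seq <|
  (emits [.rpar, .and, .neg, .box, .neg, .lpar, .neg, .neg]).seq <| emitMain.seq <|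
  (emits [.and, .neg, .neg, .x]).seq <| emitDigits.seq <| emits [.rpar, .rpar]

def emitPrologue : Frag Sym Sym Reg Unit :=
  (emits [.lpar]).seq <| emitMain.seq <|
  (emits [.and, .lpar, .K, .box, .neg, .lpar, .neg, .neg, .neg]).seq <| emitMain.seq <|
  (emits [.and, .neg, .box, .neg]).seq <| emitMain.seq <| emits [.rpar, .and, .lpar]

def countFirstsBody (_ : Unit) (a : Sym) : Frag Sym Sym Reg Unit :=
  if a = .x then seen.bind fun b => if b then pure () else inc .cnt else pure ()

/-- Counting the variables of the input on tape `cnt`. -/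
def countFirsts : Frag Sym Sym Reg Unit := (upLoop .pos countFirstsBody ()).seq (clear .pos)

def emitItemsBody (_ : Unit) (a : Sym) : Frag Sym Sym Reg Unit :=
  if a = .x then seen.bind fun b => if b then pure () else
    -- Tape `cnt` holds the number of variables still to be listed. If it becomes `0` here, this is
    -- the last one and needs neither `(` nor `∧`.
    (dec .cnt).bind fun _ => (test .cnt).bind fun b =>
      if b then (emit .lpar).seq (emitItem.seq ((emit .and).seq (inc .par))) else emitItem
  else pure ()

def emitItems : Frag Sym Sym Reg Unit := (upLoop .pos emitItemsBody ()).seq (clear .pos)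

/-- Writing the parentheses that close after the position on tape `pos`. -/
def emitClosers : Frag Sym Sym Reg Unit := (backScan closeStep .start).bind fun _ => pure ()

def decPos : Frag Sym Sym Reg Unit := (dec .pos).bind fun _ => pure ()

/-- Looking one letter ahead decides whether the index ends here. With `pos` advanced, the backward
scan starts from the digit itself; `decPos` undoes the advance. -/
def afterDigit : Frag Sym Sym Reg Unit :=
  (inc .pos).seq <| (get .pos).bind fun b =>
    if b.any Sym.isDigit = true then decPos else emitClosers.seq decPos

def emitTransBody (_ : Unit) : Sym → Frag Sym Sym Reg Unit
  | .K => (emits [.K, .neg, .lpar]).seq (emitMain.seq (emits [.and, .neg]))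
  | .box => (emits [.box, .neg, .lpar]).seq (emitMain.seq (emits [.and, .neg]))
  | .rpar => (emit .rpar).seq ((inc .pos).seq (emitClosers.seq decPos))
  | .zero => (emit .zero).seq afterDigit
  | .one => (emit .one).seq afterDigit
  | a => emit a

def emitTrans : Frag Sym Sym Reg Unit := upLoop .pos emitTransBody ()

/-- Computing the translation of strings. -/
def translate : Frag Sym Sym Reg Unit :=
  valid.bind fun b => if b = true then
    findMain.seq <| emitPrologue.seq <| countFirsts.seq <| emitItems.seq <|
      (downLoop .par (fun _ => emit .rpar) ()).seq <| (emit .and).seq <| emitTrans.seq <|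
      emits [.rpar, .rpar, .rpar]
  else emit .and

end Frag

/-- What is written for an occurrence of the letter `a` after `u` (read backwards) and before `r`,
when the variables are listed. -/
def itemOut (M u : List Sym) (a : Sym) (r : List Sym) : List Sym :=
  if a = .x then
    if digits r ∈ occBefore u (a :: r) then [] else
      if firsts (digits r :: occBefore u (a :: r)) (occ r) = [] then item M (digits r)
      else .lpar :: (item M (digits r) ++ [.and])
  else []

/-- Whether an occurrence is a first one depends on the prefix, and whether its item is the last
depends on the rest, so the conjunction can be written without storing the list of variables. -/
theorem sweepOut_itemOut (M u r : List Sym) :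
    sweepOut (itemOut M) u r = items M (firsts (occBefore u r) (occ r)) := by
  induction r generalizing u with
  | nil => rfl
  | cons a r ih =>
    rw [sweepOut, ih, itemOut, occBefore, occ]
    split_ifs with h1 h2 h3
    · rw [firsts, if_pos h2, List.nil_append]
    · rw [firsts, if_neg h2, h3, items, items, if_pos rfl, List.append_nil]
    · rw [firsts, if_neg h2, items, if_neg h3]
      simp
    · rfl

theorem sweepOut_outAt (M u r : List Sym) : sweepOut (outAt M) u r = trans M u r := by
  induction r generalizing u with
  | nil => rfl
  | cons a r ih => rw [sweepOut, ih, trans]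

theorem firsts_reverse_occBefore (u r : List Sym) :
    firsts [] (occ (u.reverse ++ r)) =
      firsts [] (occBefore u r).reverse ++ firsts (occBefore u r) (occ r) := by
  rw [occ_reverse_append, firsts_append, List.reverse_reverse, List.append_nil]

theorem drop_eq_of_eq_reverse_append {w u r : List Sym} (hw : w = u.reverse ++ r) :
    w.drop u.length = r := by
  rw [hw, ← List.length_reverse, List.drop_left]

theorem drop_succ_eq_of_eq_reverse_append {w u r : List Sym} {a : Sym}
    (hw : w = u.reverse ++ a :: r) : w.drop (u.length + 1) = r := by
  rw [← List.drop_drop, drop_eq_of_eq_reverse_append hw]; rfl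

namespace Spec

variable {w : List Sym} {v : Reg → ℕ}

theorem emitDigitsLoop (l : List Sym) : ∀ v : Reg → ℕ, l = w.drop (v .left) → v .left ≤ w.length →
    ∃ x, Spec Frag.emitDigitsLoop w 0 v () 0 (update v .left x) (digits l) := by
  induction l with
  | nil =>
    intro v hl h1
    have g := get (β := Sym) h1
    rw [← List.head?_drop, ← hl] at g
    refine ⟨v .left, ?_⟩
    rw [Function.update_eq_self]
    exact iter_exit (g.bind (pure _))
  | cons a l ih =>
    intro v hl h1
    have g := get (β := Sym) h1
    rw [← List.head?_drop, ← hl] at g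
    rw [digits_cons]
    split_ifs with ha
    · have hlt : v .left < w.length := by
        by_contra h
        rw [List.drop_eq_nil_of_le (by omega)] at hl
        cases hl
      have hl' : l = w.drop (v .left + 1) := by
        rw [List.drop_eq_getElem_cons hlt] at hl
        exact (List.cons.inj hl).2
      obtain ⟨x, h⟩ := ih (update v .left (v .left + 1)) (by simpa using hl') (by simp; omega)
      refine ⟨x, (iter_loop (e' := ()) (o := [a]) (g.bind (o' := [a]) ?_) h).cast rfl (by simp) rfl⟩
      simp only [List.head?_cons, if_pos ha]
      exact (emit a).seq (seq (inc Reg.left (by omega)) (pure _))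
    · refine ⟨v .left, ?_⟩
      rw [Function.update_eq_self]
      refine iter_exit (g.bind (o' := []) ?_)
      simp only [List.head?_cons, if_neg ha]
      exact pure _

theorem emitDigits (hp : v .pos < w.length) (hv : Clean v) :
    Spec Frag.emitDigits w 0 v () 0 v (digits (w.drop (v .pos + 1))) := by
  have c := copy (β := Sym) (w := w) (v := v) (i := .pos) (j := .left) (t := .tmp) (by simp)
    (by simp) (by simp) hv.tmp (by rw [hv.left]; omega)
  rw [hv.left, zero_add] at c
  have i := inc (β := Sym) (w := w) (p := 0) (v := update v .left (v .pos)) Reg.left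
    (by simp; omega)
  simp only [Function.update_self, Function.update_idem] at i
  obtain ⟨x, h⟩ := emitDigitsLoop (w := w) _ (update v .left (v .pos + 1)) rfl (by simp; omega)
  refine (c.seq (i.seq (h.seq (clear Reg.left)))).cast rfl ?_ (by simp)
  simp only [Function.update_idem]
  exact update_zero hv.left

theorem emitItem (hp : v .pos < w.length) (hv : Clean v) :
    Spec Frag.emitItem w 0 v () 0 v
      (item (Formula.var (v .main)).str (digits (w.drop (v .pos + 1)))) := by
  have d := emitDigits hp hv
  have m := emitMain (w := w) (v := v)
  exact ((emits _).seq (m.seq ((emits _).seq (d.seq ((emits _).seq (m.seq ((emits _).seq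
    (d.seq (emits _))))))))).cast rfl rfl (by simp [item])

theorem emitPrologue :
    Spec Frag.emitPrologue w 0 v () 0 v (prologue (Formula.var (v .main)).str) := by
  have m := emitMain (w := w) (v := v)
  exact ((emits _).seq (m.seq ((emits _).seq (m.seq ((emits _).seq (m.seq
    (emits _))))))).cast rfl rfl (by simp [prologue])

theorem countFirsts (h0 : v .pos = 0) (hc : v .cnt = 0) (hv : Clean v) :
    Spec Frag.countFirsts w 0 v () 0 (update v .cnt (firsts [] (occ w)).length) [] := by
  -- The number of distinct variables in the prefix read so far; it bounds and describes `cnt`.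
  let C : List Sym → ℕ := fun u => (firsts [] (occBefore u (w.drop u.length)).reverse).length
  have hC : ∀ u r, w = u.reverse ++ r → C u ≤ w.length := by
    intro u r hw
    have h1 := firsts_reverse_occBefore u r
    rw [← hw] at h1
    have h2 := (firsts_length_le [] (occ w)).trans (occ_length_le w)
    rw [h1, List.length_append] at h2
    simp only [C, drop_eq_of_eq_reverse_append hw]
    omega
  have hl := upLoop (w := w) (i := .pos) (F := Frag.countFirstsBody) (fun _ => ())
    (fun u => update (update v .cnt (C u)) .pos u.length) (fun _ _ _ => []) (by simp)
    (fun u a r hw => by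
      have hr := drop_eq_of_eq_reverse_append hw
      have hr' := drop_succ_eq_of_eq_reverse_append hw
      rw [Function.update_idem, Frag.countFirstsBody]
      have hC' : C (a :: u) = C u +
          if a = .x then if digits r ∈ occBefore u (a :: r) then 0 else 1 else 0 := by
        simp only [C, List.length_cons, hr, hr', occBefore]
        split_ifs with h1 h2
        · simp [firsts_append, firsts, h2]
        · simp [firsts_append, firsts, h2]
        · rfl
      split_ifs at hC' ⊢ with h1 h2
      · subst h1
        refine ((seen (β := Sym) hw (by simp) ((hv.cnt (C u)).pos u.length)).bind (o' := []) ?_)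
        rw [if_pos (by simpa using h2), hC']
        exact pure ()
      · subst h1
        refine ((seen (β := Sym) hw (by simp) ((hv.cnt (C u)).pos u.length)).bind (o' := []) ?_)
        rw [if_neg (by simpa using h2), hC']
        refine (inc Reg.cnt ?_).cast rfl ?_ rfl
        · have := hC u _ hw
          simp; omega
        · funext i
          cases i <;> simp
      · rw [hC']
        exact pure ()) [] w rfl
  have hs : update (update v .cnt (C [])) .pos ([] : List Sym).length = v := by
    simp only [C, occBefore, List.reverse_nil, firsts, List.length_nil]
    rw [update_zero hc, update_zero h0]
  have hK : C w.reverse = (firsts [] (occ w)).length := by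
    have h1 := firsts_reverse_occBefore w.reverse []
    rw [List.reverse_reverse, List.append_nil] at h1
    simp [C, h1, occ, firsts]
  rw [sweepOut_nil, hs, hK] at hl
  refine (hl.seq (clear Reg.pos)).cast rfl ?_ rfl
  rw [Function.update_idem]
  exact update_zero (by simpa using h0)

theorem emitItems (h0 : v .pos = 0) (hc : v .cnt = (firsts [] (occ w)).length) (hp : v .par = 0)
    (hv : Clean v) : Spec Frag.emitItems w 0 v () 0
      (update (update v .cnt 0) .par ((firsts [] (occ w)).length - 1))
      (items (Formula.var (v .main)).str (firsts [] (occ w))) := by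
  set K := (firsts [] (occ w)).length with hK
  let N : List Sym → ℕ := fun u =>
    (firsts (occBefore u (w.drop u.length)) (occ (w.drop u.length))).length
  have hKw : K ≤ w.length := (firsts_length_le [] (occ w)).trans (occ_length_le w)
  have hN : ∀ u r, w = u.reverse ++ r → N u ≤ K := by
    intro u r hw
    have h1 := firsts_reverse_occBefore u r
    rw [← hw] at h1
    simp only [N, hK, h1, drop_eq_of_eq_reverse_append hw, List.length_append]
    omega
  have hl := upLoop (w := w) (i := .pos) (F := Frag.emitItemsBody) (fun _ => ())
    -- Tape `par` counts the items that opened a parenthesis, which are all but the last. The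
    -- truncated subtraction `N u - 1` keeps it at `K - 1` when the last item takes `N u` from `1`
    -- to `0`.
    (fun u => update (update (update v .cnt (N u)) .par (K - 1 - (N u - 1))) .pos u.length)
    (itemOut (Formula.var (v .main)).str) (by simp)
    (fun u a r hw => by
      have hr := drop_eq_of_eq_reverse_append hw
      have hr' := drop_succ_eq_of_eq_reverse_append hw
      rw [Function.update_idem, Frag.emitItemsBody, itemOut]
      have hN' : N u = N (a :: u) +
          if a = .x then if digits r ∈ occBefore u (a :: r) then 0 else 1 else 0 := by
        simp only [N, List.length_cons, hr, hr', occBefore, occ]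
        split_ifs with h1 h2
        · simp [firsts, h2]
        · simp [firsts, h2]
        · rfl
      have hlen : u.length < w.length := by simp [hw]
      split_ifs at hN' ⊢ with h1 h2 h3
      · subst h1
        refine ((seen (β := Sym) hw (by simp)
          (((hv.cnt _).par _).pos u.length)).bind (o' := []) ?_)
        rw [if_pos (by simpa using h2), hN']
        exact pure ()
      · subst h1
        refine ((seen (β := Sym) hw (by simp)
          (((hv.cnt _).par _).pos u.length)).bind (o := []) ?_)
        have hz : N (.x :: u) = 0 := by
          simp only [N, List.length_cons, hr', occBefore, if_true, h3, List.length_nil]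
        rw [if_neg (by simpa using h2), hN', hz]
        refine (dec_succ (k := 0) (by simp)).bind (o := []) ((test Reg.cnt).bind (o := []) ?_)
        rw [if_neg (by simp)]
        refine (emitItem ?_ ?_).cast rfl ?_ ?_
        · simpa using hlen
        · exact (((hv.cnt _).par _).pos _).cnt _
        · funext i
          cases i <;> simp
        · simp [hr', item]
      · subst h1
        refine ((seen (β := Sym) hw (by simp)
          (((hv.cnt _).par _).pos u.length)).bind (o := []) ?_)
        have hz : N (.x :: u) ≠ 0 := by
          simp only [N, List.length_cons, hr', occBefore, if_true]
          simpa using h3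
        have hle := hN u _ hw
        rw [if_neg (by simpa using h2)]
        refine (dec_succ (k := N (.x :: u)) (by simp [hN'])).bind (o := [])
          ((test Reg.cnt).bind (o := []) ?_)
        rw [if_pos (by simpa using hz)]
        refine ((emit _).seq ((emitItem ?_ ?_).seq ((emit _).seq (inc Reg.par ?_)))).cast rfl ?_ ?_
        · simpa using hlen
        · exact (((hv.cnt _).par _).pos _).cnt _
        · simp; omega
        · funext i
          cases i <;> simp
          omega
        · simp [hr']
      · rw [hN']
        exact pure ()) [] w rfl
  have hN0 : N [] = K := rfl
  have hNw : N w.reverse = 0 := by simp [N, occ, firsts]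
  have hs : update (update (update v .cnt (N [])) .par (K - 1 - (N [] - 1))) .pos
      ([] : List Sym).length = v := by
    rw [hN0]
    funext i
    cases i <;> simp [h0, hc, hp]
  rw [sweepOut_itemOut] at hl
  rw [hs] at hl
  refine (hl.seq (clear Reg.pos)).cast rfl ?_ (by simp [occBefore])
  rw [hNw]
  funext i
  cases i <;> simp [h0]

theorem emitClosers {u r : List Sym} (hw : w = u.reverse ++ r) (hp : v .pos = u.length)
    (hv : Clean v) : Spec Frag.emitClosers w 0 v () 0 v (closers u) :=
  ((backScan closeStep .start hw hp hv.scan hv.ctr hv.tmp).bind (pure ())).cast rfl rfl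
    (List.append_nil _)

theorem decPos {k : ℕ} : Spec Frag.decPos w 0 (update v .pos (k + 1)) () 0 (update v .pos k) [] :=
  ((dec_succ (k := k) (by simp)).bind (pure ())).cast rfl (by simp) rfl

theorem afterDigit {u r : List Sym} {a : Sym} (hw : w = u.reverse ++ a :: r) (hv : Clean v) :
    Spec Frag.afterDigit w 0 (update v .pos u.length) () 0 (update v .pos u.length)
      (if r.head?.any Sym.isDigit then [] else closers (a :: u)) := by
  have i := inc (β := Sym) (w := w) (p := 0) (v := update v .pos u.length) Reg.pos
    (by simp [hw]; omega)
  simp only [Function.update_self, Function.update_idem] at i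
  have g := get (β := Sym) (w := w) (v := update v .pos (u.length + 1)) (i := Reg.pos)
    (by simp [hw])
  rw [Function.update_self, ← List.head?_drop, drop_succ_eq_of_eq_reverse_append hw] at g
  refine i.seq (o := []) (g.bind (o := [])
    (o' := if r.head?.any Sym.isDigit then [] else closers (a :: u)) ?_)
  split_ifs
  · exact decPos
  · exact ((emitClosers (u := a :: u) (by simpa using hw) (by simp) (hv.pos _)).seq decPos).cast
      rfl rfl (List.append_nil _)

theorem emitTrans (h0 : v .pos = 0) (hv : Clean v) : Spec Frag.emitTrans w 0 v () 0
    (update v .pos w.length) (trans (Formula.var (v .main)).str [] w) := by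
  have hl := upLoop (w := w) (i := .pos) (F := Frag.emitTransBody) (fun _ => ())
    (fun u => update v .pos u.length) (outAt (Formula.var (v .main)).str) (by simp)
    (fun u a r hw => by
      rw [Function.update_idem]
      have m := emitMain (w := w) (v := update v .pos u.length)
      rw [Function.update_of_ne (by simp)] at m
      cases a with
      | K => exact (emits _).seq (m.seq (emits _))
      | box => exact (emits _).seq (m.seq (emits _))
      | zero => exact (emit _).seq (afterDigit hw hv)
      | one => exact (emit _).seq (afterDigit hw hv)
      | rpar =>
        have i := inc (β := Sym) (w := w) (p := 0) (v := update v .pos u.length) Reg.pos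
          (by simp [hw]; omega)
        simp only [Function.update_self, Function.update_idem] at i
        exact ((emit _).seq (i.seq ((emitClosers (u := .rpar :: u) (by simpa using hw) (by simp)
          (hv.pos _)).seq decPos))).cast rfl rfl (by simp [outAt])
      | lpar => exact emit _
      | neg => exact emit _
      | and => exact emit _
      | x => exact emit _) [] w rfl
  rw [sweepOut_outAt, List.length_nil, update_zero h0, List.length_reverse] at hl
  exact hl

theorem emitPar (k : ℕ) : ∀ v : Reg → ℕ, v .par = k →
    Spec (Frag.downLoop .par (fun _ => Frag.emit Sym.rpar) ()) w 0 v () 0 (update v .par 0)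
      (List.replicate k .rpar) := by
  induction k with
  | zero =>
    intro v h
    rw [update_zero h]
    exact downLoop_exit h
  | succ k ih =>
    intro v h
    exact (downLoop_step h (emit Sym.rpar) (ih (update v .par k) (by simp))).cast rfl (by simp) rfl

/-- The phases communicate only through numbers: `main` is found first and kept, `cnt` is spent on
listing the variables, and `par` carries the `K - 1` closing parentheses to the end of the list.
Their outputs concatenate as in `str_That`. -/
theorem translate_str (φ : Formula) :
    ∃ v, Spec Frag.translate φ.str 0 (fun _ => 0) () 0 v φ.That.str := by
  have hv : Clean fun _ => 0 := ⟨rfl, rfl, rfl, rfl, rfl, rfl⟩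
  have h1 := valid (β := Sym) (w := φ.str) (v := fun _ => 0) rfl rfl rfl rfl
  rw [(accepts_iff φ.str).2 ⟨φ, rfl⟩] at h1
  have h2 := findMain (β := Sym) φ (v := fun _ => 0) rfl rfl rfl (Nat.zero_le _)
  set v₂ : Reg → ℕ := update (fun _ => 0) .main φ.mainIdx with hv₂
  have h3 := emitPrologue (w := φ.str) (v := v₂)
  have h4 := countFirsts (w := φ.str) (v := v₂) (by simp [hv₂]) (by simp [hv₂]) (hv.main _)
  set K := (firsts [] (occ φ.str)).length with hK
  have h5 := emitItems (w := φ.str) (v := update v₂ .cnt K) (by simp [hv₂]) (by simp [hK])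
    (by simp [hv₂]) ((hv.main _).cnt _)
  rw [← hK] at h5
  have h6 := emitPar (w := φ.str) (K - 1) (update (update (update v₂ .cnt K) .cnt 0) .par (K - 1))
    (by simp)
  have h7 := emitTrans (w := φ.str)
    (v := update (update (update (update v₂ .cnt K) .cnt 0) .par (K - 1)) .par 0) (by simp [hv₂])
    (((((hv.main _).cnt _).cnt _).par _).par _)
  rw [str_That]
  have hmain : v₂ .main = φ.mainIdx := by simp [hv₂]
  simp only [Function.update_of_ne (show Reg.main ≠ .cnt by simp),
    Function.update_of_ne (show Reg.main ≠ .par by simp), hmain] at h3 h5 h7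
  have h8 := h2.seq (h3.seq (h4.seq (h5.seq (h6.seq ((emit Sym.and).seq
    (h7.seq (emits [Sym.rpar, .rpar, .rpar])))))))
  exact ⟨_, h1.bind (o := []) (by rw [if_pos rfl]; exact h8)⟩

theorem translate_of_notMem (hw : w ∉ formulaLanguage) :
    Spec Frag.translate w 0 (fun _ => 0) () 0 (fun _ => 0) [.and] := by
  have h1 := valid (β := Sym) (w := w) (v := fun _ => 0) rfl rfl rfl rfl
  rw [← accepts_iff, Bool.not_eq_true] at hw
  rw [hw] at h1
  refine h1.bind (o := []) ?_
  rw [if_neg (by simp)]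
  exact emit _

end Spec

theorem logspaceComputable_stringTranslation : LogspaceComputable stringTranslation := by
  refine logspaceComputable_of_spec Frag.translate fun w => ?_
  by_cases hw : w ∈ formulaLanguage
  · obtain ⟨φ, rfl⟩ := hw
    obtain ⟨v, h⟩ := Spec.translate_str φ
    exact ⟨0, v, by rwa [stringTranslation_str]⟩
  · exact ⟨0, _, by rw [stringTranslation_of_notMem hw]; exact Spec.translate_of_notMem hw⟩

end Bimodal
theorem mainTheorem4 :
    -- correctness of the translation
    (∀ φ : Bimodal.Formula,
      (Bimodal.SSLSatisfiable φ ↔ Bimodal.S4S5Satisfiable φ.That) ∧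
      (Bimodal.SSLSatisfiable φ ↔ Bimodal.S4S5CommutatorSatisfiable φ.That)) ∧
    -- well-formedness is decidable in logarithmic space
    Bimodal.LogspaceDecidable Bimodal.formulaLanguage ∧
    -- the translation of strings is given by the translation of formulas, and it is computable
    -- in logarithmic space
    (∀ φ : Bimodal.Formula, Bimodal.stringTranslation φ.str = φ.That.str) ∧
    Bimodal.LogspaceComputable Bimodal.stringTranslation ∧
    -- it is a reduction of the satisfiability problems
    (∀ w : List Bimodal.Sym, w ∈ Bimodal.satProblem Bimodal.SSLSatisfiable ↔
      Bimodal.stringTranslation w ∈ Bimodal.satProblem Bimodal.S4S5Satisfiable) ∧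
    Bimodal.LogspaceReducible (Bimodal.satProblem Bimodal.SSLSatisfiable)
      (Bimodal.satProblem Bimodal.S4S5Satisfiable) :=
  ⟨Bimodal.ssl_iff_s4s5, Bimodal.logspaceDecidable_formulaLanguage, Bimodal.stringTranslation_str,
    Bimodal.logspaceComputable_stringTranslation, Bimodal.mem_satProblem_iff,
    Bimodal.stringTranslation, Bimodal.logspaceComputable_stringTranslation,
    Bimodal.mem_satProblem_iff⟩
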